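/- **Theorem.** Let $N\ge 3$ be an integer, let $q$ be a nonzero complex number with $q^m\neq 1$ for all integers $m\ge 1$, and let $c^2$ be a nonzero real number. Put $q_\pm=q\pm q^{-1}$, $i'=N+1-i$, $[m]=\frac{1-q^{-4m}}{1-q^{-4}}$, and for $1\le i\le N$ put $\rho_i=\frac N2-i$ if $i<i'$, $\rho_i=-(\frac N2-i')$ if $i>i'$, $\rho_i=0$ if $i=i'$. Let $$C^{ij}=C_{ij}=q^{-2\rho_i}\delta_{ij'},\qquad K^{ij}_{kl}=C^{ij}C_{kl},$$ $$\hat R^{ij}_{kl}=q^{2\delta_{ij}-2\delta_{ij'}}\delta_{il}\delta_{jk}+(q^2-q^{-2})\delta_{i<l}\,(\delta_{ik}\delta_{jl}-K^{ij}_{kl}),$$ $$P_+=\frac{1}{q^2+q^{-2}}\Bigl(q^{-2}\,\mathrm{id}+\hat R-\frac{q_+q_-}{q^{2N}-1}K\Bigr),$$ where $\delta_{i<l}=1$ if $i<l$ and $\delta_{i<l}=0$ otherwise. The FRT–Clifford algebra $\mathrm{Cl}_q(N)$ is the complex unital algebra with generators $\gamma_1,\dots,\gamma_N$ and relations $$\sum_{k,l}(P_+)^{kl}_{ij}\gamma_k\gamma_l=0\quad(1\le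 i,j\le N),\qquad \sum_{i,j}C^{ij}\gamma_i\gamma_j=c^2\,\frac{q^{2N}-1}{q^2-1},$$ and the $q$-exterior algebra $\Lambda(O_q^N)$, with product $\wedge$, is the algebra defined in the same way with $0$ in place of $c^2$. Let $V$ be the complex vector space with basis $\gamma_1,\dots,\gamma_N$, and let $\hat R_{p,p+1}$, $K_{p,p+1}$ denote $\hat R$, $K$ acting in the $p$-th and $(p+1)$-st factors of a tensor power of $V$. On $V^{\otimes(k+1)}$, $k\ge 0$, define (as images of elements of a Birman–Wenzl–Murakami algebra) $$d'^-_{k+1,i}=K_{12}K_{23}\cdots K_{k-i+1,k-i+2}\sum_{j=0}^{i-1}(-q^{-2})^j\prod_{l=1}^{j}\hat R_{k-i+1+l,k-i+2+l}\qquad(1\le i\le k),$$ $$b^-_{1,k}=\sum_{i=0}^k(-q^{-2})^i\hat R_{12}\hat R_{23}\cdots\hat R_{i,i+1}-\frac{q_+q_-}{1+q^{2N-4k}}\sum_{i=1}^kq^{4i-4k-2}d'^-_{k+1,i},$$ and the antisymmetrizers $A_0=\mathrm{id}$, $A_{k+1}=\frac1{[k+1]}(\mathrm{id}\otimes A_k)\,b^-_{1,k}$.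 Put $V^{\wedge m}=V^{\otimes m}/\ker A_m$. Let $g:V\otimes V\to\mathbb C$ be the linear form with $$g(\gamma_i\otimes\gamma_j)=\frac{c^2q^{2N-3}q_+}{q^{2N-4}+1}\,C_{ij},$$ and for $t\in V^{\otimes m}$ put $\langle\gamma_i,t\rangle=g_{12}\bigl(\gamma_i\otimes b^-_{1,m-1}(t)\bigr)\in V^{\otimes(m-1)}$ if $m\ge1$, where $g_{12}$ applies $g$ to the first two tensor factors, and $\langle\gamma_i,t\rangle=0$ if $m=0$. Then the canonical maps $V^{\otimes m}\to\Lambda(O_q^N)$, $\gamma_{j_1}\otimes\cdots\otimes\gamma_{j_m}\mapsto\gamma_{j_1}\wedge\cdots\wedge\gamma_{j_m}$, induce injective linear maps $V^{\wedge m}\hookrightarrow\Lambda(O_q^N)$; the contractions $\langle\gamma_i,\cdot\rangle$ induce linear maps from $V^{\wedge m}$ to $V^{\wedge(m-1)}$ if $m\ge 1$, and the zero map if $m=0$; and there exists a representation $\triangleright$ of $\mathrm{Cl}_q(N)$ on $\Lambda(O_q^N)$ such that $$\gamma_i\triangleright\rho_m=\gamma_i\wedge\rho_m+\frac{1+q^{2N-4}}{1+q^{2N-4m}}\,\langle\gamma_i,\rho_m\rangle$$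 for all $i=1,\dots,N$, all integers $m\ge0$ and all $\rho_m\in V^{\wedge m}$. -/

import Mathlib

namespace FRT

noncomputable section

/-- The integer `2 ρ_i`; the index `i` of the usual numbering `1, …, N` is `(i : ℕ) + 1` here, and
`i' = N + 1 - i` is `i.rev`. -/
def twoRho (N : ℕ) (i : Fin N) : ℤ :=
  if i < i.rev then (N : ℤ) - 2 * (((i : ℕ) : ℤ) + 1)
  else if i.rev < i then -((N : ℤ) - 2 * (((i.rev : ℕ) : ℤ) + 1))
  else 0

/-- The metric `C^{ij} = C_{ij} = q^{-2ρ_i} δ_{i j'}`. -/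
def metric (N : ℕ) (q : ℂ) (i j : Fin N) : ℂ :=
  if i = j.rev then q ^ (-twoRho N i) else 0

/-- The matrix `K^{ij}_{kl} = C^{ij} C_{kl}`; rows are the upper, columns the lower indices. -/
def kMat (N : ℕ) (q : ℂ) : Matrix (Fin N × Fin N) (Fin N × Fin N) ℂ :=
  fun x y => metric N q x.1 x.2 * metric N q y.1 y.2

/-- The `R̂`-matrix of `O_q(N)`; rows are the upper, columns the lower indices. -/
def rMat (N : ℕ) (q : ℂ) : Matrix (Fin N × Fin N) (Fin N × Fin N) ℂ :=
  fun x y =>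
    q ^ ((if x.1 = x.2 then 2 else 0) - (if x.1 = x.2.rev then 2 else 0) : ℤ) *
        (if x.1 = y.2 ∧ x.2 = y.1 then 1 else 0) +
      (q ^ 2 - q ^ (-2 : ℤ)) * (if x.1 < y.2 then 1 else 0) *
        ((if x.1 = y.1 ∧ x.2 = y.2 then 1 else 0) - kMat N q x y)

/-- `q₊ = q + q⁻¹`. -/
def qPlus (q : ℂ) : ℂ := q + q⁻¹

/-- `q₋ = q - q⁻¹`. -/
def qMinus (q : ℂ) : ℂ := q - q⁻¹

/-- The projector `P₊`. -/
def pPlus (N : ℕ) (q : ℂ) : Matrix (Fin N × Fin N) (Fin N × Fin N) ℂ :=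
  (1 / (q ^ 2 + q ^ (-2 : ℤ))) •
    (q ^ (-2 : ℤ) • (1 : Matrix (Fin N × Fin N) (Fin N × Fin N) ℂ) + rMat N q -
      (qPlus q * qMinus q / (q ^ (2 * N) - 1)) • kMat N q)

/-- The defining relations of the FRT–Clifford algebra, with the parameter `c²` written `s`:
`(P₊)^{kl}_{ij} γ_k γ_l = 0` for all `i, j`, and `C^{ij} γ_i γ_j = s (q^{2N} - 1) / (q² - 1)`. -/
inductive ClRel (N : ℕ) (q s : ℂ) : FreeAlgebra ℂ (Fin N) → FreeAlgebra ℂ (Fin N) → Prop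
  | plus (i j : Fin N) : ClRel N q s
      (∑ k : Fin N, ∑ l : Fin N,
        pPlus N q (k, l) (i, j) • (FreeAlgebra.ι ℂ k * FreeAlgebra.ι ℂ l)) 0
  | form : ClRel N q s
      (∑ i : Fin N, ∑ j : Fin N,
        metric N q i j • (FreeAlgebra.ι ℂ i * FreeAlgebra.ι ℂ j))
      (algebraMap ℂ (FreeAlgebra ℂ (Fin N)) (s * ((q ^ (2 * N) - 1) / (q ^ 2 - 1))))

/-- The FRT–Clifford algebra `Cl_q(N)` with parameter `c² = s`. -/
abbrev Cl (N : ℕ) (q s : ℂ) : Type := RingQuot (ClRel N q s)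

/-- The generator `γ_i` of `Cl_q(N)`. -/
def gen (N : ℕ) (q s : ℂ) (i : Fin N) : Cl N q s :=
  RingQuot.mkAlgHom ℂ (ClRel N q s) (FreeAlgebra.ι ℂ i)

/-- The `q`-exterior algebra `Λ(O_q^N)`: the case `c = 0`. Its multiplication is `∧`. -/
abbrev Ext (N : ℕ) (q : ℂ) : Type := Cl N q 0

/-- The tensor power `V^{⊗k}` of the space `V` with basis `γ_1, …, γ_N`, in coordinates: `t J` is the
coefficient of `γ_{J 0} ⊗ ⋯ ⊗ γ_{J (k-1)}`. -/
abbrev Tens (N k : ℕ) : Type := (Fin k → Fin N) → ℂ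

/-- The canonical map `V^{⊗k} → Λ(O_q^N)`,
`γ_{j_1} ⊗ ⋯ ⊗ γ_{j_k} ↦ γ_{j_1} ∧ ⋯ ∧ γ_{j_k}`. -/
def toExt (N : ℕ) (q : ℂ) (k : ℕ) : Tens N k →ₗ[ℂ] Ext N q :=
  Fintype.linearCombination ℂ fun J : Fin k → Fin N =>
    (List.ofFn fun a => gen N q 0 (J a)).prod

/-- `M_{p,p+1}`: the operator `M` on `V ⊗ V` acting in the tensor factors number `p` and `p + 1`
(counted from `1`) of `V^{⊗k}`. It is used only for `1 ≤ p` and `p + 1 ≤ k`. -/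
def onPair {N : ℕ} (M : Matrix (Fin N × Fin N) (Fin N × Fin N) ℂ) (k p : ℕ) :
    Module.End ℂ (Tens N k) :=
  if h : 1 ≤ p ∧ p + 1 ≤ k then
    { toFun := fun t J =>
        ∑ a : Fin N, ∑ b : Fin N,
          M (J ⟨p - 1, by omega⟩, J ⟨p, by omega⟩) (a, b) *
            t (Function.update (Function.update J ⟨p - 1, by omega⟩ a) ⟨p, by omega⟩ b)
      map_add' := fun s t => by
        funext J
        simp only [Pi.add_apply, mul_add, Finset.sum_add_distrib]
      map_smul' := fun r t => by
        funext J
        simp only [Pi.smul_apply, smul_eq_mul, RingHom.id_apply, Finset.mul_sum]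
        exact Finset.sum_congr rfl fun a _ => Finset.sum_congr rfl fun b _ => by ring }
  else 1

/-- The operator `id ⊗ A` on `V ⊗ V^{⊗k} = V^{⊗(k+1)}`. -/
def idTensor {N k : ℕ} (A : Module.End ℂ (Tens N k)) : Module.End ℂ (Tens N (k + 1)) where
  toFun t J := A (fun L => t (Fin.cons (J 0) L)) (Fin.tail J)
  map_add' s t := by
    funext J
    exact congrFun (A.map_add (fun L => s (Fin.cons (J 0) L)) fun L => t (Fin.cons (J 0) L))
      (Fin.tail J)
  map_smul' r t := by
    funext J
    exact congrFun (A.map_smul r fun L => t (Fin.cons (J 0) L)) (Fin.tail J)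

/-- The `q`-number `[m] = (1 - q^{-4m}) / (1 - q^{-4})`. -/
def qNum (q : ℂ) (m : ℕ) : ℂ := (1 - q ^ (-4 * (m : ℤ))) / (1 - q ^ (-4 : ℤ))

/-- The element `d'⁻_{k+1,i}`, `1 ≤ i ≤ k`, of the Birman–Wenzl–Murakami algebra, acting on
`V^{⊗(k+1)}`. -/
def dPrime (N : ℕ) (q : ℂ) (k i : ℕ) : Module.End ℂ (Tens N (k + 1)) :=
  ((List.range (k - i + 1)).map fun a => onPair (kMat N q) (k + 1) (a + 1)).prod *
    ∑ j ∈ Finset.range i, (-q ^ (-2 : ℤ)) ^ j •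
      ((List.range j).map fun a => onPair (rMat N q) (k + 1) (k - i + 1 + (a + 1))).prod

/-- The element `b⁻_{1,k}` of the Birman–Wenzl–Murakami algebra, acting on `V^{⊗(k+1)}`. -/
def bMinus (N : ℕ) (q : ℂ) (k : ℕ) : Module.End ℂ (Tens N (k + 1)) :=
  (∑ i ∈ Finset.range (k + 1), (-q ^ (-2 : ℤ)) ^ i •
      ((List.range i).map fun a => onPair (rMat N q) (k + 1) (a + 1)).prod) -
    (qPlus q * qMinus q / (1 + q ^ (2 * (N : ℤ) - 4 * (k : ℤ)))) •
      ∑ i ∈ Finset.Icc 1 k, q ^ (4 * (i : ℤ) - 4 * (k : ℤ) - 2) • dPrime N q k i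

/-- The antisymmetrizer `A_k` acting on `V^{⊗k}`: `A_0 = id` and
`A_{k+1} = (id ⊗ A_k) b⁻_{1,k} / [k+1]`, whence `A_1 = id` and `A_2 = P₋`. -/
def antisym (N : ℕ) (q : ℂ) : (k : ℕ) → Module.End ℂ (Tens N k)
  | 0 => 1
  | k + 1 => (1 / qNum q (k + 1)) • (idTensor (antisym N q k) * bMinus N q k)

/-- The exterior power `V^{∧k} = V^{⊗k} / ker A_k`. -/
abbrev ExtPow (N : ℕ) (q : ℂ) (k : ℕ) : Type := Tens N k ⧸ LinearMap.ker (antisym N q k)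

/-- The bilinear form `g(γ_i ⊗ γ_j) = c² q^{2N-3} q₊ C_{ij} / (q^{2N-4} + 1)`, with `s = c²`. -/
def gForm (N : ℕ) (q s : ℂ) (i j : Fin N) : ℂ :=
  s * q ^ (2 * (N : ℤ) - 3) * qPlus q * metric N q i j / (q ^ (2 * (N : ℤ) - 4) + 1)

/-- The map `g₁₂(γ_i ⊗ ·) : V^{⊗(k+1)} → V^{⊗k}`. -/
def gFirst (N : ℕ) (q s : ℂ) (i : Fin N) (k : ℕ) : Tens N (k + 1) →ₗ[ℂ] Tens N k where
  toFun t L := ∑ j : Fin N, gForm N q s i j * t (Fin.cons j L)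
  map_add' x y := by
    funext L
    simp only [Pi.add_apply, mul_add, Finset.sum_add_distrib]
  map_smul' r x := by
    funext L
    simp only [Pi.smul_apply, smul_eq_mul, RingHom.id_apply, Finset.mul_sum]
    exact Finset.sum_congr rfl fun a _ => by ring

/-- The contraction `⟨γ_i, ·⟩ : V^{⊗m} → V^{⊗ max(0, m-1)}`: it is `0` for `m = 0` and
`⟨γ_i, t⟩ = g₁₂(γ_i ⊗ b⁻_{1,m-1}(t))` for `m ≥ 1`. -/
def contract (N : ℕ) (q s : ℂ) (i : Fin N) : (m : ℕ) → Tens N m →ₗ[ℂ] Tens N (m - 1)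
  | 0 => 0
  | m + 1 => gFirst N q s i m ∘ₗ bMinus N q m

end

end FRT

/-! Let I_k ⊆ V^{⊗k} be the degree k part of the ideal generated by the image of R̂ + q⁻²
(`relSub`). The heart of the matter is ker A_k = I_k (`ker_antisym`); both the embedding into Λ and
the descent of the contractions follow from it.

The matrices R̂ and K satisfy the Birman–Wenzl–Murakami relations: R̂ K = ν K, a quadratic relation
(`rMat_mul_rMat`), crossing symmetry (`metric_mul_rMat`) and the braid relation (`braid`). Except
for crossing symmetry, which is checked on entries, they are proved by induction from N to N + 2:
deleting the first and last index leaves the same matrices, and on the outer indices R̂ is nearly a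
permutation.

Write b⁻_{1,k} = S_k - c_k U_k, with S_k the braided sum and U_k the part that starts with K₁₂.
Modulo I_{k+1} every leading R̂ is -q⁻² and every leading K is 0, so b⁻_{1,k} acts as [k+1]
(`mkQ_bMinus`). Hence A_k is the identity modulo I_k, and ker A_k ⊆ I_k. Conversely b⁻_{1,k} maps
I_{k+1} into V ⊗ I_k (`bMinus_mem`): on a relation, S_k and U_k are both multiples of one tensor
K₁₂z modulo V ⊗ I_k, and c_k is exactly the ratio of the multiples (`exists_braidSum_cupSum`,
`cupCoeff_mul_cupWeight`). So A_k kills I_k. The same argument for the transpose gives A_k = A_kᵗ,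
whence R̂₁₂A_k = -q⁻²A_k and K₁₂A_k = 0.

The operators γ_i ∧ · + coefficient · ⟨γ_i, ·⟩ are defined on ⨁ V^{∧m}. A quadratic Clifford
relation splits into degrees +2, 0 and -2. Degree +2 lies in I. Degree 0 is computed by sliding a
cap through b⁻ (`mkQ_cap_bMinus`), and there the coefficients (1 + q^{2N-4}) / (1 + q^{2N-4m}) are
what makes the terms match (`contrCoeff_eq`, `contrCoeff_loop`). In degree -2, A turns iterated
contractions into plain metric contractions of A t, and the relations of R̂₁₂ and K₁₂ with A finish
the proof.

For c = 0 this representation, applied to the unit, is an inverse of the canonical map ⨁ V^{∧m} → Λ.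
That map is therefore an isomorphism, which yields the injectivity and carries the representation
for general c over to Λ. -/

namespace FRT

/-! ### The metric and the matrices on `V ⊗ V` -/

section Indices

variable {N : ℕ}

/-- The inclusion of the indices of `V_N` as the inner indices of `V_{N+2}`. -/
def inner (i : Fin N) : Fin (N + 2) := i.castSucc.succ

@[simp] theorem rev_inner (i : Fin N) : (inner i).rev = inner i.rev := by
  rw [inner, Fin.rev_succ, Fin.rev_castSucc]; rfl

@[simp] theorem inner_inj {i j : Fin N} : inner i = inner j ↔ i = j := by
  simp [inner]

@[simp] theorem inner_lt_inner {i j : Fin N} : inner i < inner j ↔ i < j := by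
  simp [inner]

@[simp] theorem inner_ne_zero (i : Fin N) : inner i ≠ 0 := by
  simp [inner]

@[simp] theorem zero_ne_inner (i : Fin N) : 0 ≠ inner i := (inner_ne_zero i).symm

@[simp] theorem inner_ne_last (i : Fin N) : inner i ≠ Fin.last (N + 1) := by
  simp [inner, Fin.ext_iff]; omega

@[simp] theorem last_ne_inner (i : Fin N) : Fin.last (N + 1) ≠ inner i := (inner_ne_last i).symm

@[simp] theorem zero_lt_inner (i : Fin N) : 0 < inner i := by
  simp [inner]

@[simp] theorem inner_lt_last (i : Fin N) : inner i < Fin.last (N + 1) := by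
  simp [inner, Fin.lt_def]

@[simp] theorem not_last_lt (x : Fin (N + 2)) : ¬ Fin.last (N + 1) < x := by
  simp [Fin.le_last]

@[simp] theorem zero_ne_last : (0 : Fin (N + 2)) ≠ Fin.last (N + 1) := by
  simp [Fin.ext_iff]

@[simp] theorem last_ne_zero : Fin.last (N + 1) ≠ (0 : Fin (N + 2)) := by
  simp [Fin.ext_iff]

@[simp] theorem zero_lt_last : (0 : Fin (N + 2)) < Fin.last (N + 1) := by
  simp [Fin.lt_def]

theorem index_cases (x : Fin (N + 2)) : x = 0 ∨ x = Fin.last (N + 1) ∨ ∃ i : Fin N, x = inner i := by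
  induction x using Fin.cases with
  | zero => exact Or.inl rfl
  | succ x =>
    induction x using Fin.lastCases with
    | last => exact Or.inr (Or.inl (Fin.succ_last _))
    | cast i => exact Or.inr (Or.inr ⟨i, rfl⟩)

theorem sum_index {M : Type*} [AddCommMonoid M] (f : Fin (N + 2) → M) :
    ∑ x, f x = f 0 + ((∑ i : Fin N, f (inner i)) + f (Fin.last (N + 1))) := by
  rw [Fin.sum_univ_succ, Fin.sum_univ_castSucc, Fin.succ_last]
  rfl

theorem twoRho_rev (i : Fin N) : twoRho N i.rev = -twoRho N i := by
  unfold twoRho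
  rw [Fin.rev_rev]
  split_ifs <;> omega

/-- Since ρ depends only on the distance to the middle of the index range, the inner block of every
matrix below is the same matrix for N. This drives all inductions from N to N + 2. -/
theorem twoRho_inner (i : Fin N) : twoRho (N + 2) (inner i) = twoRho N i := by
  unfold twoRho
  have h : ((inner i : Fin (N + 2)) : ℕ) = i + 1 := by simp [inner]
  have h' : ((inner i.rev : Fin (N + 2)) : ℕ) = i.rev + 1 := by simp [inner]
  simp only [rev_inner, inner_lt_inner, h, h']
  push_cast
  split_ifs <;> ring

theorem twoRho_zero : twoRho (N + 2) 0 = N := by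
  simp [twoRho]

theorem twoRho_last : twoRho (N + 2) (Fin.last (N + 1)) = -N := by
  have := twoRho_rev (0 : Fin (N + 2))
  rwa [Fin.rev_zero, twoRho_zero] at this

end Indices

/-! ### The metric and the value of a closed loop -/

section Metric

variable {N : ℕ} {q : ℂ}

theorem metric_eq (i j : Fin N) :
    metric N q i j = if j = i.rev then q ^ (-twoRho N i) else 0 := by
  unfold metric
  exact if_congr ⟨fun h => by rw [h, Fin.rev_rev], fun h => by rw [h, Fin.rev_rev]⟩ rfl rfl

theorem metric_rev (i : Fin N) : metric N q i i.rev = q ^ (-twoRho N i) := by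
  simp [metric_eq]

theorem rev_metric (i : Fin N) : metric N q i.rev i = q ^ (twoRho N i) := by
  simp [metric_eq, twoRho_rev]

theorem metric_of_ne {i j : Fin N} (h : j ≠ i.rev) : metric N q i j = 0 := by
  simp [metric_eq, h]

theorem metric_rev_mul (hq : q ≠ 0) (i : Fin N) :
    metric N q i i.rev * metric N q i.rev i = 1 := by
  rw [metric_rev, rev_metric, ← zpow_add₀ hq]; simp

theorem metric_inner (i j : Fin N) : metric (N + 2) q (inner i) (inner j) = metric N q i j := by
  simp [metric_eq, twoRho_inner]

@[simp] theorem metric_zero_inner (i : Fin N) : metric (N + 2) q 0 (inner i) = 0 := by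
  simp [metric_eq]

@[simp] theorem metric_inner_zero (i : Fin N) : metric (N + 2) q (inner i) 0 = 0 := by
  simp [metric_eq]

@[simp] theorem metric_last_inner (i : Fin N) :
    metric (N + 2) q (Fin.last (N + 1)) (inner i) = 0 := by
  simp [metric_eq]

@[simp] theorem metric_inner_last (i : Fin N) :
    metric (N + 2) q (inner i) (Fin.last (N + 1)) = 0 := by
  simp [metric_eq]

@[simp] theorem metric_zero_zero : metric (N + 2) q 0 0 = 0 := by
  simp [metric_eq]

@[simp] theorem metric_last_last :
    metric (N + 2) q (Fin.last (N + 1)) (Fin.last (N + 1)) = 0 := by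
  simp [metric_eq]

theorem metric_zero_last : metric (N + 2) q 0 (Fin.last (N + 1)) = q ^ (-N : ℤ) := by
  simp [metric_eq, twoRho_zero]

theorem metric_last_zero : metric (N + 2) q (Fin.last (N + 1)) 0 = q ^ (N : ℤ) := by
  simp [metric_eq, twoRho_last]

theorem sum_metric_mul (i : Fin N) (f : Fin N → ℂ) :
    ∑ j, metric N q i j * f j = metric N q i i.rev * f i.rev := by
  rw [Finset.sum_eq_single i.rev]
  · intro j _ hj; rw [metric_of_ne hj, zero_mul]
  · simp

theorem sum_metric_mul' (j : Fin N) (f : Fin N → ℂ) :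
    ∑ i, metric N q i j * f i = metric N q j.rev j * f j.rev := by
  rw [Finset.sum_eq_single j.rev]
  · intro i _ hi
    rw [metric_of_ne (by rintro rfl; simp at hi), zero_mul]
  · simp

/-- `Q - Q⁻¹` for `Q = q²`. -/
noncomputable def lam (q : ℂ) : ℂ := q ^ 2 - q ^ (-2 : ℤ)

theorem lam_ne_zero (hq : q ≠ 0) (hq4 : q ^ 4 ≠ 1) : lam q ≠ 0 := by
  rw [lam, zpow_neg]
  intro h
  apply hq4
  field_simp at h
  norm_cast at h
  linear_combination h

/-- The value `∑ C^{ij} C_{ij}` of a closed loop. -/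
noncomputable def loop (N : ℕ) (q : ℂ) : ℂ := ∑ i, ∑ j, metric N q i j * metric N q i j

theorem loop_add_two : loop (N + 2) q =
    loop N q + q ^ (N : ℤ) * q ^ (N : ℤ) + q ^ (-N : ℤ) * q ^ (-N : ℤ) := by
  simp only [loop, sum_index, metric_inner, metric_zero_inner, metric_inner_zero,
    metric_last_inner, metric_inner_last, metric_zero_zero, metric_last_last, metric_zero_last,
    metric_last_zero, mul_zero, zero_add, Finset.sum_const_zero, add_zero]
  ring

/-- Two outer indices add q^{2N} + q^{-2N} to the loop, and after multiplication by q² - q⁻² these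
contributions telescope. -/
theorem lam_mul_loop (hq : q ≠ 0) : ∀ N : ℕ,
    lam q * loop N q = lam q + (q ^ (2 * (N : ℤ) - 2) - q ^ (2 - 2 * (N : ℤ)))
  | 0 => by simp [loop, lam]
  | 1 => by simp [loop, metric_eq, twoRho]
  | N + 2 => by
    have e1 : q ^ (2 * ((N + 2 : ℕ) : ℤ) - 2) = q ^ (N : ℤ) * q ^ (N : ℤ) * q ^ 2 := by
      rw [← zpow_add₀ hq, ← zpow_natCast q 2, ← zpow_add₀ hq]; congr 1; push_cast; ring
    have e2 : q ^ (2 - 2 * ((N + 2 : ℕ) : ℤ)) = q ^ (-N : ℤ) * q ^ (-N : ℤ) * q ^ (-2 : ℤ) := by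
      rw [← zpow_add₀ hq, ← zpow_add₀ hq]; congr 1; push_cast; ring
    have e3 : q ^ (2 * (N : ℤ) - 2) = q ^ (N : ℤ) * q ^ (N : ℤ) * q ^ (-2 : ℤ) := by
      rw [← zpow_add₀ hq, ← zpow_add₀ hq]; congr 1; ring
    have e4 : q ^ (2 - 2 * (N : ℤ)) = q ^ (-N : ℤ) * q ^ (-N : ℤ) * q ^ 2 := by
      rw [← zpow_add₀ hq, ← zpow_natCast q 2, ← zpow_add₀ hq]; congr 1; push_cast; ring
    rw [loop_add_two, e1, e2, mul_add, mul_add, lam_mul_loop hq N, e3, e4, lam]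
    ring

end Metric

/-! ### Entries, symmetry and crossing of R̂ -/

section RMatrix

variable {N : ℕ} {q : ℂ}

theorem kMat_apply (i j k l : Fin N) :
    kMat N q (i, j) (k, l) = metric N q i j * metric N q k l := rfl

theorem rMat_apply (i j k l : Fin N) : rMat N q (i, j) (k, l) =
    q ^ ((if i = j then 2 else 0) - (if j = i.rev then 2 else 0) : ℤ) *
        (if i = l ∧ j = k then 1 else 0) +
      lam q * (if i < l then 1 else 0) *
        ((if i = k ∧ j = l then 1 else 0) - metric N q i j * metric N q k l) := by
  have h : (i = j.rev) = (j = i.rev) := propext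
    ⟨fun h => by rw [h, Fin.rev_rev], fun h => by rw [h, Fin.rev_rev]⟩
  simp only [rMat, kMat_apply, lam, h]

theorem transpose_kMat : (kMat N q).transpose = kMat N q := by
  ext ⟨i, j⟩ ⟨k, l⟩
  simp [kMat_apply, mul_comm]

/-- In the K-term the condition i < k' is equivalent to k < i'. Symmetry lets later identities be
transposed, and vanishing columns be turned into vanishing rows. -/
theorem transpose_rMat : (rMat N q).transpose = rMat N q := by
  ext ⟨i, j⟩ ⟨k, l⟩
  rw [Matrix.transpose_apply, rMat_apply, rMat_apply]
  by_cases h : k = j ∧ l = i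
  · obtain ⟨rfl, rfl⟩ := h
    by_cases h1 : k = l
    · subst h1; simp
    · have h2 : (l = k.rev) = (k = l.rev) := propext
        ⟨fun h => by rw [h, Fin.rev_rev], fun h => by rw [h, Fin.rev_rev]⟩
      simp [h1, Ne.symm h1, h2, mul_comm]
  · have h' : ¬ (i = l ∧ j = k) := fun h1 => h ⟨h1.2.symm, h1.1.symm⟩
    rw [if_neg h, if_neg h', mul_zero, mul_zero, zero_add, zero_add]
    by_cases h1 : k = i ∧ l = j
    · obtain ⟨rfl, rfl⟩ := h1; ring
    · have h1' : ¬ (i = k ∧ j = l) := fun h1' => h1 ⟨h1'.1.symm, h1'.2.symm⟩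
      rw [if_neg h1, if_neg h1']
      by_cases h2 : j = i.rev
      · by_cases h3 : l = k.rev
        · subst h2 h3
          have : (k < i.rev) = (i < k.rev) := propext (Fin.lt_rev_iff)
          simp only [this]; ring
        · rw [metric_of_ne h3]; ring
      · rw [metric_of_ne h2]; ring

/-- The inverse of the `R̂`-matrix. -/
noncomputable def rInv (N : ℕ) (q : ℂ) : Matrix (Fin N × Fin N) (Fin N × Fin N) ℂ :=
  rMat N q - lam q • (1 - kMat N q)

theorem rInv_apply (i j k l : Fin N) : rInv N q (i, j) (k, l) = rMat N q (i, j) (k, l) -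
    lam q * ((if i = k ∧ j = l then 1 else 0) - metric N q i j * metric N q k l) := by
  simp [rInv, kMat_apply, Matrix.one_apply]

/-- A quarter turn by the metric exchanges the identity of V ⊗ V with K. This and the next lemma are
the two directions. -/
theorem metric_mul_one (hq : q ≠ 0) (j k l m : Fin N) :
    metric N q k k.rev * (if k.rev = l ∧ j = m then 1 else 0) =
      metric N q j m.rev * metric N q k l * metric N q m.rev m := by
  by_cases h1 : l = k.rev
  · by_cases h2 : j = m
    · subst h1 h2
      rw [if_pos ⟨rfl, rfl⟩, mul_right_comm, metric_rev_mul hq]; ring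
    · rw [if_neg (fun h => h2 h.2), metric_of_ne (i := j)
        (fun h => h2 (Fin.rev_injective h.symm))]
      ring
  · rw [if_neg (fun h => h1 h.1.symm), metric_of_ne h1]; ring

theorem metric_mul_kMat (hq : q ≠ 0) (j k l m : Fin N) :
    metric N q k k.rev * (metric N q k.rev j * metric N q l m) =
      (if j = k ∧ m.rev = l then 1 else 0) * metric N q m.rev m := by
  by_cases h1 : j = k
  · by_cases h2 : m.rev = l
    · subst h1 h2
      rw [if_pos ⟨rfl, rfl⟩, ← mul_assoc, metric_rev_mul hq]
    · rw [if_neg (fun h => h2 h.2), metric_of_ne (i := l)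
        (fun h => h2 (by rw [h, Fin.rev_rev]))]
      ring
  · rw [if_neg (fun h => h1 h.1), metric_of_ne (i := k.rev) (by rwa [Fin.rev_rev])]; ring

/-- Crossing symmetry of the `R̂`-matrix. -/
theorem metric_mul_rMat (hq : q ≠ 0) (j k l m : Fin N) :
    metric N q k k.rev * rMat N q (k.rev, j) (l, m) =
      rInv N q (j, m.rev) (k, l) * metric N q m.rev m := by
  have h1 := metric_mul_one hq j k l m
  have h2 := metric_mul_kMat hq j k l m
  have e1 : q ^ ((0 : ℤ) - 2) = q ^ (-2 : ℤ) := by rw [zero_sub]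
  have e2 : q ^ ((2 : ℤ) - 0) = q ^ 2 := by rw [sub_zero]; exact zpow_ofNat q 2
  rw [rInv_apply, rMat_apply, rMat_apply]
  by_cases hm : m = k.rev
  · subst hm
    simp only [lt_irrefl, if_false, Fin.rev_rev] at h1 h2 ⊢
    by_cases hl : j = l
    · subst hl
      simp only [lt_irrefl, if_false, and_true, if_true]
      by_cases a : j = k
      · subst a
        by_cases b : j = j.rev
        · have hb : j.rev = j := b.symm
          simp only [hb, and_self, if_true] at h1 h2 ⊢
          linear_combination lam q * h1
        · have hb : ¬ j.rev = j := fun h => b h.symm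
          have hz : metric N q j j = 0 := metric_of_ne b
          simp only [hb, b, and_self, if_true, if_false, hz, e1, e2, lam]
          ring
      · by_cases b : j = k.rev
        · subst b
          have hb' : ¬ k = k.rev := fun h => a h.symm
          simp only [a, hb', Fin.rev_rev, and_self, if_true, if_false, e1, e2] at h1 ⊢
          rw [mul_one] at h1
          simp only [lam]
          linear_combination (q ^ 2 - q ^ (-2 : ℤ)) * h1
        · have hz : metric N q j k = 0 := metric_of_ne fun h => b (by rw [h, Fin.rev_rev])
          have b' : ¬ k.rev = j := fun h => b h.symm
          have b'' : ¬ k = j.rev := fun h => b (by rw [h, Fin.rev_rev])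
          have a' : ¬ k = j := fun h => a h.symm
          simp [a, a', b, b', b'', hz]
    · have hl' : ¬ l = j := fun h => hl h.symm
      have hne : ¬ (j = k ∧ k = l) := fun h => hl (h.1.trans h.2)
      have hz : metric N q j k * metric N q k l = 0 := by
        by_cases h : l = k.rev
        · rw [metric_of_ne (i := j), zero_mul]
          rintro rfl
          exact hl' (by rw [h, Fin.rev_rev])
        · rw [metric_of_ne h, mul_zero]
      simp [hl, hne, hz]
  · have c1 : ¬ (k.rev = m ∧ j = l) := fun h => hm h.1.symm
    have c2 : ¬ (j = l ∧ m.rev = k) := fun h => hm (by rw [← h.2, Fin.rev_rev])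
    rw [if_neg c1, if_neg c2]
    by_cases g : j = k ∧ m.rev = l ∨ k.rev = l ∧ j = m
    -- In R̂⁻¹ the coefficient of 1 - K is (q² - q⁻²)(δ_{j<l} - 1). On the support of the two terms
    -- this is -(q² - q⁻²)δ_{k'<m}, and the sign is absorbed by the exchange of 1 and K.
    · have key : (if j < l then (1 : ℂ) else 0) = 1 - (if k.rev < m then 1 else 0) := by
        rcases g with ⟨rfl, rfl⟩ | ⟨rfl, rfl⟩
        · rcases lt_trichotomy j m.rev with h | h | h
          · rw [if_pos h, if_neg (by rw [Fin.rev_lt_iff]; exact not_lt_of_gt h)]; ring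
          · exact absurd (by rw [h, Fin.rev_rev]) hm
          · rw [if_neg (not_lt_of_gt h), if_pos (by rwa [Fin.rev_lt_iff])]; ring
        · rcases lt_trichotomy j k.rev with h | h | h
          · rw [if_pos h, if_neg (not_lt_of_gt h)]; ring
          · exact absurd h hm
          · rw [if_neg (not_lt_of_gt h), if_pos h]; ring
      rw [key]
      linear_combination (lam q * (if k.rev < m then 1 else 0)) * (h1 - h2)
    · rw [not_or] at g
      rw [if_neg g.1, zero_mul] at h2
      rw [if_neg g.2, mul_zero] at h1
      rw [if_neg g.1, if_neg g.2]
      linear_combination (lam q * (if k.rev < m then 1 else 0)) * (- h2) +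
        (lam q * (1 - (if j < l then 1 else 0))) * h1

theorem metric_mul_rInv (hq : q ≠ 0) (j k l m : Fin N) :
    metric N q k k.rev * rInv N q (k.rev, j) (l, m) =
      rMat N q (j, m.rev) (k, l) * metric N q m.rev m := by
  have h1 := metric_mul_one hq j k l m
  have h2 := metric_mul_kMat hq j k l m
  have h3 := metric_mul_rMat hq j k l m
  rw [rInv_apply] at h3 ⊢
  linear_combination h3 - lam q * h1 + lam q * h2

theorem rMat_inner (i j k l : Fin N) :
    rMat (N + 2) q (inner i, inner j) (inner k, inner l) = rMat N q (i, j) (k, l) := by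
  simp only [rMat_apply, rev_inner, inner_inj, inner_lt_inner, metric_inner]

/-- The factor in `R̂ (e_last ⊗ e_x) = χ(x) e_x ⊗ e_last`. -/
noncomputable def lastChar (N : ℕ) (q : ℂ) (x : Fin (N + 2)) : ℂ :=
  q ^ ((if x = Fin.last (N + 1) then 2 else 0) - (if x = 0 then 2 else 0) : ℤ)

/-- The factor in `R̂ (e_x ⊗ e_0) = χ(x) e_0 ⊗ e_x`. -/
noncomputable def zeroChar (N : ℕ) (q : ℂ) (x : Fin (N + 2)) : ℂ :=
  q ^ ((if x = 0 then 2 else 0) - (if x = Fin.last (N + 1) then 2 else 0) : ℤ)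

theorem rMat_last (i j x : Fin (N + 2)) : rMat (N + 2) q (i, j) (Fin.last (N + 1), x) =
    if i = x ∧ j = Fin.last (N + 1) then lastChar N q x else 0 := by
  rw [rMat_apply]
  by_cases h : i = x ∧ j = Fin.last (N + 1)
  · obtain ⟨rfl, rfl⟩ := h
    have : (Fin.last (N + 1) = i.rev) = (i = 0) := propext
      ⟨fun h => by rw [← Fin.rev_rev i, ← h, Fin.rev_last], fun h => by rw [h, Fin.rev_zero]⟩
    simp [lastChar, eq_comm, this]
  · rw [if_neg h, if_neg h, mul_zero, zero_add]
    by_cases hi : i < x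
    · have h1 : ¬ (i = Fin.last (N + 1) ∧ j = x) := by
        rintro ⟨rfl, -⟩; exact not_last_lt _ hi
      have h2 : metric (N + 2) q (Fin.last (N + 1)) x = 0 := by
        apply metric_of_ne
        rw [Fin.rev_last]
        rintro rfl
        exact Fin.not_lt_zero _ hi
      rw [if_neg h1, h2]; ring
    · rw [if_neg hi]; ring

theorem rMat_zero (i j x : Fin (N + 2)) : rMat (N + 2) q (i, j) (x, 0) =
    if i = 0 ∧ j = x then zeroChar N q x else 0 := by
  rw [rMat_apply]
  by_cases h : i = 0 ∧ j = x
  · obtain ⟨rfl, rfl⟩ := h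
    simp [zeroChar, eq_comm]
  · rw [if_neg h, if_neg h, mul_zero, zero_add, if_neg (Fin.not_lt_zero _)]; ring

theorem lastChar_ne_zero (hq : q ≠ 0) (x : Fin (N + 2)) : lastChar N q x ≠ 0 := zpow_ne_zero _ hq

theorem zeroChar_ne_zero (hq : q ≠ 0) (x : Fin (N + 2)) : zeroChar N q x ≠ 0 := zpow_ne_zero _ hq

theorem lastChar_rev (hq : q ≠ 0) (x : Fin (N + 2)) :
    lastChar N q x * lastChar N q x.rev = 1 := by
  rw [lastChar, lastChar, ← zpow_add₀ hq]
  rcases index_cases x with rfl | rfl | ⟨i, rfl⟩ <;> simp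

theorem zeroChar_rev (hq : q ≠ 0) (x : Fin (N + 2)) :
    zeroChar N q x * zeroChar N q x.rev = 1 := by
  rw [zeroChar, zeroChar, ← zpow_add₀ hq]
  rcases index_cases x with rfl | rfl | ⟨i, rfl⟩ <;> simp

/-- The `R̂`-matrix preserves weights. -/
theorem rMat_mul_weight (χ : Fin N → ℂ) (hχ : ∀ x, χ x * χ x.rev = 1) (i j k l : Fin N) :
    rMat N q (i, j) (k, l) * (χ i * χ j) = (χ k * χ l) * rMat N q (i, j) (k, l) := by
  rw [rMat_apply]
  by_cases h1 : i = l ∧ j = k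
  · obtain ⟨rfl, rfl⟩ := h1; ring
  rw [if_neg h1]
  by_cases h2 : i = k ∧ j = l
  · obtain ⟨rfl, rfl⟩ := h2; ring
  rw [if_neg h2]
  by_cases h3 : j = i.rev
  · by_cases h4 : l = k.rev
    · subst h3 h4; rw [hχ, hχ]; ring
    · rw [metric_of_ne h4]; ring
  · rw [metric_of_ne h3]; ring

theorem rMat_inner_of_not (i j : Fin N) (k l : Fin (N + 2)) (h : l ≠ k.rev)
    (h' : k = 0 ∨ k = Fin.last (N + 1) ∨ l = 0 ∨ l = Fin.last (N + 1)) :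
    rMat (N + 2) q (inner i, inner j) (k, l) = 0 := by
  rw [rMat_apply, metric_of_ne h]
  rcases h' with rfl | rfl | rfl | rfl <;> simp

theorem rMat_inner_zero_last (i j : Fin N) :
    rMat (N + 2) q (inner i, inner j) (0, Fin.last (N + 1)) =
      - lam q * (metric N q i j * q ^ (-N : ℤ)) := by
  rw [rMat_apply]; simp [metric_inner, metric_zero_last]

end RMatrix

/-! ### Eigenvalues and the quadratic relation of R̂ -/

section TwoSites

variable {N : ℕ} {q : ℂ}

/-- The eigenvalue of `R̂` on the image of `K`. -/
noncomputable def nu (N : ℕ) (q : ℂ) : ℂ := q ^ (2 - 2 * (N : ℤ))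

theorem nu_add_two (hq : q ≠ 0) :
    nu (N + 2) q = nu N q - lam q * (q ^ (-N : ℤ) * q ^ (-N : ℤ)) := by
  have e1 : nu (N + 2) q = q ^ (-N : ℤ) * q ^ (-N : ℤ) * q ^ (-2 : ℤ) := by
    rw [nu, ← zpow_add₀ hq, ← zpow_add₀ hq]; congr 1; push_cast; ring
  have e2 : nu N q = q ^ (-N : ℤ) * q ^ (-N : ℤ) * q ^ 2 := by
    rw [nu, ← zpow_add₀ hq, ← zpow_natCast q 2, ← zpow_add₀ hq]; congr 1; push_cast; ring
  rw [e1, e2, lam]; ring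

theorem sum_mul_metric (x : Fin N) (f : Fin N → ℂ) :
    ∑ y, f y * metric N q x y = f x.rev * metric N q x x.rev := by
  simpa only [mul_comm] using sum_metric_mul (q := q) x f

theorem loop_eq : loop N q = ∑ x : Fin N, metric N q x x.rev * metric N q x x.rev :=
  Finset.sum_congr rfl fun x _ => sum_mul_metric x _

/-- By induction from N to N + 2. On an inner row only the pair (0, last) is new, and its
contribution is the change of ν in `nu_add_two`; the row (0, last) closes a loop and needs
`lam_mul_loop`. -/
theorem sum_rMat_metric (hq : q ≠ 0) : ∀ (N : ℕ) (i j : Fin N),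
    ∑ x, ∑ y, rMat N q (i, j) (x, y) * metric N q x y = nu N q * metric N q i j
  | 0, i, _ => i.elim0
  | 1, i, j => by
    have hi : i = 0 := Subsingleton.elim _ _
    have hj : j = 0 := Subsingleton.elim _ _
    subst hi hj
    simp [rMat_apply, metric_eq, twoRho, nu]
  | N + 2, i, j => by
    simp only [sum_mul_metric]
    by_cases hj : j = i.rev
    · subst hj
      rcases index_cases i with rfl | rfl | ⟨i, rfl⟩
      · have h0 : ∀ x : Fin N, rMat (N + 2) q (0, Fin.last (N + 1)) (inner x, inner x.rev) =
            - lam q * (q ^ (-N : ℤ) * metric N q x x.rev) := fun x => by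
          rw [rMat_apply]; simp [metric_inner, metric_zero_last]
        have h1 : rMat (N + 2) q (0, Fin.last (N + 1)) (0, Fin.last (N + 1)) =
            lam q * (1 - q ^ (-N : ℤ) * q ^ (-N : ℤ)) := by
          rw [rMat_apply]; simp [metric_zero_last]
        have h2 : rMat (N + 2) q (0, Fin.last (N + 1)) (Fin.last (N + 1), 0) = q ^ (-2 : ℤ) := by
          rw [rMat_last]; simp [lastChar]
        have hl := lam_mul_loop hq N
        have hs : ∑ x : Fin N, - lam q * (q ^ (-N : ℤ) * metric N q x x.rev) * metric N q x x.rev =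
            - q ^ (-N : ℤ) * (lam q * loop N q) := by
          rw [loop_eq, Finset.mul_sum, Finset.mul_sum]
          exact Finset.sum_congr rfl fun x _ => by ring
        rw [sum_index]
        simp only [Fin.rev_zero, Fin.rev_last, rev_inner, metric_inner, h0, h1, h2, hs, hl,
          metric_zero_last, metric_last_zero, nu_add_two hq]
        have e3 : q ^ (2 * (N : ℤ) - 2) = q ^ (N : ℤ) * q ^ (N : ℤ) * q ^ (-2 : ℤ) := by
          rw [← zpow_add₀ hq, ← zpow_add₀ hq]; congr 1; ring
        have e4 : q ^ (N : ℤ) * q ^ (-N : ℤ) = 1 := by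
          rw [← zpow_add₀ hq]; simp
        rw [e3, nu]
        linear_combination (-q ^ (-2 : ℤ) * q ^ (N : ℤ)) * e4
      · rw [Finset.sum_eq_single 0]
        · have h1 : rMat (N + 2) q (Fin.last (N + 1), 0) (0, Fin.last (N + 1)) = q ^ (-2 : ℤ) := by
            rw [rMat_apply]; simp
          rw [Fin.rev_zero, Fin.rev_last, h1, metric_zero_last, metric_last_zero, nu,
            ← zpow_add₀ hq, ← zpow_add₀ hq]
          congr 1; push_cast; ring
        · intro x _ hx
          have : ¬ (Fin.last (N + 1) = x.rev) := fun h => hx (by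
            rw [← Fin.rev_rev x, ← h, Fin.rev_last])
          rw [Fin.rev_last, rMat_apply]
          simp [this]
        · simp
      · have ih := sum_rMat_metric hq N i i.rev
        simp only [sum_mul_metric] at ih
        rw [sum_index]
        have h1 : rMat (N + 2) q (inner i, inner i.rev) (Fin.last (N + 1), 0) = 0 := by
          rw [rMat_last]; simp
        simp only [rev_inner, rMat_inner, metric_inner, ih, Fin.rev_zero, Fin.rev_last, h1,
          rMat_inner_zero_last, metric_zero_last, nu_add_two hq]
        ring
    · rw [metric_of_ne hj, mul_zero]
      refine Finset.sum_eq_zero fun x _ => ?_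
      have h1 : ¬ (i = x.rev ∧ j = x) := by rintro ⟨rfl, rfl⟩; exact hj (by rw [Fin.rev_rev])
      have h2 : ¬ (i = x ∧ j = x.rev) := by rintro ⟨rfl, rfl⟩; exact hj rfl
      rw [rMat_apply, metric_of_ne hj, if_neg h1, if_neg h2]
      ring

theorem rMat_mul_kMat (hq : q ≠ 0) : rMat N q * kMat N q = nu N q • kMat N q := by
  ext ⟨i, j⟩ ⟨k, l⟩
  rw [Matrix.mul_apply, Fintype.sum_prod_type]
  simp only [kMat_apply, Matrix.smul_apply, smul_eq_mul, ← mul_assoc, ← Finset.sum_mul]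
  rw [sum_rMat_metric hq]

theorem kMat_mul_rMat (hq : q ≠ 0) : kMat N q * rMat N q = nu N q • kMat N q := by
  have := congrArg Matrix.transpose (rMat_mul_kMat (N := N) hq)
  rwa [Matrix.transpose_mul, Matrix.transpose_smul, transpose_kMat, transpose_rMat] at this

/-- The quadratic relation of the `R̂`-matrix. -/
theorem rMat_mul_rMat (hq : q ≠ 0) : ∀ N : ℕ,
    rMat N q * rMat N q = 1 + lam q • rMat N q - (lam q * nu N q) • kMat N q
  | 0 => by ext ⟨i, _⟩; exact i.elim0
  | 1 => by
    ext ⟨i, j⟩ ⟨k, l⟩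
    have hi : i = 0 := Subsingleton.elim _ _
    have hj : j = 0 := Subsingleton.elim _ _
    have hk : k = 0 := Subsingleton.elim _ _
    have hl : l = 0 := Subsingleton.elim _ _
    subst hi hj hk hl
    simp [Matrix.mul_apply, Fintype.sum_prod_type, rMat_apply, kMat_apply, metric_eq, twoRho, nu]
  | N + 2 => by
    have ih := rMat_mul_rMat hq N
    -- The defect of the relation. It is symmetric and commutes with R̂, so it suffices to kill a
    -- few columns by hand and the inner block by induction.
    set Z := rMat (N + 2) q * rMat (N + 2) q -
      (1 + lam q • rMat (N + 2) q - (lam q * nu (N + 2) q) • kMat (N + 2) q) with hZ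
    have hcomm : Z * rMat (N + 2) q = rMat (N + 2) q * Z := by
      rw [hZ]
      simp only [sub_mul, mul_sub, add_mul, mul_add, Matrix.smul_mul, Matrix.mul_smul,
        rMat_mul_kMat hq, kMat_mul_rMat hq, mul_assoc, one_mul, mul_one]
    have hsymm : ∀ x y, Z x y = Z y x := by
      have : Z.transpose = Z := by
        rw [hZ]
        simp only [Matrix.transpose_sub, Matrix.transpose_add, Matrix.transpose_mul,
          Matrix.transpose_smul, Matrix.transpose_one, transpose_rMat, transpose_kMat]
      exact fun x y => congrFun (congrFun this y) x
    have e3 : q ^ (-2 : ℤ) * q ^ 2 = 1 := by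
      rw [zpow_neg]; exact inv_mul_cancel₀ (pow_ne_zero 2 hq)
    have hZ' : ∀ i j k l, Z (i, j) (k, l) =
        (∑ a, ∑ b, rMat (N + 2) q (i, j) (a, b) * rMat (N + 2) q (a, b) (k, l)) -
        ((if i = k ∧ j = l then 1 else 0) + lam q * rMat (N + 2) q (i, j) (k, l) -
          lam q * nu (N + 2) q * (metric (N + 2) q i j * metric (N + 2) q k l)) := by
      intro i j k l
      rw [hZ, Matrix.sub_apply, Matrix.mul_apply, Fintype.sum_prod_type]
      simp [kMat_apply, Matrix.one_apply]
    -- In the columns (last, x), and below (x, 0), R̂ has a single nonzero entry, so they are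
    -- computed directly.
    have hlast : ∀ (x : Fin (N + 2)) (z), Z z (Fin.last (N + 1), x) = 0 := by
      rintro x ⟨i, j⟩
      have h : ∑ a, ∑ b, rMat (N + 2) q (i, j) (a, b) *
          rMat (N + 2) q (a, b) (Fin.last (N + 1), x) =
          rMat (N + 2) q (i, j) (x, Fin.last (N + 1)) * lastChar N q x := by
        simp [rMat_last, ite_and]
      rw [hZ', h, rMat_last]
      rcases index_cases x with rfl | rfl | ⟨x, rfl⟩
      · have hc : lastChar N q 0 = q ^ (-2 : ℤ) := by simp [lastChar]
        have e1 : nu (N + 2) q * q ^ (N : ℤ) = q ^ (-2 : ℤ) * q ^ (-N : ℤ) := by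
          rw [nu, ← zpow_add₀ hq, ← zpow_add₀ hq]; congr 1; push_cast; ring
        have e2 : q ^ (N : ℤ) * q ^ (-N : ℤ) = 1 := by
          rw [← zpow_add₀ hq]; simp
        rw [hc, rMat_apply, metric_zero_last, metric_last_zero]
        by_cases hi : i = Fin.last (N + 1)
        · subst hi
          by_cases hj : j = 0
          · subst hj
            simp only [metric_last_zero, zpow_natCast, and_self, last_ne_zero, zero_ne_last, if_false,
              if_true, Fin.rev_last, zpow_neg, zpow_ofNat, lt_irrefl, mul_zero, zero_mul, add_zero,
              mul_one, zero_sub, lam] at e1 e2 e3 ⊢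
            linear_combination ((q ^ 2 - (q ^ 2)⁻¹) * q ^ N) * e1 +
              ((q ^ 2 - (q ^ 2)⁻¹) * (q ^ 2)⁻¹) * e2 + e3
          · have : metric (N + 2) q (Fin.last (N + 1)) j = 0 := metric_of_ne (by simpa using hj)
            simp [hj, this]
        · have hi' : i < Fin.last (N + 1) := Fin.lt_last_iff_ne_last.2 hi
          simp only [hi, hi', false_and, if_false, if_true]
          split_ifs <;> linear_combination (lam q * metric (N + 2) q i j) * e1
      · rw [rMat_last]
        by_cases h : i = Fin.last (N + 1) ∧ j = Fin.last (N + 1)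
        · obtain ⟨rfl, rfl⟩ := h
          simp only [lastChar, and_self, last_ne_zero, if_true, if_false, sub_zero, zpow_ofNat,
            metric_last_last, mul_zero, lam]
          linear_combination e3
        · simp [h]
      · have hc : lastChar N q (inner x) = 1 := by simp [lastChar]
        rw [hc, rMat_apply, metric_inner_last, metric_last_inner]
        by_cases h : i = inner x
        · subst h; simp
        · by_cases h2 : i = Fin.last (N + 1)
          · subst h2
            by_cases h3 : j = inner x
            · subst h3; simp
            · simp [h3]
          · simp [h, h2]
    have hzero : ∀ (x : Fin (N + 2)) (z), Z z (x, 0) = 0 := by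
      rintro x ⟨i, j⟩
      have h : ∑ a, ∑ b, rMat (N + 2) q (i, j) (a, b) * rMat (N + 2) q (a, b) (x, 0) =
          rMat (N + 2) q (i, j) (0, x) * zeroChar N q x := by
        simp [rMat_zero, ite_and]
      rcases index_cases x with rfl | rfl | ⟨x, rfl⟩
      · rw [hZ', h, rMat_zero]
        by_cases h : i = 0 ∧ j = 0
        · obtain ⟨rfl, rfl⟩ := h
          simp only [zeroChar, and_self, zero_ne_last, if_true, if_false, sub_zero, zpow_ofNat,
            metric_zero_zero, mul_zero, lam]
          linear_combination e3
        · simp [h]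
      · exact hlast _ _
      · have hc : zeroChar N q (inner x) = 1 := by simp [zeroChar]
        rw [hZ', h, rMat_zero, hc, rMat_apply, metric_inner_zero, metric_zero_inner]
        by_cases h : i = 0
        · subst h; simp
        · by_cases h2 : i = inner x
          · subst h2
            by_cases h3 : j = 0
            · subst h3; simp
            · simp [h3]
          · simp [h, h2]
    -- R̂ sends e_last ⊗ e_x to a nonzero multiple of e_x ⊗ e_last, so column (last, x) of Z R̂ = R̂
    -- Z gives column (x, last) of Z.
    have hlast' : ∀ (x : Fin (N + 2)) (z), Z z (x, Fin.last (N + 1)) = 0 := by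
      intro x z
      have h := congrFun (congrFun hcomm z) (Fin.last (N + 1), x)
      rw [Matrix.mul_apply, Matrix.mul_apply, Fintype.sum_prod_type] at h
      simp only [rMat_last, hlast, mul_zero, Finset.sum_const_zero] at h
      simpa [ite_and, lastChar_ne_zero hq] using h
    have hzero' : ∀ (x : Fin (N + 2)) (z), Z z (0, x) = 0 := by
      intro x z
      have h := congrFun (congrFun hcomm z) (x, 0)
      rw [Matrix.mul_apply, Matrix.mul_apply, Fintype.sum_prod_type] at h
      simp only [rMat_zero, hzero, mul_zero, Finset.sum_const_zero] at h
      simpa [ite_and, zeroChar_ne_zero hq] using h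
    -- The only outer intermediate pair is (0, last). It adds (q² - q⁻²)² q^{-2N} K, which is
    -- compensated by the change of ν.
    have hin : ∀ i j k l : Fin N, Z (inner i, inner j) (inner k, inner l) = 0 := by
      intro i j k l
      have h := congrFun (congrFun ih (i, j)) (k, l)
      rw [Matrix.mul_apply, Fintype.sum_prod_type] at h
      have hsym : ∀ x y, rMat (N + 2) q x y = rMat (N + 2) q y x := fun x y =>
        congrFun (congrFun transpose_rMat y) x
      have e1 : ∀ x : Fin N, rMat (N + 2) q (inner i, inner j) (inner x, 0) = 0 := fun x =>
        rMat_inner_of_not _ _ _ _ (by simp) (by simp)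
      have e2 : ∀ x : Fin N, rMat (N + 2) q (inner i, inner j) (inner x, Fin.last (N + 1)) = 0 :=
        fun x => rMat_inner_of_not _ _ _ _ (by simp) (by simp)
      have e3 : ∀ x : Fin N, rMat (N + 2) q (inner i, inner j) (0, inner x) = 0 := fun x =>
        rMat_inner_of_not _ _ _ _ (by simp) (by simp)
      have e4 : rMat (N + 2) q (inner i, inner j) (0, 0) = 0 :=
        rMat_inner_of_not _ _ _ _ (by simp) (by simp)
      rw [hZ']
      simp only [sum_index, e1, e2, e3, e4, rMat_last, inner_ne_last, and_false, if_false,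
        zero_mul, zero_add, add_zero, rMat_inner_zero_last, rMat_inner, Finset.sum_const_zero]
      rw [hsym (0, Fin.last (N + 1)), rMat_inner_zero_last]
      simp [Matrix.one_apply, kMat_apply] at h
      simp only [inner_inj, metric_inner, h, nu_add_two hq]
      ring
    rw [← sub_eq_zero, ← hZ]
    ext ⟨i, j⟩ ⟨k, l⟩
    rw [Matrix.zero_apply]
    rcases index_cases i with rfl | rfl | ⟨i, rfl⟩
    · rw [hsymm, hzero']
    · rw [hsymm, hlast]
    rcases index_cases j with rfl | rfl | ⟨j, rfl⟩
    · rw [hsymm, hzero]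
    · rw [hsymm, hlast']
    rcases index_cases k with rfl | rfl | ⟨k, rfl⟩
    · rw [hzero']
    · rw [hlast]
    rcases index_cases l with rfl | rfl | ⟨l, rfl⟩
    · rw [hzero]
    · rw [hlast']
    · exact hin i j k l

/-- The quadratic relation rewritten: its K-term cancels against K R̂ = ν K. -/
theorem rInv_mul_rMat (hq : q ≠ 0) : rInv N q * rMat N q = 1 := by
  rw [rInv, sub_mul, Matrix.smul_mul, sub_mul, one_mul, kMat_mul_rMat hq, rMat_mul_rMat hq]
  module

end TwoSites

/-! ### Relations on `V ⊗ V ⊗ V` -/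

section ThreeSites

variable {N : ℕ} {q : ℂ}

/-- `M ⊗ id` on `V ⊗ V ⊗ V`. -/
def onLeft (M : Matrix (Fin N × Fin N) (Fin N × Fin N) ℂ) :
    Matrix (Fin N × Fin N × Fin N) (Fin N × Fin N × Fin N) ℂ :=
  fun x y => M (x.1, x.2.1) (y.1, y.2.1) * if x.2.2 = y.2.2 then 1 else 0

/-- `id ⊗ M` on `V ⊗ V ⊗ V`. -/
def onRight (M : Matrix (Fin N × Fin N) (Fin N × Fin N) ℂ) :
    Matrix (Fin N × Fin N × Fin N) (Fin N × Fin N × Fin N) ℂ :=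
  fun x y => (if x.1 = y.1 then 1 else 0) * M x.2 y.2

variable (A B : Matrix (Fin N × Fin N) (Fin N × Fin N) ℂ)
  (X : Matrix (Fin N × Fin N × Fin N) (Fin N × Fin N × Fin N) ℂ)

theorem onLeft_mul_apply (a b c : Fin N) (z : Fin N × Fin N × Fin N) :
    (onLeft A * X) (a, b, c) z = ∑ x, ∑ y, A (a, b) (x, y) * X (x, y, c) z := by
  simp [Matrix.mul_apply, Fintype.sum_prod_type, onLeft]

theorem onRight_mul_apply (a b c : Fin N) (z : Fin N × Fin N × Fin N) :
    (onRight A * X) (a, b, c) z = ∑ x, ∑ y, A (b, c) (x, y) * X (a, x, y) z := by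
  simp [Matrix.mul_apply, Fintype.sum_prod_type, onRight, ite_mul, Finset.sum_ite_irrel]

theorem mul_onLeft_apply (a b c : Fin N) (z : Fin N × Fin N × Fin N) :
    (X * onLeft A) z (a, b, c) = ∑ x, ∑ y, X z (x, y, c) * A (x, y) (a, b) := by
  simp [Matrix.mul_apply, Fintype.sum_prod_type, onLeft]

theorem mul_onRight_apply (a b c : Fin N) (z : Fin N × Fin N × Fin N) :
    (X * onRight A) z (a, b, c) = ∑ x, ∑ y, X z (a, x, y) * A (x, y) (b, c) := by
  simp [Matrix.mul_apply, Fintype.sum_prod_type, onRight, Finset.sum_ite_irrel]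

theorem onLeft_mul : onLeft (A * B) = onLeft A * onLeft B := by
  ext ⟨a, b, c⟩ z
  rw [onLeft_mul_apply]
  simp only [onLeft, Matrix.mul_apply, Fintype.sum_prod_type, Finset.sum_mul, mul_assoc]

theorem onRight_mul : onRight (A * B) = onRight A * onRight B := by
  ext ⟨a, b, c⟩ z
  rw [onRight_mul_apply]
  simp only [onRight, Matrix.mul_apply, Fintype.sum_prod_type, Finset.mul_sum]
  refine Finset.sum_congr rfl fun x _ => Finset.sum_congr rfl fun y _ => ?_
  ring

theorem onLeft_one : onLeft (1 : Matrix (Fin N × Fin N) (Fin N × Fin N) ℂ) = 1 := by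
  ext ⟨a, b, c⟩ ⟨d, e, f⟩
  simp only [onLeft, Matrix.one_apply, Prod.mk.injEq, ← ite_and, mul_ite, mul_one, mul_zero]
  congr 1
  simp only [eq_iff_iff]; tauto

theorem onRight_one : onRight (1 : Matrix (Fin N × Fin N) (Fin N × Fin N) ℂ) = 1 := by
  ext ⟨a, b, c⟩ ⟨d, e, f⟩
  simp only [onRight, Matrix.one_apply, Prod.mk.injEq, ite_mul, one_mul, zero_mul, ← ite_and]

theorem onLeft_add : onLeft (A + B) = onLeft A + onLeft B := by
  ext x y; simp only [onLeft, Matrix.add_apply, add_mul]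

theorem onRight_add : onRight (A + B) = onRight A + onRight B := by
  ext x y; simp [onRight, mul_add]

theorem onLeft_sub : onLeft (A - B) = onLeft A - onLeft B := by
  ext x y; simp only [onLeft, Matrix.sub_apply, sub_mul]

theorem onRight_sub : onRight (A - B) = onRight A - onRight B := by
  ext x y; simp [onRight, mul_sub]

theorem onLeft_smul (r : ℂ) : onLeft (r • A) = r • onLeft A := by
  ext x y; simp [onLeft]

theorem onRight_smul (r : ℂ) : onRight (r • A) = r • onRight A := by
  ext x y; simp [onRight]

theorem transpose_onLeft : (onLeft A).transpose = onLeft A.transpose := by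
  ext x y; simp [onLeft, eq_comm]

theorem transpose_onRight : (onRight A).transpose = onRight A.transpose := by
  ext x y; simp [onRight, eq_comm]

theorem sum_metric_mul_metric (hq : q ≠ 0) (a b : Fin N) :
    ∑ x, metric N q a x * metric N q x b = if a = b then 1 else 0 := by
  rw [sum_metric_mul]
  by_cases h : a = b
  · subst h; rw [metric_rev_mul hq, if_pos rfl]
  · rw [metric_of_ne (i := a.rev) (by rw [Fin.rev_rev]; exact Ne.symm h), mul_zero, if_neg h]

theorem kMat_left_right_apply (hq : q ≠ 0) (a b c k l m : Fin N) :
    (onLeft (kMat N q) * onRight (kMat N q)) (a, b, c) (k, l, m) =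
      metric N q a b * (if k = c then 1 else 0) * metric N q l m := by
  rw [onLeft_mul_apply, ← sum_metric_mul_metric hq k c, Finset.mul_sum, Finset.sum_mul]
  rw [Finset.sum_eq_single k]
  · refine Finset.sum_congr rfl fun y _ => ?_
    simp only [onRight, kMat_apply, if_true]; ring
  · intro x _ hx
    exact Finset.sum_eq_zero fun y _ => by simp [onRight, hx]
  · simp

theorem kMat_right_left_apply (hq : q ≠ 0) (a b c k l m : Fin N) :
    (onRight (kMat N q) * onLeft (kMat N q)) (a, b, c) (k, l, m) =
      metric N q b c * (if a = m then 1 else 0) * metric N q k l := by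
  rw [onRight_mul_apply, ← sum_metric_mul_metric hq a m, Finset.mul_sum, Finset.sum_mul]
  refine Finset.sum_congr rfl fun x _ => ?_
  rw [Finset.sum_eq_single m]
  · simp only [onLeft, kMat_apply, if_true]; ring
  · intro y _ hy
    simp [onLeft, hy]
  · simp

theorem kMat_mul_onRight_apply (M : Matrix (Fin N × Fin N) (Fin N × Fin N) ℂ)
    (a b c k l m : Fin N) : (onLeft (kMat N q) * onRight M) (a, b, c) (k, l, m) =
      metric N q a b * (metric N q k k.rev * M (k.rev, c) (l, m)) := by
  rw [onLeft_mul_apply, ← sum_metric_mul k fun y => M (y, c) (l, m), Finset.sum_eq_single k]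
  · rw [Finset.mul_sum]
    refine Finset.sum_congr rfl fun y _ => ?_
    simp only [onRight, kMat_apply, if_true]; ring
  · intro x _ hx
    exact Finset.sum_eq_zero fun y _ => by simp [onRight, hx]
  · simp

theorem kMat_kMat_mul_onLeft_apply (hq : q ≠ 0) (M : Matrix (Fin N × Fin N) (Fin N × Fin N) ℂ)
    (a b c k l m : Fin N) :
    (onLeft (kMat N q) * onRight (kMat N q) * onLeft M) (a, b, c) (k, l, m) =
      metric N q a b * (M (c, m.rev) (k, l) * metric N q m.rev m) := by
  simp only [mul_onLeft_apply, kMat_left_right_apply hq]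
  rw [mul_comm (M _ _), ← sum_metric_mul' m fun y => M (c, y) (k, l), Finset.sum_eq_single c]
  · rw [Finset.mul_sum]
    refine Finset.sum_congr rfl fun y _ => ?_
    simp only [if_true]; ring
  · intro x _ hx
    simp [hx]
  · simp

theorem kMat_mul_onLeft_apply (M : Matrix (Fin N × Fin N) (Fin N × Fin N) ℂ)
    (a b c k l m : Fin N) : (onRight (kMat N q) * onLeft M) (a, b, c) (k, l, m) =
      metric N q b c * (M (a, m.rev) (k, l) * metric N q m.rev m) := by
  rw [onRight_mul_apply, mul_comm (M _ _), ← sum_metric_mul' m fun y => M (a, y) (k, l),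
    Finset.mul_sum]
  refine Finset.sum_congr rfl fun x _ => ?_
  rw [Finset.sum_eq_single m]
  · simp only [onLeft, kMat_apply, if_true]; ring
  · intro y _ hy
    simp [onLeft, hy]
  · simp

theorem kMat_kMat_mul_onRight_apply (hq : q ≠ 0)
    (M : Matrix (Fin N × Fin N) (Fin N × Fin N) ℂ) (a b c k l m : Fin N) :
    (onRight (kMat N q) * onLeft (kMat N q) * onRight M) (a, b, c) (k, l, m) =
      metric N q b c * (metric N q k k.rev * M (k.rev, a) (l, m)) := by
  simp only [mul_onRight_apply, kMat_right_left_apply hq]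
  rw [← sum_metric_mul k fun y => M (y, a) (l, m), Finset.mul_sum]
  refine Finset.sum_congr rfl fun x _ => ?_
  rw [Finset.sum_eq_single a]
  · simp only [if_true]; ring
  · intro y _ hy
    simp [Ne.symm hy]
  · simp

/-- Crossing symmetry on three factors: a strand slid under the cap of K₁₂ changes R̂₂₃ into R̂₁₂⁻¹.
-/
theorem kMat_mul_rMat_right (hq : q ≠ 0) : onLeft (kMat N q) * onRight (rMat N q) =
    onLeft (kMat N q) * onRight (kMat N q) * onLeft (rInv N q) := by
  ext ⟨a, b, c⟩ ⟨k, l, m⟩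
  rw [kMat_mul_onRight_apply, kMat_kMat_mul_onLeft_apply hq, metric_mul_rMat hq]

theorem kMat_right_mul_rMat (hq : q ≠ 0) : onRight (kMat N q) * onLeft (rMat N q) =
    onRight (kMat N q) * onLeft (kMat N q) * onRight (rInv N q) := by
  ext ⟨a, b, c⟩ ⟨k, l, m⟩
  rw [kMat_mul_onLeft_apply, kMat_kMat_mul_onRight_apply hq, metric_mul_rInv hq]

theorem kMat_mul_rInv_right (hq : q ≠ 0) : onLeft (kMat N q) * onRight (kMat N q) *
    onLeft (rMat N q) = onLeft (kMat N q) * onRight (rInv N q) := by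
  ext ⟨a, b, c⟩ ⟨k, l, m⟩
  rw [kMat_mul_onRight_apply, kMat_kMat_mul_onLeft_apply hq, metric_mul_rInv hq]

theorem transpose_rInv : (rInv N q).transpose = rInv N q := by
  rw [rInv, Matrix.transpose_sub, Matrix.transpose_smul, Matrix.transpose_sub, transpose_kMat,
    transpose_rMat, Matrix.transpose_one]

theorem rInv_mul_kMat_right (hq : q ≠ 0) : onLeft (rInv N q) * onRight (kMat N q) =
    onRight (rMat N q) * onLeft (kMat N q) * onRight (kMat N q) := by
  have h : onRight (kMat N q) * onLeft (rInv N q) =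
      onRight (kMat N q) * onLeft (kMat N q) * onRight (rMat N q) := by
    ext ⟨a, b, c⟩ ⟨k, l, m⟩
    rw [kMat_mul_onLeft_apply, kMat_kMat_mul_onRight_apply hq, metric_mul_rMat hq]
  have h' := congrArg Matrix.transpose h
  simpa only [Matrix.transpose_mul, transpose_onLeft, transpose_onRight, transpose_rMat,
    transpose_rInv, transpose_kMat, ← mul_assoc] using h'

/-- The R̂₁₂⁻¹ produced by crossing cancels the last R̂₁₂. The mirror image is proved in the same
way, and two more relations follow by transposition. -/
theorem kMat_rMat_rMat (hq : q ≠ 0) :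
    onLeft (kMat N q) * onRight (rMat N q) * onLeft (rMat N q) =
      onLeft (kMat N q) * onRight (kMat N q) := by
  rw [kMat_mul_rMat_right hq, mul_assoc, ← onLeft_mul, rInv_mul_rMat hq, onLeft_one, mul_one]

theorem kMat_right_rMat_rMat (hq : q ≠ 0) :
    onRight (kMat N q) * onLeft (rMat N q) * onRight (rMat N q) =
      onRight (kMat N q) * onLeft (kMat N q) := by
  rw [kMat_right_mul_rMat hq, mul_assoc, ← onRight_mul, rInv_mul_rMat hq, onRight_one, mul_one]

theorem rMat_rMat_kMat (hq : q ≠ 0) :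
    onLeft (rMat N q) * onRight (rMat N q) * onLeft (kMat N q) =
      onRight (kMat N q) * onLeft (kMat N q) := by
  have h := congrArg Matrix.transpose (kMat_rMat_rMat (N := N) hq)
  simpa only [Matrix.transpose_mul, transpose_onLeft, transpose_onRight, transpose_rMat,
    transpose_kMat, ← mul_assoc] using h

theorem rMat_rMat_kMat_right (hq : q ≠ 0) :
    onRight (rMat N q) * onLeft (rMat N q) * onRight (kMat N q) =
      onLeft (kMat N q) * onRight (kMat N q) := by
  have h := congrArg Matrix.transpose (kMat_right_rMat_rMat (N := N) hq)
  simpa only [Matrix.transpose_mul, transpose_onLeft, transpose_onRight, transpose_rMat,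
    transpose_kMat, ← mul_assoc] using h

end ThreeSites

/-! ### The braid relation -/

section Braid

variable {N : ℕ} {q : ℂ}

/-- The defect of the braid relation. -/
noncomputable def braidDefect (N : ℕ) (q : ℂ) :
    Matrix (Fin N × Fin N × Fin N) (Fin N × Fin N × Fin N) ℂ :=
  onLeft (rMat N q) * onRight (rMat N q) * onLeft (rMat N q) -
    onRight (rMat N q) * onLeft (rMat N q) * onRight (rMat N q)

theorem transpose_braidDefect : (braidDefect N q).transpose = braidDefect N q := by
  simp only [braidDefect, Matrix.transpose_sub, Matrix.transpose_mul, transpose_onLeft,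
    transpose_onRight, transpose_rMat, mul_assoc]

/-- Expanding R̂² on both sides by the quadratic relation leaves the same K-terms, because
R̂₁₂R̂₂₃K₁₂ = K₂₃K₁₂ = K₂₃R̂₁₂R̂₂₃. This intertwining carries vanishing columns of the defect to
other columns. -/
theorem braidDefect_mul_left (hq : q ≠ 0) : braidDefect N q * onLeft (rMat N q) =
    (lam q • 1 - onRight (rMat N q)) * braidDefect N q := by
  have h1 : onLeft (rMat N q) * onLeft (rMat N q) =
      1 + lam q • onLeft (rMat N q) - (lam q * nu N q) • onLeft (kMat N q) := by
    rw [← onLeft_mul, rMat_mul_rMat hq, onLeft_sub, onLeft_add, onLeft_one, onLeft_smul,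
      onLeft_smul]
  have h2 : onRight (rMat N q) * onRight (rMat N q) =
      1 + lam q • onRight (rMat N q) - (lam q * nu N q) • onRight (kMat N q) := by
    rw [← onRight_mul, rMat_mul_rMat hq, onRight_sub, onRight_add, onRight_one, onRight_smul,
      onRight_smul]
  have h3 := rMat_rMat_kMat (N := N) hq
  have h4 := kMat_right_rMat_rMat (N := N) hq
  rw [braidDefect]
  set a := onLeft (rMat N q)
  set b := onRight (rMat N q)
  set u := onLeft (kMat N q)
  set v := onRight (kMat N q)
  have e1 : a * b * a * a = a * b + lam q • (a * b * a) - (lam q * nu N q) • (v * u) := by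
    rw [mul_assoc (a * b), h1, ← h3]
    simp only [mul_add, mul_sub, mul_one, Matrix.mul_smul]
  have e2 : b * (b * a * b) = a * b + lam q • (b * a * b) - (lam q * nu N q) • (v * u) := by
    rw [mul_assoc, ← mul_assoc b b, h2, ← h4]
    simp only [add_mul, sub_mul, one_mul, Matrix.smul_mul, mul_assoc]
  rw [sub_mul, e1, sub_mul, mul_sub b, e2, Matrix.smul_mul, one_mul]
  simp only [mul_assoc]
  module

theorem braidDefect_mul_right (hq : q ≠ 0) : braidDefect N q * onRight (rMat N q) =
    (lam q • 1 - onLeft (rMat N q)) * braidDefect N q := by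
  have h1 : onLeft (rMat N q) * onLeft (rMat N q) =
      1 + lam q • onLeft (rMat N q) - (lam q * nu N q) • onLeft (kMat N q) := by
    rw [← onLeft_mul, rMat_mul_rMat hq, onLeft_sub, onLeft_add, onLeft_one, onLeft_smul,
      onLeft_smul]
  have h2 : onRight (rMat N q) * onRight (rMat N q) =
      1 + lam q • onRight (rMat N q) - (lam q * nu N q) • onRight (kMat N q) := by
    rw [← onRight_mul, rMat_mul_rMat hq, onRight_sub, onRight_add, onRight_one, onRight_smul,
      onRight_smul]
  have h3 := rMat_rMat_kMat_right (N := N) hq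
  have h4 := kMat_rMat_rMat (N := N) hq
  rw [braidDefect]
  set a := onLeft (rMat N q)
  set b := onRight (rMat N q)
  set u := onLeft (kMat N q)
  set v := onRight (kMat N q)
  have e1 : b * a * b * b = b * a + lam q • (b * a * b) - (lam q * nu N q) • (u * v) := by
    rw [mul_assoc (b * a), h2, ← h3]
    simp only [mul_add, mul_sub, mul_one, Matrix.mul_smul]
  have e2 : a * (a * b * a) = b * a + lam q • (a * b * a) - (lam q * nu N q) • (u * v) := by
    rw [mul_assoc, ← mul_assoc a a, h1, ← h4]
    simp only [add_mul, sub_mul, one_mul, Matrix.smul_mul, mul_assoc]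
  rw [sub_mul, e1, sub_mul, mul_sub a, e2, Matrix.smul_mul, one_mul]
  simp only [mul_assoc]
  module

section Corner

variable (X : Matrix (Fin (N + 2) × Fin (N + 2) × Fin (N + 2))
  (Fin (N + 2) × Fin (N + 2) × Fin (N + 2)) ℂ)

theorem mul_onLeft_last (x y : Fin (N + 2)) (z) :
    (X * onLeft (rMat (N + 2) q)) z (Fin.last (N + 1), x, y) =
      X z (x, Fin.last (N + 1), y) * lastChar N q x := by
  simp [mul_onLeft_apply, rMat_last, ite_and]

theorem mul_onRight_last (x y : Fin (N + 2)) (z) :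
    (X * onRight (rMat (N + 2) q)) z (x, Fin.last (N + 1), y) =
      X z (x, y, Fin.last (N + 1)) * lastChar N q y := by
  simp [mul_onRight_apply, rMat_last, ite_and]

theorem mul_onLeft_zero (x y : Fin (N + 2)) (z) :
    (X * onLeft (rMat (N + 2) q)) z (x, 0, y) = X z (0, x, y) * zeroChar N q x := by
  simp [mul_onLeft_apply, rMat_zero, ite_and]

theorem mul_onRight_zero (x y : Fin (N + 2)) (z) :
    (X * onRight (rMat (N + 2) q)) z (x, y, 0) = X z (x, 0, y) * zeroChar N q y := by
  simp [mul_onRight_apply, rMat_zero, ite_and]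

end Corner

/-- The extreme index passes through the two other factors with scalar factors only, before or after
R̂ acts on them. The two orders agree because R̂ preserves weights. -/
theorem braidDefect_last (hq : q ≠ 0) (x y : Fin (N + 2)) (z) :
    braidDefect (N + 2) q z (Fin.last (N + 1), x, y) = 0 := by
  obtain ⟨a, b, c⟩ := z
  have h1 : (onLeft (rMat (N + 2) q) * onRight (rMat (N + 2) q) * onLeft (rMat (N + 2) q))
      (a, b, c) (Fin.last (N + 1), x, y) = (if c = Fin.last (N + 1) then 1 else 0) *
        (lastChar N q x * lastChar N q y * rMat (N + 2) q (a, b) (x, y)) := by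
    rw [mul_onLeft_last, mul_onRight_last]
    simp only [onLeft]
    ring
  have h2 : (onRight (rMat (N + 2) q) * onLeft (rMat (N + 2) q) * onRight (rMat (N + 2) q))
      (a, b, c) (Fin.last (N + 1), x, y) = (if c = Fin.last (N + 1) then 1 else 0) *
        (rMat (N + 2) q (a, b) (x, y) * (lastChar N q a * lastChar N q b)) := by
    simp only [mul_onRight_apply, mul_onLeft_last, onRight, rMat_last]
    rw [Finset.sum_eq_single a, Finset.sum_eq_single b]
    · by_cases hc : c = Fin.last (N + 1)
      · simp only [hc, and_self, if_true]; ring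
      · simp [hc]
    · intro y' _ hy; simp [Ne.symm hy]
    · simp
    · intro x' _ hx
      exact Finset.sum_eq_zero fun y' _ => by simp [Ne.symm hx]
    · simp
  rw [braidDefect, Matrix.sub_apply, h1, h2, rMat_mul_weight _ (lastChar_rev hq), sub_self]

theorem braidDefect_zero (hq : q ≠ 0) (x y : Fin (N + 2)) (z) :
    braidDefect (N + 2) q z (x, y, 0) = 0 := by
  obtain ⟨a, b, c⟩ := z
  have h1 : (onRight (rMat (N + 2) q) * onLeft (rMat (N + 2) q) * onRight (rMat (N + 2) q))
      (a, b, c) (x, y, 0) = (if a = 0 then 1 else 0) *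
        (zeroChar N q x * zeroChar N q y * rMat (N + 2) q (b, c) (x, y)) := by
    rw [mul_onRight_zero, mul_onLeft_zero]
    simp only [onRight]
    ring
  have h2 : (onLeft (rMat (N + 2) q) * onRight (rMat (N + 2) q) * onLeft (rMat (N + 2) q))
      (a, b, c) (x, y, 0) = (if a = 0 then 1 else 0) *
        (rMat (N + 2) q (b, c) (x, y) * (zeroChar N q b * zeroChar N q c)) := by
    simp only [mul_onLeft_apply, mul_onRight_zero, onLeft, rMat_zero]
    rw [Finset.sum_eq_single b, Finset.sum_eq_single c]
    · by_cases hc : a = 0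
      · simp only [hc, and_self, if_true]; ring
      · simp [hc]
    · intro y' _ hy; simp [Ne.symm hy]
    · simp
    · intro x' _ hx
      exact Finset.sum_eq_zero fun y' _ => by simp [Ne.symm hx]
    · simp
  rw [braidDefect, Matrix.sub_apply, h1, h2, rMat_mul_weight _ (zeroChar_rev hq), sub_self]

theorem eq_zero_of_mul_onLeft {X Y : Matrix (Fin N × Fin N × Fin N) (Fin N × Fin N × Fin N) ℂ}
    {y : Fin N × Fin N × Fin N} (h : ∀ z, X z y = 0) (z) : (Y * X) z y = 0 := by
  simp [Matrix.mul_apply, h]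

/-- The intertwining relations move the last index from the first factor to the second and third,
and the index 0 from the third factor to the second and first. Each move multiplies a column by a
nonzero scalar. -/
theorem braidDefect_outer (hq : q ≠ 0) (x y z w) (h : (x = 0 ∨ x = Fin.last (N + 1)) ∨
    (y = 0 ∨ y = Fin.last (N + 1)) ∨ (z = 0 ∨ z = Fin.last (N + 1))) :
    braidDefect (N + 2) q w (x, y, z) = 0 := by
  have last_mid : ∀ x y w, braidDefect (N + 2) q w (x, Fin.last (N + 1), y) = 0 := by
    intro x y w
    have h := congrFun (congrFun (braidDefect_mul_left (N := N + 2) hq) w) (Fin.last (N + 1), x, y)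
    rw [mul_onLeft_last, eq_zero_of_mul_onLeft (braidDefect_last hq x y)] at h
    exact (mul_eq_zero.1 h).resolve_right (lastChar_ne_zero hq _)
  have last_right : ∀ x y w, braidDefect (N + 2) q w (x, y, Fin.last (N + 1)) = 0 := by
    intro x y w
    have h := congrFun (congrFun (braidDefect_mul_right (N := N + 2) hq) w)
      (x, Fin.last (N + 1), y)
    rw [mul_onRight_last, eq_zero_of_mul_onLeft (last_mid x y)] at h
    exact (mul_eq_zero.1 h).resolve_right (lastChar_ne_zero hq _)
  have zero_mid : ∀ x y w, braidDefect (N + 2) q w (x, 0, y) = 0 := by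
    intro x y w
    have h := congrFun (congrFun (braidDefect_mul_right (N := N + 2) hq) w) (x, y, 0)
    rw [mul_onRight_zero, eq_zero_of_mul_onLeft (braidDefect_zero hq x y)] at h
    exact (mul_eq_zero.1 h).resolve_right (zeroChar_ne_zero hq _)
  have zero_left : ∀ x y w, braidDefect (N + 2) q w (0, x, y) = 0 := by
    intro x y w
    have h := congrFun (congrFun (braidDefect_mul_left (N := N + 2) hq) w) (x, 0, y)
    rw [mul_onLeft_zero, eq_zero_of_mul_onLeft (zero_mid x y)] at h
    exact (mul_eq_zero.1 h).resolve_right (zeroChar_ne_zero hq _)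
  rcases h with (rfl | rfl) | (rfl | rfl) | (rfl | rfl)
  · exact zero_left _ _ _
  · exact braidDefect_last hq _ _ _
  · exact zero_mid _ _ _
  · exact last_mid _ _ _
  · exact braidDefect_zero hq _ _ _
  · exact last_right _ _ _

/-- Of the outer intermediate pairs, only (0, last) can reach an inner pair under R̂, and the
hypothesis on f removes it. Hence inner blocks of the triple products are the triple products for N.
-/
theorem sum_mul_rMat_inner (f : Fin (N + 2) → Fin (N + 2) → ℂ)
    (hf : f 0 (Fin.last (N + 1)) = 0) (k l : Fin N) :
    ∑ x, ∑ y, f x y * rMat (N + 2) q (x, y) (inner k, inner l) =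
      ∑ x, ∑ y, f (inner x) (inner y) * rMat N q (x, y) (k, l) := by
  have h1 : ∀ x y : Fin (N + 2),
      (x = 0 ∨ x = Fin.last (N + 1)) ∨ (y = 0 ∨ y = Fin.last (N + 1)) →
      f x y * rMat (N + 2) q (x, y) (inner k, inner l) = 0 := by
    intro x y h
    have hsym : rMat (N + 2) q (x, y) (inner k, inner l) =
        rMat (N + 2) q (inner k, inner l) (x, y) :=
      congrFun (congrFun transpose_rMat _) _
    by_cases hy : y = x.rev
    · subst hy
      by_cases h0 : x = 0
      · subst h0; rw [Fin.rev_zero, hf, zero_mul]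
      · have : x = Fin.last (N + 1) := by
          rcases h with (h | h) | (h | h)
          · exact absurd h h0
          · exact h
          · rw [← Fin.rev_rev x, h, Fin.rev_zero]
          · exact absurd (by rw [← Fin.rev_rev x, h, Fin.rev_last]) h0
        subst this
        rw [hsym, rMat_last]; simp
    · rw [hsym, rMat_inner_of_not _ _ _ _ hy (by tauto), mul_zero]
  simp only [sum_index, rMat_inner]
  simp [h1]

theorem onLeft_onRight_onLeft_inner (a b c k l m : Fin N) :
    (onLeft (rMat (N + 2) q) * onRight (rMat (N + 2) q) * onLeft (rMat (N + 2) q))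
      (inner a, inner b, inner c) (inner k, inner l, inner m) =
    (onLeft (rMat N q) * onRight (rMat N q) * onLeft (rMat N q)) (a, b, c) (k, l, m) := by
  rw [mul_onLeft_apply, mul_onLeft_apply, sum_mul_rMat_inner _ (by
    rw [mul_onRight_last]; simp [onLeft])]
  refine Finset.sum_congr rfl fun x _ => Finset.sum_congr rfl fun y _ => ?_
  rw [mul_onRight_apply, mul_onRight_apply, sum_mul_rMat_inner _ (by simp [onLeft])]
  simp only [onLeft, rMat_inner, inner_inj]

theorem onRight_onLeft_onRight_inner (a b c k l m : Fin N) :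
    (onRight (rMat (N + 2) q) * onLeft (rMat (N + 2) q) * onRight (rMat (N + 2) q))
      (inner a, inner b, inner c) (inner k, inner l, inner m) =
    (onRight (rMat N q) * onLeft (rMat N q) * onRight (rMat N q)) (a, b, c) (k, l, m) := by
  rw [mul_onRight_apply, mul_onRight_apply, sum_mul_rMat_inner _ (by
    rw [mul_onLeft_zero]; simp [onRight])]
  refine Finset.sum_congr rfl fun x _ => Finset.sum_congr rfl fun y _ => ?_
  rw [mul_onLeft_apply, mul_onLeft_apply, sum_mul_rMat_inner _ (by simp [onRight])]
  simp only [onRight, rMat_inner, inner_inj]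

theorem braidDefect_eq_zero (hq : q ≠ 0) : ∀ N : ℕ, braidDefect N q = 0
  | 0 => by ext ⟨i, _⟩; exact i.elim0
  | 1 => by
    have h : onLeft (rMat 1 q) = onRight (rMat 1 q) := by
      ext ⟨a, b, c⟩ ⟨k, l, m⟩
      have : ∀ x : Fin 1, x = 0 := fun x => Subsingleton.elim _ _
      rw [this a, this b, this c, this k, this l, this m]
      simp [onLeft, onRight]
    rw [braidDefect, h, sub_self]
  | N + 2 => by
    have ih := braidDefect_eq_zero hq N
    have hsymm : ∀ x y, braidDefect (N + 2) q x y = braidDefect (N + 2) q y x := fun x y =>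
      congrFun (congrFun transpose_braidDefect y) x
    ext ⟨a, b, c⟩ ⟨k, l, m⟩
    rw [Matrix.zero_apply]
    by_cases h1 : (k = 0 ∨ k = Fin.last (N + 1)) ∨ (l = 0 ∨ l = Fin.last (N + 1)) ∨
      (m = 0 ∨ m = Fin.last (N + 1))
    · exact braidDefect_outer hq _ _ _ _ h1
    by_cases h2 : (a = 0 ∨ a = Fin.last (N + 1)) ∨ (b = 0 ∨ b = Fin.last (N + 1)) ∨
      (c = 0 ∨ c = Fin.last (N + 1))
    · rw [hsymm]; exact braidDefect_outer hq _ _ _ _ h2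
    have hin : ∀ x : Fin (N + 2), ¬ (x = 0 ∨ x = Fin.last (N + 1)) → ∃ i, x = inner i := by
      intro x hx
      rcases index_cases x with h | h | h
      · exact absurd (Or.inl h) hx
      · exact absurd (Or.inr h) hx
      · exact h
    simp only [not_or] at h1 h2
    obtain ⟨a, rfl⟩ := hin a (not_or.2 h2.1)
    obtain ⟨b, rfl⟩ := hin b (not_or.2 h2.2.1)
    obtain ⟨c, rfl⟩ := hin c (not_or.2 h2.2.2)
    obtain ⟨k, rfl⟩ := hin k (not_or.2 h1.1)
    obtain ⟨l, rfl⟩ := hin l (not_or.2 h1.2.1)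
    obtain ⟨m, rfl⟩ := hin m (not_or.2 h1.2.2)
    have h := congrFun (congrFun ih (a, b, c)) (k, l, m)
    rw [braidDefect, Matrix.sub_apply] at h ⊢
    rw [onLeft_onRight_onLeft_inner, onRight_onLeft_onRight_inner, h, Matrix.zero_apply]

/-- The braid relation. -/
theorem braid (hq : q ≠ 0) :
    onLeft (rMat N q) * onRight (rMat N q) * onLeft (rMat N q) =
      onRight (rMat N q) * onLeft (rMat N q) * onRight (rMat N q) :=
  sub_eq_zero.1 (braidDefect_eq_zero hq N)

end Braid

/-! ### Operators on tensor powers -/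

section Tensors

variable {N k : ℕ} {q : ℂ}

/-- The coefficient of `γ_a` in the first tensor factor. -/
def slice (a : Fin N) : Tens N (k + 1) →ₗ[ℂ] Tens N k where
  toFun t L := t (Fin.cons a L)
  map_add' _ _ := rfl
  map_smul' _ _ := rfl

/-- The map `t ↦ γ_i ⊗ t`. -/
def consTensor (i : Fin N) : Tens N k →ₗ[ℂ] Tens N (k + 1) where
  toFun t J := if J 0 = i then t (Fin.tail J) else 0
  map_add' s t := by
    funext J
    by_cases h : J 0 = i <;> simp [h]
  map_smul' r t := by
    funext J
    by_cases h : J 0 = i <;> simp [h]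

theorem slice_ext {s t : Tens N (k + 1)} (h : ∀ a, slice a s = slice a t) : s = t := by
  funext J
  have := congrFun (h (J 0)) (Fin.tail J)
  simpa [slice] using this

theorem slice_consTensor (a i : Fin N) (t : Tens N k) :
    slice a (consTensor i t) = if a = i then t else 0 := by
  funext L
  by_cases h : a = i <;> simp [slice, consTensor, h]

theorem sum_consTensor_slice (t : Tens N (k + 1)) : ∑ a, consTensor a (slice a t) = t := by
  refine slice_ext fun b => ?_
  simp [slice_consTensor]

theorem slice_idTensor (A : Module.End ℂ (Tens N k)) (a : Fin N) (t : Tens N (k + 1)) :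
    slice a (idTensor A t) = A (slice a t) := by
  funext L
  simp [slice, idTensor]

theorem idTensor_consTensor (A : Module.End ℂ (Tens N k)) (a : Fin N) (t : Tens N k) :
    idTensor A (consTensor a t) = consTensor a (A t) := by
  refine slice_ext fun b => ?_
  rw [slice_idTensor, slice_consTensor, slice_consTensor]
  split_ifs <;> simp

/-- The algebra map `A ↦ id ⊗ A`. -/
def idTensorHom (N k : ℕ) : Module.End ℂ (Tens N k) →ₐ[ℂ] Module.End ℂ (Tens N (k + 1)) :=
  AlgHom.ofLinearMap
    { toFun := idTensor
      map_add' := fun A B => LinearMap.ext fun t => slice_ext fun a => by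
        simp [slice_idTensor]
      map_smul' := fun r A => LinearMap.ext fun t => slice_ext fun a => by
        simp [slice_idTensor] }
    (LinearMap.ext fun t => slice_ext fun a => by simp [slice_idTensor])
    (fun A B => LinearMap.ext fun t => slice_ext fun a => by simp [slice_idTensor])

theorem idTensorHom_apply (A : Module.End ℂ (Tens N k)) : idTensorHom N k A = idTensor A := rfl

/-- A matrix on `V ⊗ V` acting in the first two tensor factors. -/
def headTwo (M : Matrix (Fin N × Fin N) (Fin N × Fin N) ℂ) (k : ℕ) :
    Module.End ℂ (Tens N (k + 2)) where
  toFun t J := ∑ x, ∑ y, M (J 0, J 1) (x, y) * t (Fin.cons x (Fin.cons y (Fin.tail (Fin.tail J))))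
  map_add' s t := by
    funext J
    simp only [Pi.add_apply, mul_add, Finset.sum_add_distrib]
  map_smul' r t := by
    funext J
    simp only [Pi.smul_apply, smul_eq_mul, RingHom.id_apply, Finset.mul_sum]
    exact Finset.sum_congr rfl fun a _ => Finset.sum_congr rfl fun b _ => by ring

theorem slice_headTwo (M : Matrix (Fin N × Fin N) (Fin N × Fin N) ℂ) (t : Tens N (k + 2))
    (a b : Fin N) : slice b (slice a (headTwo M k t)) =
      ∑ x, ∑ y, M (a, b) (x, y) • slice y (slice x t) := by
  funext L
  simp only [slice, headTwo, LinearMap.coe_mk, AddHom.coe_mk, Finset.sum_apply, Pi.smul_apply,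
    smul_eq_mul]
  rfl

/-- A matrix on `V ⊗ V ⊗ V` acting in the first three tensor factors. -/
def headThree (M : Matrix (Fin N × Fin N × Fin N) (Fin N × Fin N × Fin N) ℂ) (k : ℕ) :
    Module.End ℂ (Tens N (k + 3)) where
  toFun t J := ∑ x, ∑ y, ∑ z, M (J 0, J 1, J 2) (x, y, z) *
    t (Fin.cons x (Fin.cons y (Fin.cons z (Fin.tail (Fin.tail (Fin.tail J))))))
  map_add' s t := by
    funext J
    simp only [Pi.add_apply, mul_add, Finset.sum_add_distrib]
  map_smul' r t := by
    funext J
    simp only [Pi.smul_apply, smul_eq_mul, RingHom.id_apply, Finset.mul_sum]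
    refine Finset.sum_congr rfl fun a _ => Finset.sum_congr rfl fun b _ =>
      Finset.sum_congr rfl fun c _ => by ring

theorem slice_headThree (M : Matrix (Fin N × Fin N × Fin N) (Fin N × Fin N × Fin N) ℂ)
    (t : Tens N (k + 3)) (a b c : Fin N) : slice c (slice b (slice a (headThree M k t))) =
      ∑ x, ∑ y, ∑ z, M (a, b, c) (x, y, z) • slice z (slice y (slice x t)) := by
  funext L
  simp only [slice, headThree, LinearMap.coe_mk, AddHom.coe_mk, Finset.sum_apply, Pi.smul_apply,
    smul_eq_mul]
  rfl

theorem headTwo_mul (A B : Matrix (Fin N × Fin N) (Fin N × Fin N) ℂ) :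
    headTwo (A * B) k = headTwo A k * headTwo B k := by
  refine LinearMap.ext fun t => slice_ext fun a => slice_ext fun b => ?_
  rw [Module.End.mul_apply, slice_headTwo, slice_headTwo]
  simp only [slice_headTwo, Finset.smul_sum, Matrix.mul_apply, Fintype.sum_prod_type,
    Finset.sum_smul, smul_smul]
  conv_lhs => enter [2, x]; rw [Finset.sum_comm]
  rw [Finset.sum_comm]
  refine Finset.sum_congr rfl fun u _ => ?_
  conv_lhs => enter [2, x]; rw [Finset.sum_comm]
  rw [Finset.sum_comm]

theorem headThree_mul (A B : Matrix (Fin N × Fin N × Fin N) (Fin N × Fin N × Fin N) ℂ) :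
    headThree (A * B) k = headThree A k * headThree B k := by
  have h : ∀ (M : Matrix (Fin N × Fin N × Fin N) (Fin N × Fin N × Fin N) ℂ) (t : Tens N (k + 3))
      (a b c : Fin N), slice c (slice b (slice a (headThree M k t))) =
        ∑ z, M (a, b, c) z • slice z.2.2 (slice z.2.1 (slice z.1 t)) := by
    intro M t a b c
    rw [slice_headThree, Fintype.sum_prod_type]
    simp only [Fintype.sum_prod_type]
  refine LinearMap.ext fun t => slice_ext fun a => slice_ext fun b => slice_ext fun c => ?_
  rw [Module.End.mul_apply, h, h]
  simp only [h, Finset.smul_sum, Matrix.mul_apply, Finset.sum_smul, smul_smul]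
  rw [Finset.sum_comm]

theorem headTwo_one : headTwo (1 : Matrix (Fin N × Fin N) (Fin N × Fin N) ℂ) k = 1 := by
  refine LinearMap.ext fun t => slice_ext fun a => slice_ext fun b => ?_
  rw [slice_headTwo]
  simp [Matrix.one_apply, ite_and, Finset.sum_ite_irrel]

theorem headTwo_add (A B : Matrix (Fin N × Fin N) (Fin N × Fin N) ℂ) :
    headTwo (A + B) k = headTwo A k + headTwo B k := by
  refine LinearMap.ext fun t => slice_ext fun a => slice_ext fun b => ?_
  simp [slice_headTwo, add_smul, Finset.sum_add_distrib]

theorem headTwo_sub (A B : Matrix (Fin N × Fin N) (Fin N × Fin N) ℂ) :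
    headTwo (A - B) k = headTwo A k - headTwo B k := by
  refine LinearMap.ext fun t => slice_ext fun a => slice_ext fun b => ?_
  simp [slice_headTwo, sub_smul, Finset.sum_sub_distrib]

theorem headTwo_smul (r : ℂ) (A : Matrix (Fin N × Fin N) (Fin N × Fin N) ℂ) :
    headTwo (r • A) k = r • headTwo A k := by
  refine LinearMap.ext fun t => slice_ext fun a => slice_ext fun b => ?_
  simp [slice_headTwo, Finset.smul_sum, smul_smul]

theorem headThree_onLeft (A : Matrix (Fin N × Fin N) (Fin N × Fin N) ℂ) :
    headThree (onLeft A) k = headTwo A (k + 1) := by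
  refine LinearMap.ext fun t => slice_ext fun a => slice_ext fun b => slice_ext fun c => ?_
  rw [slice_headThree, slice_headTwo]
  simp [onLeft, map_sum]

theorem headThree_onRight (A : Matrix (Fin N × Fin N) (Fin N × Fin N) ℂ) :
    headThree (onRight A) k = idTensor (headTwo A k) := by
  refine LinearMap.ext fun t => slice_ext fun a => slice_ext fun b => slice_ext fun c => ?_
  rw [slice_headThree, slice_idTensor, slice_headTwo, Finset.sum_eq_single a]
  · simp [onRight]
  · intro x _ hx
    simp [onRight, Ne.symm hx]
  · simp

theorem headTwo_comm (A : Matrix (Fin N × Fin N) (Fin N × Fin N) ℂ)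
    (B : Module.End ℂ (Tens N k)) :
    headTwo A k * idTensor (idTensor B) = idTensor (idTensor B) * headTwo A k := by
  refine LinearMap.ext fun t => slice_ext fun a => slice_ext fun b => ?_
  simp [slice_headTwo, slice_idTensor, map_sum]

theorem onPair_one (M : Matrix (Fin N × Fin N) (Fin N × Fin N) ℂ) :
    onPair M (k + 2) 1 = headTwo M k := by
  refine LinearMap.ext fun t => ?_
  funext J
  rw [onPair, dif_pos ⟨le_refl _, by omega⟩]
  simp only [LinearMap.coe_mk, AddHom.coe_mk, headTwo]
  refine Finset.sum_congr rfl fun x _ => Finset.sum_congr rfl fun y _ => ?_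
  congr 2
  funext i
  refine Fin.cases ?_ (fun i => ?_) i
  · rfl
  · refine Fin.cases ?_ (fun i => ?_) i
    · rfl
    · rfl

theorem onPair_succ (M : Matrix (Fin N × Fin N) (Fin N × Fin N) ℂ) (p : ℕ) :
    onPair M (k + 1) (p + 2) = idTensor (onPair M k (p + 1)) := by
  by_cases h : p + 2 ≤ k
  · refine LinearMap.ext fun t => slice_ext fun a => ?_
    rw [slice_idTensor]
    funext J
    rw [onPair, onPair, dif_pos ⟨by omega, by omega⟩, dif_pos ⟨by omega, by omega⟩]
    simp only [LinearMap.coe_mk, AddHom.coe_mk, slice]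
    refine Finset.sum_congr rfl fun x _ => Finset.sum_congr rfl fun y _ => ?_
    congr 2
    rw [Fin.cons_update, Fin.cons_update]
    rfl
  -- Out of range both `onPair` operators are the identity, which id ⊗ · preserves.
  · rw [onPair, onPair, dif_neg (by omega), dif_neg (by omega), ← idTensorHom_apply, map_one]

end Tensors

/-! ### The Birman–Wenzl–Murakami relations on tensor powers -/

section BMW

variable (N : ℕ) (q : ℂ) (k : ℕ)

/-- `R̂` in the first two tensor factors. -/
noncomputable def headR : Module.End ℂ (Tens N (k + 2)) := headTwo (rMat N q) k

/-- `K` in the first two tensor factors. -/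
noncomputable def headK : Module.End ℂ (Tens N (k + 2)) := headTwo (kMat N q) k

/-- `R̂⁻¹` in the first two tensor factors. -/
noncomputable def headRInv : Module.End ℂ (Tens N (k + 2)) := headTwo (rInv N q) k

variable {N q k}

theorem headThree_headR : headThree (onLeft (rMat N q)) k = headR N q (k + 1) :=
  headThree_onLeft _

theorem headThree_headR' : headThree (onRight (rMat N q)) k = idTensor (headR N q k) :=
  headThree_onRight _

theorem headThree_headK : headThree (onLeft (kMat N q)) k = headK N q (k + 1) :=
  headThree_onLeft _

theorem headThree_headK' : headThree (onRight (kMat N q)) k = idTensor (headK N q k) :=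
  headThree_onRight _

theorem headThree_headRInv : headThree (onLeft (rInv N q)) k = headRInv N q (k + 1) :=
  headThree_onLeft _

theorem headThree_headRInv' : headThree (onRight (rInv N q)) k = idTensor (headRInv N q k) :=
  headThree_onRight _

theorem headRInv_mul_headR (hq : q ≠ 0) : headRInv N q k * headR N q k = 1 := by
  rw [headR, headRInv, ← headTwo_mul, rInv_mul_rMat hq, headTwo_one]

theorem headRInv_eq :
    headRInv N q k = headR N q k - lam q • (1 - headK N q k) := by
  rw [headRInv, rInv, headTwo_sub, headTwo_smul, headTwo_sub, headTwo_one, headR, headK]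

theorem headR_mul_headK (hq : q ≠ 0) : headR N q k * headK N q k = nu N q • headK N q k := by
  rw [headR, headK, ← headTwo_mul, rMat_mul_kMat hq, headTwo_smul]

theorem headK_mul_headR (hq : q ≠ 0) : headK N q k * headR N q k = nu N q • headK N q k := by
  rw [headR, headK, ← headTwo_mul, kMat_mul_rMat hq, headTwo_smul]

theorem headR_mul_headR (hq : q ≠ 0) : headR N q k * headR N q k =
    1 + lam q • headR N q k - (lam q * nu N q) • headK N q k := by
  rw [headR, headK, ← headTwo_mul, rMat_mul_rMat hq, headTwo_sub, headTwo_add, headTwo_smul,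
    headTwo_smul, headTwo_one]

theorem headR_braid (hq : q ≠ 0) :
    headR N q (k + 1) * idTensor (headR N q k) * headR N q (k + 1) =
      idTensor (headR N q k) * headR N q (k + 1) * idTensor (headR N q k) := by
  simp only [← headThree_headR, ← headThree_headR', ← headThree_mul, braid hq]

theorem headK_headR_headR (hq : q ≠ 0) :
    headK N q (k + 1) * idTensor (headR N q k) * headR N q (k + 1) =
      headK N q (k + 1) * idTensor (headK N q k) := by
  simp only [← headThree_headR, ← headThree_headR', ← headThree_headK, ← headThree_headK',
    ← headThree_mul, kMat_rMat_rMat hq]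

theorem headR_headR_idTensor_headK (hq : q ≠ 0) :
    idTensor (headR N q k) * headR N q (k + 1) * idTensor (headK N q k) =
      headK N q (k + 1) * idTensor (headK N q k) := by
  simp only [← headThree_headR, ← headThree_headR', ← headThree_headK, ← headThree_headK',
    ← headThree_mul, rMat_rMat_kMat_right hq]

theorem headK_headK_headR (hq : q ≠ 0) :
    headK N q (k + 1) * idTensor (headK N q k) * headR N q (k + 1) =
      headK N q (k + 1) * idTensor (headRInv N q k) := by
  simp only [← headThree_headR, ← headThree_headRInv', ← headThree_headK, ← headThree_headK',
    ← headThree_mul, kMat_mul_rInv_right hq]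

theorem headRInv_idTensor_headK (hq : q ≠ 0) :
    headRInv N q (k + 1) * idTensor (headK N q k) =
      idTensor (headR N q k) * headK N q (k + 1) * idTensor (headK N q k) := by
  simp only [← headThree_headRInv, ← headThree_headR', ← headThree_headK, ← headThree_headK',
    ← headThree_mul, rInv_mul_kMat_right hq]

end BMW

/-! ### b⁻ by recursion on the first tensor factor -/

section Recursion

variable (N : ℕ) (q : ℂ)

/-- The braided sum `∑ (-q⁻²)^i R̂₁₂ ⋯ R̂_{i,i+1}` on `V^{⊗(k+1)}`. -/
noncomputable def braidSum : (k : ℕ) → Module.End ℂ (Tens N (k + 1))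
  | 0 => 1
  | k + 1 => 1 - q ^ (-2 : ℤ) • (headR N q k * idTensor (braidSum k))

/-- The contracted part `∑ q^{4i-4k-2} d'⁻_{k+1,i}` of `b⁻_{1,k}`. -/
noncomputable def cupSum : (k : ℕ) → Module.End ℂ (Tens N (k + 1))
  | 0 => 0
  | k + 1 => q ^ (-2 : ℤ) •
      (headK N q k * idTensor (braidSum N q k + q ^ (-2 : ℤ) • cupSum k))

/-- The coefficient of the contracted part in `b⁻_{1,k}`. -/
noncomputable def cupCoeff (k : ℕ) : ℂ :=
  qPlus q * qMinus q / (1 + q ^ (2 * (N : ℤ) - 4 * (k : ℤ)))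

variable {N q}

theorem prod_onPair_succ (M : Matrix (Fin N × Fin N) (Fin N × Fin N) ℂ) (k c i : ℕ) :
    ((List.range i).map fun a => onPair M (k + 1) (c + 1 + (a + 1))).prod =
      idTensor ((List.range i).map fun a => onPair M k (c + (a + 1))).prod := by
  rw [← idTensorHom_apply, map_list_prod, List.map_map]
  congr 1
  refine List.map_congr_left fun a _ => ?_
  rw [Function.comp_apply, idTensorHom_apply, ← add_assoc c a 1, ← onPair_succ]
  congr 1; ring

theorem prod_onPair_range_succ (M : Matrix (Fin N × Fin N) (Fin N × Fin N) ℂ) (k i : ℕ) :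
    ((List.range (i + 1)).map fun a => onPair M (k + 2) (a + 1)).prod =
      headTwo M k * idTensor ((List.range i).map fun a => onPair M (k + 1) (a + 1)).prod := by
  rw [List.range_succ_eq_map, List.map_cons, List.prod_cons, onPair_one, List.map_map]
  have := prod_onPair_succ M (k + 1) 0 i
  simp only [zero_add] at this
  rw [← this]
  congr 3
  funext a
  simp [add_comm]

theorem braidSum_eq (k : ℕ) : braidSum N q k =
    ∑ i ∈ Finset.range (k + 1), (-q ^ (-2 : ℤ)) ^ i •
      ((List.range i).map fun a => onPair (rMat N q) (k + 1) (a + 1)).prod := by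
  induction k with
  | zero => simp [braidSum]
  | succ k ih =>
    rw [Finset.sum_range_succ', braidSum, ih]
    simp only [prod_onPair_range_succ, List.range_zero, List.map_nil, List.prod_nil, pow_zero,
      one_smul]
    rw [← idTensorHom_apply, map_sum, Finset.mul_sum, Finset.smul_sum, sub_eq_add_neg]
    refine (add_comm _ _).trans ?_
    rw [← Finset.sum_neg_distrib]
    congr 1
    refine Finset.sum_congr rfl fun i _ => ?_
    rw [map_smul, idTensorHom_apply, mul_smul_comm, smul_smul, ← neg_smul, pow_succ', headR]
    congr 1; ring

/-- With i fixed, one more factor only puts K₁₂ in front of the chain of K's and shifts the rest.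
The only element not obtained in this way is the top one, i = k + 1, treated next. -/
theorem dPrime_succ (k i : ℕ) (hk : i ≤ k) :
    dPrime N q (k + 1) i = headK N q k * idTensor (dPrime N q k i) := by
  obtain ⟨c, rfl⟩ := Nat.exists_eq_add_of_le hk
  have h1 : i + c + 1 - i = c + 1 := by omega
  have h2 : i + c - i = c := by omega
  rw [dPrime, dPrime, h1, h2, prod_onPair_range_succ, ← idTensorHom_apply, ← idTensorHom_apply,
    map_mul, ← mul_assoc, map_sum]
  congr 1
  refine Finset.sum_congr rfl fun j _ => ?_
  rw [map_smul, idTensorHom_apply, prod_onPair_succ]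

theorem dPrime_self (k : ℕ) :
    dPrime N q (k + 1) (k + 1) = headK N q k * idTensor (braidSum N q k) := by
  rw [dPrime, Nat.sub_self, prod_onPair_range_succ, braidSum_eq, ← idTensorHom_apply,
    ← idTensorHom_apply, map_sum]
  simp only [List.range_zero, List.map_nil, List.prod_nil, map_one, mul_one]
  congr 1
  refine Finset.sum_congr rfl fun j _ => ?_
  rw [map_smul, idTensorHom_apply, prod_onPair_succ (c := 0)]
  simp

theorem cupSum_eq (hq : q ≠ 0) (k : ℕ) : cupSum N q k =
    ∑ i ∈ Finset.Icc 1 k, q ^ (4 * (i : ℤ) - 4 * (k : ℤ) - 2) • dPrime N q k i := by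
  induction k with
  | zero => simp [cupSum]
  | succ k ih =>
    rw [Finset.sum_Icc_succ_top (by omega), dPrime_self, cupSum, ih]
    have h : ∑ i ∈ Finset.Icc 1 k, q ^ (4 * (i : ℤ) - 4 * ((k + 1 : ℕ) : ℤ) - 2) •
        dPrime N q (k + 1) i = q ^ (-2 : ℤ) • (headK N q k * idTensor (q ^ (-2 : ℤ) •
          ∑ i ∈ Finset.Icc 1 k, q ^ (4 * (i : ℤ) - 4 * (k : ℤ) - 2) • dPrime N q k i)) := by
      rw [← idTensorHom_apply, map_smul, map_sum, mul_smul_comm, smul_smul, Finset.mul_sum,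
        Finset.smul_sum]
      refine Finset.sum_congr rfl fun i hi => ?_
      rw [dPrime_succ k i (Finset.mem_Icc.1 hi).2, map_smul,
        mul_smul_comm, smul_smul, ← zpow_add₀ hq, ← zpow_add₀ hq, idTensorHom_apply]
      congr 2
      push_cast; ring
    rw [h, ← idTensorHom_apply, map_add, mul_add, smul_add, idTensorHom_apply,
      idTensorHom_apply]
    refine (add_comm _ _).trans ?_
    congr 3
    push_cast; ring

theorem bMinus_eq (hq : q ≠ 0) (k : ℕ) :
    bMinus N q k = braidSum N q k - cupCoeff N q k • cupSum N q k := by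
  rw [bMinus, braidSum_eq, cupSum_eq hq, cupCoeff]

end Recursion

/-! ### The quadratic relations and the antisymmetrizers -/

section Relations

variable {N : ℕ} {q : ℂ} {k : ℕ}

/-- The subspace `V ⊗ W`. -/
def consSub (W : Submodule ℂ (Tens N k)) : Submodule ℂ (Tens N (k + 1)) :=
  ⨅ a, W.comap (slice a)

theorem mem_consSub {W : Submodule ℂ (Tens N k)} {t : Tens N (k + 1)} :
    t ∈ consSub W ↔ ∀ a, slice a t ∈ W := by
  simp [consSub]

theorem consSub_mono {W W' : Submodule ℂ (Tens N k)} (h : W ≤ W') : consSub W ≤ consSub W' :=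
  fun _ ht => mem_consSub.2 fun a => h (mem_consSub.1 ht a)

theorem consTensor_mem {W : Submodule ℂ (Tens N k)} {t : Tens N k} (ht : t ∈ W) (i : Fin N) :
    consTensor i t ∈ consSub W := by
  refine mem_consSub.2 fun a => ?_
  rw [slice_consTensor]
  split_ifs
  exacts [ht, W.zero_mem]

theorem idTensor_mem {W W' : Submodule ℂ (Tens N k)} {A : Module.End ℂ (Tens N k)}
    (h : ∀ t ∈ W, A t ∈ W') {t : Tens N (k + 1)} (ht : t ∈ consSub W) :
    idTensor A t ∈ consSub W' :=
  mem_consSub.2 fun a => by rw [slice_idTensor]; exact h _ (mem_consSub.1 ht a)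

theorem headTwo_mem (M : Matrix (Fin N × Fin N) (Fin N × Fin N) ℂ) {W : Submodule ℂ (Tens N k)}
    {t : Tens N (k + 2)} (ht : t ∈ consSub (consSub W)) :
    headTwo M k t ∈ consSub (consSub W) := by
  refine mem_consSub.2 fun a => mem_consSub.2 fun b => ?_
  rw [slice_headTwo]
  exact Submodule.sum_mem _ fun x _ => Submodule.sum_mem _ fun y _ =>
    W.smul_mem _ (mem_consSub.1 (mem_consSub.1 ht x) y)

variable (N q) in
/-- The degree `k` part of the ideal of the tensor algebra generated by the image of
`R̂ + q⁻²`. -/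
noncomputable def relSub : (k : ℕ) → Submodule ℂ (Tens N k)
  | 0 => ⊥
  | 1 => ⊥
  | k + 2 => consSub (relSub (k + 1)) ⊔ LinearMap.range (headR N q k + q ^ (-2 : ℤ) • 1)

theorem consSub_bot : consSub (⊥ : Submodule ℂ (Tens N k)) = ⊥ := by
  refine eq_bot_iff.2 fun t ht => ?_
  rw [Submodule.mem_bot]
  refine slice_ext fun a => ?_
  rw [map_zero]
  exact (Submodule.mem_bot ℂ).1 (mem_consSub.1 ht a)

theorem consSub_relSub_le : ∀ k, consSub (relSub N q k) ≤ relSub N q (k + 1)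
  | 0 => by rw [relSub, consSub_bot]; exact bot_le
  | _ + 1 => le_sup_left

theorem headR_add_mem (t : Tens N (k + 2)) :
    headR N q k t + q ^ (-2 : ℤ) • t ∈ relSub N q (k + 2) :=
  Submodule.mem_sup_right ⟨t, rfl⟩

theorem mkQ_eq_iff {W : Submodule ℂ (Tens N k)} {s t : Tens N k} :
    W.mkQ s = W.mkQ t ↔ s - t ∈ W := by
  rw [Submodule.mkQ_apply, Submodule.mkQ_apply, Submodule.Quotient.eq]

theorem mkQ_headR (t : Tens N (k + 2)) : (relSub N q (k + 2)).mkQ (headR N q k t) =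
    -q ^ (-2 : ℤ) • (relSub N q (k + 2)).mkQ t := by
  rw [← map_smul, mkQ_eq_iff, neg_smul, sub_neg_eq_add]
  exact headR_add_mem t

theorem mkQ_consSub_of {W : Submodule ℂ (Tens N k)} {A B : Module.End ℂ (Tens N k)}
    (h : ∀ t, W.mkQ (A t) = W.mkQ (B t)) (t : Tens N (k + 1)) :
    (consSub W).mkQ (idTensor A t) = (consSub W).mkQ (idTensor B t) := by
  rw [mkQ_eq_iff]
  refine mem_consSub.2 fun a => ?_
  rw [map_sub, slice_idTensor, slice_idTensor]
  exact mkQ_eq_iff.1 (h _)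

theorem idTensor_smul_one (r : ℂ) (t : Tens N (k + 1)) :
    idTensor (r • (1 : Module.End ℂ (Tens N k))) t = r • t := by
  rw [← idTensorHom_apply, map_smul, map_one]; rfl

theorem mkQ_idTensor_headR (t : Tens N (k + 3)) :
    (consSub (relSub N q (k + 2))).mkQ (idTensor (headR N q k) t) =
      -q ^ (-2 : ℤ) • (consSub (relSub N q (k + 2))).mkQ t := by
  rw [mkQ_consSub_of (B := (-q ^ (-2 : ℤ)) • 1) (fun s => by
    rw [mkQ_headR, ← map_smul]; rfl), idTensor_smul_one, map_smul]

theorem mkQ_of_le {W W' : Submodule ℂ (Tens N k)} (h : W ≤ W') {s t : Tens N k}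
    (hst : W.mkQ s = W.mkQ t) : W'.mkQ s = W'.mkQ t :=
  mkQ_eq_iff.2 (h (mkQ_eq_iff.1 hst))

/-- `q` is generic: it is not a root of unity. -/
def Generic (q : ℂ) : Prop := q ≠ 0 ∧ ∀ m : ℕ, 0 < m → q ^ m ≠ 1

theorem Generic.zpow_ne_one (hq : Generic q) {m : ℤ} (hm : m ≠ 0) : q ^ m ≠ 1 := by
  rcases Int.natAbs_eq m with h | h
  · rw [h, zpow_natCast]; exact hq.2 _ (by omega)
  · rw [h, zpow_neg, zpow_natCast, ne_eq, inv_eq_one]; exact hq.2 _ (by omega)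

/-- If q^m = -1 then q^{2m} = 1, which forces m = 0, where the sum is 2. This clears the
denominators of b⁻, g and the contraction coefficients. -/
theorem Generic.one_add_zpow_ne_zero (hq : Generic q) (m : ℤ) : 1 + q ^ m ≠ 0 := by
  intro h
  by_cases hm : m = 0
  · subst hm; norm_num at h
  · refine hq.zpow_ne_one (m := m + m) (by omega) ?_
    rw [zpow_add₀ hq.1]
    linear_combination (q ^ m - 1) * h

theorem lam_eq (q : ℂ) : lam q = (q ^ (-2 : ℤ))⁻¹ - q ^ (-2 : ℤ) := by
  rw [lam, ← zpow_neg]; rfl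

/-- With p = q⁻², the coefficient identities of the descent become rational identities in p and
q^{-2N}, treated as independent. -/
theorem nu_eq (hq : q ≠ 0) : nu N q = (q ^ (-2 : ℤ))⁻¹ * q ^ (-2 * (N : ℤ)) := by
  rw [nu, ← zpow_neg, ← zpow_add₀ hq]; congr 1

theorem Generic.nu_add_ne_zero (hq : Generic q) : nu N q + q ^ (-2 : ℤ) ≠ 0 := by
  have h := mul_ne_zero (zpow_ne_zero (-2) hq.1) (hq.one_add_zpow_ne_zero (4 - 2 * (N : ℤ)))
  rw [mul_add, mul_one, ← zpow_add₀ hq.1, add_comm] at h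
  rw [nu]
  convert h using 3
  ring

/-- On the image of K₁₂ the operator R̂₁₂ + q⁻² is the nonzero scalar ν + q⁻². -/
theorem headK_mem (hq : Generic q) (t : Tens N (k + 2)) : headK N q k t ∈ relSub N q (k + 2) := by
  have h := headR_add_mem (q := q) (headK N q k t)
  have e := LinearMap.congr_fun (headR_mul_headK (N := N) (k := k) hq.1) t
  rw [Module.End.mul_apply, LinearMap.smul_apply] at e
  rw [e, ← add_smul] at h
  exact (Submodule.smul_mem_iff _ hq.nu_add_ne_zero).1 h

theorem mkQ_headK (hq : Generic q) (t : Tens N (k + 2)) :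
    (relSub N q (k + 2)).mkQ (headK N q k t) = 0 := by
  rw [Submodule.mkQ_apply, Submodule.Quotient.mk_eq_zero]
  exact headK_mem hq t

theorem Generic.one_sub_ne_zero (hq : Generic q) : 1 - q ^ (-4 : ℤ) ≠ 0 :=
  sub_ne_zero.2 (hq.zpow_ne_one (by norm_num)).symm

theorem qNum_succ (hq : Generic q) (m : ℕ) :
    qNum q (m + 1) = 1 + (q ^ (-2 : ℤ)) ^ 2 * qNum q m := by
  have h := hq.one_sub_ne_zero
  have e : (q ^ (-2 : ℤ)) ^ 2 = q ^ (-4 : ℤ) := by rw [← zpow_natCast, ← zpow_mul]; norm_num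
  have e2 : q ^ (-4 * ((m + 1 : ℕ) : ℤ)) = q ^ (-4 : ℤ) * q ^ (-4 * (m : ℤ)) := by
    rw [← zpow_add₀ hq.1]; congr 1; push_cast; ring
  rw [qNum, qNum, e, e2]
  generalize q ^ (-4 : ℤ) = x at h
  field_simp
  ring

theorem one_sub_mul_qNum (hq : Generic q) (m : ℕ) :
    (1 - (q ^ (-2 : ℤ)) ^ 2) * qNum q m = 1 - (q ^ (-2 : ℤ)) ^ (2 * m) := by
  have h := hq.one_sub_ne_zero
  have e : (q ^ (-2 : ℤ)) ^ 2 = q ^ (-4 : ℤ) := by rw [← zpow_natCast, ← zpow_mul]; norm_num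
  rw [qNum, pow_mul, e, mul_div_cancel₀ _ h, ← zpow_natCast, ← zpow_mul]

theorem Generic.qNum_ne_zero (hq : Generic q) (m : ℕ) : qNum q (m + 1) ≠ 0 := by
  rw [qNum]
  exact div_ne_zero (sub_ne_zero.2 (hq.zpow_ne_one (by push_cast; omega)).symm) hq.one_sub_ne_zero

theorem braidSum_succ_apply (t : Tens N (k + 2)) : braidSum N q (k + 1) t =
    t - q ^ (-2 : ℤ) • headR N q k (idTensor (braidSum N q k) t) := rfl

theorem cupSum_succ_apply (t : Tens N (k + 2)) : cupSum N q (k + 1) t =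
    q ^ (-2 : ℤ) • headK N q k (idTensor (braidSum N q k) t +
      q ^ (-2 : ℤ) • idTensor (cupSum N q k) t) := by
  rw [cupSum, ← idTensorHom_apply, map_add, map_smul]; rfl

/-- Modulo relations each R̂ is -q⁻², so the i-th summand becomes q^{-4i} and the sum is geometric.
-/
theorem mkQ_braidSum (hq : Generic q) : ∀ (k : ℕ) (t : Tens N (k + 1)),
    (relSub N q (k + 1)).mkQ (braidSum N q k t) = qNum q (k + 1) • (relSub N q (k + 1)).mkQ t
  | 0, t => by
    have : qNum q 1 = 1 := by
      rw [qNum]; simp only [Nat.cast_one, mul_one]; exact div_self hq.one_sub_ne_zero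
    rw [this, one_smul]; rfl
  | k + 1, t => by
    have h : (relSub N q (k + 2)).mkQ (idTensor (braidSum N q k) t) =
        qNum q (k + 1) • (relSub N q (k + 2)).mkQ t := by
      have h1 := mkQ_of_le (consSub_relSub_le (N := N) (q := q) (k + 1))
        (mkQ_consSub_of (A := braidSum N q k) (B := qNum q (k + 1) • 1)
          (fun s => by rw [mkQ_braidSum hq k s, ← map_smul]; rfl) t)
      rw [h1, idTensor_smul_one, map_smul]
    rw [braidSum_succ_apply, map_sub, map_smul, mkQ_headR, h, qNum_succ hq (k + 1)]
    module

theorem mkQ_cupSum (hq : Generic q) : ∀ (k : ℕ) (t : Tens N (k + 1)),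
    (relSub N q (k + 1)).mkQ (cupSum N q k t) = 0
  | 0, t => by simp [cupSum]
  | k + 1, t => by rw [cupSum_succ_apply, map_smul, mkQ_headK hq, smul_zero]

theorem mkQ_bMinus (hq : Generic q) (k : ℕ) (t : Tens N (k + 1)) :
    (relSub N q (k + 1)).mkQ (bMinus N q k t) = qNum q (k + 1) • (relSub N q (k + 1)).mkQ t := by
  rw [bMinus_eq hq.1, LinearMap.sub_apply, LinearMap.smul_apply, map_sub, map_smul,
    mkQ_braidSum hq, mkQ_cupSum hq, smul_zero, sub_zero]

end Relations

/-! ### The kernel of the antisymmetrizer -/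

section Descent

variable {N : ℕ} {q : ℂ} {k : ℕ}

theorem headTwo_comm_apply (A : Matrix (Fin N × Fin N) (Fin N × Fin N) ℂ)
    (B : Module.End ℂ (Tens N k)) (t : Tens N (k + 2)) :
    headTwo A k (idTensor (idTensor B) t) = idTensor (idTensor B) (headTwo A k t) :=
  LinearMap.congr_fun (headTwo_comm A B) t

theorem headR_comm (B : Module.End ℂ (Tens N k)) (t : Tens N (k + 2)) :
    headR N q k (idTensor (idTensor B) t) = idTensor (idTensor B) (headR N q k t) :=
  headTwo_comm_apply _ B t

theorem headK_comm (B : Module.End ℂ (Tens N k)) (t : Tens N (k + 2)) :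
    headK N q k (idTensor (idTensor B) t) = idTensor (idTensor B) (headK N q k t) :=
  headTwo_comm_apply _ B t

theorem idTensor_add_apply (A B : Module.End ℂ (Tens N k)) (t : Tens N (k + 1)) :
    idTensor (A + B) t = idTensor A t + idTensor B t := by
  rw [← idTensorHom_apply, map_add]; rfl

theorem idTensor_smul_apply (r : ℂ) (A : Module.End ℂ (Tens N k)) (t : Tens N (k + 1)) :
    idTensor (r • A) t = r • idTensor A t := by
  rw [← idTensorHom_apply, map_smul]; rfl

theorem idTensor_mul_apply (A B : Module.End ℂ (Tens N k)) (t : Tens N (k + 1)) :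
    idTensor (A * B) t = idTensor A (idTensor B t) := by
  rw [← idTensorHom_apply, map_mul]; rfl

theorem idTensor_braidSum_succ (t : Tens N (k + 3)) : idTensor (braidSum N q (k + 1)) t =
    t - q ^ (-2 : ℤ) • idTensor (headR N q k) (idTensor (idTensor (braidSum N q k)) t) := by
  refine slice_ext fun a => ?_
  simp only [map_sub, map_smul, slice_idTensor, braidSum_succ_apply]

theorem idTensor_cupSum_succ (t : Tens N (k + 3)) : idTensor (cupSum N q (k + 1)) t =
    q ^ (-2 : ℤ) • idTensor (headK N q k) (idTensor (idTensor (braidSum N q k)) t +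
      q ^ (-2 : ℤ) • idTensor (idTensor (cupSum N q k)) t) := by
  refine slice_ext fun a => ?_
  simp only [map_add, map_smul, slice_idTensor, cupSum_succ_apply]

/-- The inverse in the second and third factors: `R̂₂₃⁻¹ = R̂₂₃ - (Q - Q⁻¹)(1 - K₂₃)`. -/
theorem idTensor_headRInv (t : Tens N (k + 3)) : idTensor (headRInv N q k) t =
    idTensor (headR N q k) t - lam q • (t - idTensor (headK N q k) t) := by
  refine slice_ext fun a => ?_
  rw [headRInv_eq]
  simp only [map_sub, map_smul, slice_idTensor]
  rfl

/-- The cup part on the factors from the third on is zero or starts with K₃₄, and R̂₂₃⁻¹K₃₄ =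
R̂₃₄K₂₃K₃₄. Now R̂₃₄ commutes with K₁₂ and acts as -q⁻² modulo V ⊗ I. -/
theorem mkQ_headK_headRInv_cupSum (hq : Generic q) : ∀ (k : ℕ) (t : Tens N (k + 3)),
    (consSub (relSub N q (k + 2))).mkQ (headK N q (k + 1) (idTensor (headRInv N q k)
      (idTensor (idTensor (cupSum N q k)) t))) =
    -q ^ (-2 : ℤ) • (consSub (relSub N q (k + 2))).mkQ (headK N q (k + 1)
      (idTensor (headK N q k) (idTensor (idTensor (cupSum N q k)) t)))
  | 0, t => by
    have : idTensor (idTensor (cupSum N q 0)) t = 0 := by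
      refine slice_ext fun a => slice_ext fun b => ?_
      rw [slice_idTensor, slice_idTensor]; simp [cupSum]
    simp only [this, map_zero, smul_zero]
  | k + 1, t => by
    obtain ⟨w, hw⟩ : ∃ w, idTensor (idTensor (cupSum N q (k + 1))) t =
        idTensor (idTensor (headK N q k)) w := by
      refine ⟨idTensor (idTensor (q ^ (-2 : ℤ) • idTensor (braidSum N q k + q ^ (-2 : ℤ) • cupSum N q k))) t, ?_⟩
      refine slice_ext fun a => slice_ext fun b => ?_
      simp only [slice_idTensor]
      rw [cupSum]
      simp
    have e := congrArg (idTensorHom N (k + 3)) (headRInv_idTensor_headK (N := N) (k := k) hq.1)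
    simp only [map_mul, idTensorHom_apply] at e
    have e' := LinearMap.congr_fun e w
    simp only [Module.End.mul_apply] at e'
    rw [hw, e', headK_comm]
    have h := mkQ_of_le (consSub_mono (consSub_relSub_le (N := N) (q := q) (k + 2)))
      (mkQ_consSub_of (A := idTensor (headR N q k)) (B := (-q ^ (-2 : ℤ)) • 1)
        (fun s => by rw [mkQ_idTensor_headR, ← map_smul]; rfl)
        (headK N q (k + 2) (idTensor (headK N q (k + 1)) (idTensor (idTensor (headK N q k)) w))))
    rw [h, idTensor_smul_one, map_smul]

/-- The common coefficient in the descent of `b⁻` to the quotient. -/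
noncomputable def cupWeight (N : ℕ) (q : ℂ) (k : ℕ) : ℂ :=
  q ^ (-2 * (N : ℤ)) + (q ^ (-2 : ℤ)) ^ (2 * k)

/-- With S'' the braided sum from the third factor on, S = 1 - q⁻²R̂₁₂ + q⁻⁴R̂₁₂R̂₂₃S''. The
quadratic relation reduces (1 - q⁻²R̂₁₂)(R̂₁₂ + q⁻²) to a multiple of K₁₂. In the rest the braid
relation brings R̂₂₃ to the front, where it is -q⁻², and the two terms cancel. -/
theorem braidSum_headR_add (hq : Generic q) (y : Tens N (k + 3)) :
    (consSub (relSub N q (k + 2))).mkQ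
      (braidSum N q (k + 2) (headR N q (k + 1) y + q ^ (-2 : ℤ) • y)) =
    (lam q * q ^ (-2 * (N : ℤ))) • (consSub (relSub N q (k + 2))).mkQ (headK N q (k + 1) y) := by
  have h2 := fun t => LinearMap.congr_fun (headR_mul_headR (N := N) (k := k + 1) hq.1) t
  have hb := fun t => LinearMap.congr_fun (headR_braid (N := N) (k := k) hq.1) t
  simp only [Module.End.mul_apply, LinearMap.add_apply, LinearMap.sub_apply, LinearMap.smul_apply,
    Module.End.one_apply] at h2 hb
  have hp : q ^ (-2 : ℤ) ≠ 0 := zpow_ne_zero _ hq.1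
  rw [braidSum_succ_apply, idTensor_braidSum_succ]
  simp only [map_add, map_sub, map_smul, ← headR_comm, h2, hb, mkQ_idTensor_headR]
  rw [nu_eq hq.1, lam_eq]
  generalize q ^ (-2 : ℤ) = p at hp
  match_scalars <;> field_simp <;> ring

/-- Unfolding two steps and using K₁₂R̂₂₃R̂₁₂ = K₁₂K₂₃ and K₁₂K₂₃R̂₁₂ = K₁₂R̂₂₃⁻¹, all terms with
R̂₂₃ or K₂₃ cancel. What remains is K₁₂y with a coefficient containing the geometric sum [k+1],
which collapses to `cupWeight`. -/
theorem cupSum_headR_add (hq : Generic q) (y : Tens N (k + 3)) :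
    (consSub (relSub N q (k + 2))).mkQ
      (cupSum N q (k + 2) (headR N q (k + 1) y + q ^ (-2 : ℤ) • y)) =
    cupWeight N q (k + 2) • (consSub (relSub N q (k + 2))).mkQ (headK N q (k + 1) y) := by
  have h1 := fun t => LinearMap.congr_fun (headK_mul_headR (N := N) (k := k + 1) hq.1) t
  have h2 := fun t => LinearMap.congr_fun (headK_headR_headR (N := N) (k := k) hq.1) t
  have h3 := fun t => LinearMap.congr_fun (headK_headK_headR (N := N) (k := k) hq.1) t
  simp only [Module.End.mul_apply, LinearMap.smul_apply] at h1 h2 h3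
  have hp : q ^ (-2 : ℤ) ≠ 0 := zpow_ne_zero _ hq.1
  have hs : (consSub (relSub N q (k + 2))).mkQ
      (headK N q (k + 1) (idTensor (idTensor (braidSum N q k)) y)) =
      qNum q (k + 1) • (consSub (relSub N q (k + 2))).mkQ (headK N q (k + 1) y) := by
    rw [headK_comm]
    have h := mkQ_of_le (consSub_mono (consSub_relSub_le (N := N) (q := q) (k + 1)))
      (mkQ_consSub_of (A := idTensor (braidSum N q k)) (B := qNum q (k + 1) • 1)
        (fun s => by
          rw [mkQ_consSub_of (B := qNum q (k + 1) • 1)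
            (fun s => by rw [mkQ_braidSum hq, ← map_smul]; rfl), idTensor_smul_one]; rfl)
        (headK N q (k + 1) y))
    rw [h, idTensor_smul_one, map_smul]
  have hu := mkQ_headK_headRInv_cupSum (N := N) hq k y
  have hn := one_sub_mul_qNum hq (k + 1)
  rw [cupSum_succ_apply, idTensor_braidSum_succ, idTensor_cupSum_succ]
  simp only [map_add, map_sub, map_smul, ← headR_comm, h1, h2, h3]
  simp only [idTensor_headRInv, map_sub, map_smul, hs] at hu ⊢
  rw [cupWeight, nu_eq hq.1]
  rw [lam_eq] at hu ⊢
  have hn' := congrArg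
    (fun r => r • (consSub (relSub N q (k + 2))).mkQ (headK N q (k + 1) y)) hn
  generalize q ^ (-2 : ℤ) = p at *
  -- `hu` removes the terms with the inner cup sum; `hn'` evaluates (1 - p²)[k+1].
  linear_combination (norm := (match_scalars <;> field_simp <;> ring)) p ^ 4 • hu - p ^ 2 • hn'

theorem braidSum_one_headR_add (hq : Generic q) (y : Tens N 2) :
    (consSub (relSub N q 1)).mkQ (braidSum N q 1 (headR N q 0 y + q ^ (-2 : ℤ) • y)) =
      (lam q * q ^ (-2 * (N : ℤ))) • (consSub (relSub N q 1)).mkQ (headK N q 0 y) := by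
  have h2 := LinearMap.congr_fun (headR_mul_headR (N := N) (k := 0) hq.1) y
  have hi : ∀ t : Tens N 2, idTensor (braidSum N q 0) t = t := fun t =>
    slice_ext fun a => by rw [slice_idTensor]; rfl
  simp only [Module.End.mul_apply, LinearMap.add_apply, LinearMap.sub_apply,
    LinearMap.smul_apply, Module.End.one_apply] at h2
  have hp : q ^ (-2 : ℤ) ≠ 0 := zpow_ne_zero _ hq.1
  rw [braidSum_succ_apply, hi]
  simp only [map_add, map_sub, map_smul, h2]
  rw [nu_eq hq.1, lam_eq]
  generalize q ^ (-2 : ℤ) = p at hp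
  match_scalars <;> field_simp <;> ring

theorem cupSum_one_headR_add (hq : Generic q) (y : Tens N 2) :
    (consSub (relSub N q 1)).mkQ (cupSum N q 1 (headR N q 0 y + q ^ (-2 : ℤ) • y)) =
      cupWeight N q 1 • (consSub (relSub N q 1)).mkQ (headK N q 0 y) := by
  have h1 := LinearMap.congr_fun (headK_mul_headR (N := N) (k := 0) hq.1) y
  have hi : ∀ t : Tens N 2, idTensor (braidSum N q 0) t = t := fun t =>
    slice_ext fun a => by rw [slice_idTensor]; rfl
  have hc : ∀ t : Tens N 2, idTensor (cupSum N q 0) t = 0 := fun t =>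
    slice_ext fun a => by rw [slice_idTensor]; rfl
  simp only [Module.End.mul_apply, LinearMap.smul_apply] at h1
  have hp : q ^ (-2 : ℤ) ≠ 0 := zpow_ne_zero _ hq.1
  rw [cupSum_succ_apply, hi, hc]
  simp only [map_add, map_smul, h1, smul_zero, add_zero, cupWeight]
  rw [nu_eq hq.1]
  generalize q ^ (-2 : ℤ) = p at hp
  match_scalars
  field_simp

/-- On relations, both parts of `b⁻_{1,k}` agree modulo relations with multiples of one tensor
`K₁₂ z`. -/
theorem exists_braidSum_cupSum (hq : Generic q) : ∀ (k : ℕ), ∀ x ∈ relSub N q (k + 2),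
    ∃ z, (consSub (relSub N q (k + 1))).mkQ (braidSum N q (k + 1) x) =
        (lam q * q ^ (-2 * (N : ℤ))) • (consSub (relSub N q (k + 1))).mkQ (headK N q k z) ∧
      (consSub (relSub N q (k + 1))).mkQ (cupSum N q (k + 1) x) =
        cupWeight N q (k + 1) • (consSub (relSub N q (k + 1))).mkQ (headK N q k z)
  | 0, x, hx => by
    obtain ⟨u, hu, -, ⟨y, rfl⟩, rfl⟩ := Submodule.mem_sup.1 hx
    have hu' : u = 0 := by
      change u ∈ consSub (⊥ : Submodule ℂ (Tens N 1)) at hu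
      rwa [consSub_bot, Submodule.mem_bot] at hu
    subst hu'
    have e := zero_add ((headR N q 0 + q ^ (-2 : ℤ) • (1 : Module.End ℂ (Tens N 2))) y)
    refine ⟨y, ?_, ?_⟩
    · rw [e]; exact braidSum_one_headR_add hq y
    · rw [e]; exact cupSum_one_headR_add hq y
  | k + 1, x, hx => by
    obtain ⟨u, hu, -, ⟨y, rfl⟩, rfl⟩ := Submodule.mem_sup.1 hx
    choose z hz1 hz2 using fun a => exists_braidSum_cupSum hq k (slice a u) (mem_consSub.1 hu a)
    -- The tensors K₁₂z_a found for the slices of u, reassembled as one tensor in the image of K₂₃.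
    set w : Tens N (k + 3) := idTensor (headK N q k) (∑ a, consTensor a (z a)) with hw
    have hw' : ∀ a, slice a w = headK N q k (z a) := fun a => by
      rw [hw, slice_idTensor]
      congr 1
      simp [map_sum, slice_consTensor]
    have hle := consSub_mono (consSub_relSub_le (N := N) (q := q) (k + 1))
    have e1 : (consSub (consSub (relSub N q (k + 1)))).mkQ (idTensor (braidSum N q (k + 1)) u) =
        (consSub (consSub (relSub N q (k + 1)))).mkQ ((lam q * q ^ (-2 * (N : ℤ))) • w) := by
      rw [mkQ_eq_iff]
      refine mem_consSub.2 fun a => ?_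
      rw [map_sub, map_smul, slice_idTensor, hw', ← mkQ_eq_iff, hz1, map_smul]
    have e2 : (consSub (consSub (relSub N q (k + 1)))).mkQ (idTensor (cupSum N q (k + 1)) u) =
        (consSub (consSub (relSub N q (k + 1)))).mkQ (cupWeight N q (k + 1) • w) := by
      rw [mkQ_eq_iff]
      refine mem_consSub.2 fun a => ?_
      rw [map_sub, map_smul, slice_idTensor, hw', ← mkQ_eq_iff, hz2, map_smul]
    have head : ∀ (M : Matrix (Fin N × Fin N) (Fin N × Fin N) ℂ) {s t : Tens N (k + 3)},
        (consSub (consSub (relSub N q (k + 1)))).mkQ s =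
          (consSub (consSub (relSub N q (k + 1)))).mkQ t →
        (consSub (relSub N q (k + 2))).mkQ (headTwo M (k + 1) s) =
          (consSub (relSub N q (k + 2))).mkQ (headTwo M (k + 1) t) := by
      intro M s t h
      refine mkQ_of_le hle ?_
      rw [mkQ_eq_iff, ← map_sub]
      exact headTwo_mem M (mkQ_eq_iff.1 h)
    have f1 : (consSub (relSub N q (k + 2))).mkQ
        (headR N q (k + 1) (idTensor (braidSum N q (k + 1)) u)) = _ := head (rMat N q) e1
    have f2 : (consSub (relSub N q (k + 2))).mkQ
        (headK N q (k + 1) (idTensor (braidSum N q (k + 1)) u)) = _ := head (kMat N q) e1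
    have f3 : (consSub (relSub N q (k + 2))).mkQ
        (headK N q (k + 1) (idTensor (cupSum N q (k + 1)) u)) = _ := head (kMat N q) e2
    have hu0 : (consSub (relSub N q (k + 2))).mkQ u = 0 := by
      rw [Submodule.mkQ_apply, Submodule.Quotient.mk_eq_zero]; exact hu
    -- As w lies in the image of K₂₃, R̂₂₃R̂₁₂w = K₁₂w, and the leading R̂₂₃ is -q⁻² modulo V ⊗ I.
    -- So R̂₁₂w is also a multiple of K₁₂w.
    have hRK : (consSub (relSub N q (k + 2))).mkQ (headR N q (k + 1) w) =
        -(q ^ (-2 : ℤ))⁻¹ • (consSub (relSub N q (k + 2))).mkQ (headK N q (k + 1) w) := by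
      have h := LinearMap.congr_fun (headR_headR_idTensor_headK (N := N) (k := k) hq.1)
        (∑ a, consTensor a (z a))
      simp only [Module.End.mul_apply, ← hw] at h
      rw [← h, mkQ_idTensor_headR, smul_smul, neg_mul_neg,
        inv_mul_cancel₀ (zpow_ne_zero _ hq.1), one_smul]
    change _ = (consSub (relSub N q (k + 2))).mkQ (headR N q (k + 1) _) at f1
    change _ = (consSub (relSub N q (k + 2))).mkQ (headK N q (k + 1) _) at f2 f3
    have hp : q ^ (-2 : ℤ) ≠ 0 := zpow_ne_zero _ hq.1
    have g1 : (consSub (relSub N q (k + 2))).mkQ (braidSum N q (k + 2) u) =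
        (lam q * q ^ (-2 * (N : ℤ))) • (consSub (relSub N q (k + 2))).mkQ
          (headK N q (k + 1) w) := by
      rw [braidSum_succ_apply, map_sub, map_smul, f1, map_smul, map_smul, hRK, hu0, zero_sub,
        smul_smul, smul_smul, ← neg_smul]
      congr 1
      generalize q ^ (-2 : ℤ) = p at hp
      field_simp
    have g2 : (consSub (relSub N q (k + 2))).mkQ (cupSum N q (k + 2) u) =
        cupWeight N q (k + 2) • (consSub (relSub N q (k + 2))).mkQ (headK N q (k + 1) w) := by
      rw [cupSum_succ_apply, map_smul, map_add, map_add, map_smul, map_smul, f2, f3, map_smul,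
        map_smul, map_smul, map_smul, smul_smul, smul_add, smul_smul, smul_smul, ← add_smul]
      congr 1
      rw [cupWeight, cupWeight, lam_eq]
      generalize q ^ (-2 : ℤ) = p at hp
      field_simp
      ring
    -- w accounts for the part u in V ⊗ I, and y for the part in the image of R̂₁₂ + q⁻².
    refine ⟨w + y, ?_, ?_⟩
    · have h := braidSum_headR_add hq y
      rw [map_add (braidSum N q (k + 2)), map_add, map_add, map_add, smul_add]
      exact congrArg₂ (· + ·) g1 h
    · have h := cupSum_headR_add hq y
      rw [map_add (cupSum N q (k + 2)), map_add, map_add, map_add, smul_add]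
      exact congrArg₂ (· + ·) g2 h

/-- This fixes the coefficient of the contracted part of b⁻: with it the two multiples of K₁₂z
cancel. -/
theorem cupCoeff_mul_cupWeight (hq : Generic q) (k : ℕ) :
    cupCoeff N q k * cupWeight N q k = lam q * q ^ (-2 * (N : ℤ)) := by
  have h := hq.one_add_zpow_ne_zero (2 * (N : ℤ) - 4 * (k : ℤ))
  have e1 : cupWeight N q k =
      q ^ (-2 * (N : ℤ)) * (1 + q ^ (2 * (N : ℤ) - 4 * (k : ℤ))) := by
    rw [cupWeight, mul_add, mul_one, ← zpow_add₀ hq.1, ← zpow_natCast, ← zpow_mul]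
    congr 2
    push_cast; ring
  have e2 : qPlus q * qMinus q = lam q := by
    rw [qPlus, qMinus, lam, zpow_neg, zpow_ofNat, ← inv_pow]; ring
  rw [cupCoeff, e1, e2]
  field_simp

/-- `b⁻_{1,k}` maps the relations in `V^{⊗(k+1)}` to `V` tensored with the relations. -/
theorem bMinus_mem (hq : Generic q) : ∀ (k : ℕ), ∀ x ∈ relSub N q (k + 1),
    bMinus N q k x ∈ consSub (relSub N q k)
  | 0, x, hx => by
    rw [(Submodule.mem_bot ℂ).1 hx, map_zero]; exact Submodule.zero_mem _
  | k + 1, x, hx => by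
    obtain ⟨z, h1, h2⟩ := exists_braidSum_cupSum hq k x hx
    rw [← Submodule.Quotient.mk_eq_zero, ← Submodule.mkQ_apply, bMinus_eq hq.1,
      LinearMap.sub_apply, LinearMap.smul_apply, map_sub, map_smul, h1, h2, smul_smul,
      cupCoeff_mul_cupWeight hq, sub_self]

theorem antisym_succ (k : ℕ) (t : Tens N (k + 1)) : antisym N q (k + 1) t =
    (1 / qNum q (k + 1)) • idTensor (antisym N q k) (bMinus N q k t) := rfl

theorem antisym_eq_zero (hq : Generic q) : ∀ (k : ℕ), ∀ x ∈ relSub N q k, antisym N q k x = 0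
  | 0, x, hx => by rw [(Submodule.mem_bot ℂ).1 hx, map_zero]
  | k + 1, x, hx => by
    have h := idTensor_mem (W' := ⊥) (A := antisym N q k)
      (fun t ht => (Submodule.mem_bot ℂ).2 (antisym_eq_zero hq k t ht)) (bMinus_mem hq k x hx)
    rw [consSub_bot, Submodule.mem_bot] at h
    rw [antisym_succ, h, smul_zero]

/-- The scalar [k+1] by which b⁻ acts modulo relations is cancelled by the normalization of A. -/
theorem mkQ_antisym (hq : Generic q) : ∀ (k : ℕ) (t : Tens N k),
    (relSub N q k).mkQ (antisym N q k t) = (relSub N q k).mkQ t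
  | 0, t => rfl
  | k + 1, t => by
    have h := mkQ_of_le (consSub_relSub_le (N := N) (q := q) k)
      (mkQ_consSub_of (A := antisym N q k) (B := (1 : ℂ) • 1)
        (fun s => by rw [mkQ_antisym hq k s, one_smul]; rfl) (bMinus N q k t))
    rw [antisym_succ, map_smul, h, idTensor_smul_one, one_smul, mkQ_bMinus hq, smul_smul,
      one_div_mul_cancel (hq.qNum_ne_zero k), one_smul]

/-- The kernel of the antisymmetrizer consists of the relations. -/
theorem ker_antisym (hq : Generic q) (k : ℕ) : LinearMap.ker (antisym N q k) = relSub N q k := by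
  refine le_antisymm (fun t ht => ?_) fun t ht => antisym_eq_zero hq k t ht
  have h := mkQ_antisym hq k t
  rw [LinearMap.mem_ker.1 ht, map_zero] at h
  exact (Submodule.Quotient.mk_eq_zero _).1 h.symm

end Descent

/-! ### Transposes, and the symmetry of the antisymmetrizers -/

section Transpose

variable {N : ℕ} {q : ℂ} {k : ℕ}

/-- The transpose of an operator on `V^{⊗k}`. -/
noncomputable def tr (A : Module.End ℂ (Tens N k)) : Module.End ℂ (Tens N k) :=
  Matrix.toLin' (LinearMap.toMatrix' A).transpose

theorem dotProduct_tr (A : Module.End ℂ (Tens N k)) (s t : Tens N k) :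
    s ⬝ᵥ tr A t = A s ⬝ᵥ t := by
  rw [tr, Matrix.toLin'_apply, Matrix.mulVec_transpose, dotProduct_comm, ← Matrix.dotProduct_mulVec,
    LinearMap.toMatrix'_mulVec, dotProduct_comm]

theorem tr_eq_of {A B : Module.End ℂ (Tens N k)} (h : ∀ s t, s ⬝ᵥ B t = A s ⬝ᵥ t) : tr A = B := by
  refine LinearMap.ext fun t => ?_
  refine dotProduct_eq _ _ fun s => ?_
  rw [dotProduct_comm, dotProduct_tr, ← h, dotProduct_comm]

theorem tr_tr (A : Module.End ℂ (Tens N k)) : tr (tr A) = A := by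
  simp [tr]

theorem tr_mul (A B : Module.End ℂ (Tens N k)) : tr (A * B) = tr B * tr A :=
  tr_eq_of fun s t => by
    rw [Module.End.mul_apply, Module.End.mul_apply, dotProduct_tr, dotProduct_tr]

theorem tr_add (A B : Module.End ℂ (Tens N k)) : tr (A + B) = tr A + tr B := by
  simp [tr]

theorem tr_sub (A B : Module.End ℂ (Tens N k)) : tr (A - B) = tr A - tr B := by
  simp [tr]

theorem tr_smul (r : ℂ) (A : Module.End ℂ (Tens N k)) : tr (r • A) = r • tr A := by
  simp [tr]

theorem tr_one : tr (1 : Module.End ℂ (Tens N k)) = 1 :=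
  tr_eq_of fun _ _ => rfl

theorem dotProduct_slice (s t : Tens N (k + 1)) : s ⬝ᵥ t = ∑ a, slice a s ⬝ᵥ slice a t := by
  simp only [dotProduct]
  rw [← (Fin.consEquiv fun _ : Fin (k + 1) => Fin N).sum_comp, Fintype.sum_prod_type]
  rfl

theorem tr_idTensor (A : Module.End ℂ (Tens N k)) : tr (idTensor A) = idTensor (tr A) :=
  tr_eq_of fun s t => by
    simp only [dotProduct_slice, slice_idTensor, dotProduct_tr]

theorem tr_headTwo (M : Matrix (Fin N × Fin N) (Fin N × Fin N) ℂ) :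
    tr (headTwo M k) = headTwo M.transpose k :=
  tr_eq_of fun s t => by
    simp only [dotProduct_slice, slice_headTwo, dotProduct_sum, sum_dotProduct, dotProduct_smul,
      smul_dotProduct, Matrix.transpose_apply]
    conv_lhs => enter [2, a]; rw [Finset.sum_comm]
    rw [Finset.sum_comm]
    refine Finset.sum_congr rfl fun x _ => ?_
    conv_lhs => enter [2, a]; rw [Finset.sum_comm]
    rw [Finset.sum_comm]

theorem tr_headR : tr (headR N q k) = headR N q k := by
  rw [headR, tr_headTwo, transpose_rMat]

theorem tr_headK : tr (headK N q k) = headK N q k := by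
  rw [headK, tr_headTwo, transpose_kMat]

theorem mkQ_idTensor_of {A : Module.End ℂ (Tens N k)} {r : ℂ}
    (h : ∀ t, (relSub N q k).mkQ (A t) = r • (relSub N q k).mkQ t) (t : Tens N (k + 1)) :
    (relSub N q (k + 1)).mkQ (idTensor A t) = r • (relSub N q (k + 1)).mkQ t := by
  rw [mkQ_of_le (consSub_relSub_le k) (mkQ_consSub_of (B := r • 1)
    (fun s => by rw [h, ← map_smul]; rfl) t), idTensor_smul_one, map_smul]

theorem mkQ_tr_braidSum (hq : Generic q) : ∀ (k : ℕ) (t : Tens N (k + 1)),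
    (relSub N q (k + 1)).mkQ (tr (braidSum N q k) t) = qNum q (k + 1) • (relSub N q (k + 1)).mkQ t
  | 0, t => by
    rw [← mkQ_braidSum hq, braidSum, tr_one]
  | k + 1, t => by
    rw [braidSum, tr_sub, tr_smul, tr_mul, tr_one, tr_headR, tr_idTensor, LinearMap.sub_apply,
      LinearMap.smul_apply, Module.End.mul_apply, Module.End.one_apply, map_sub, map_smul,
      mkQ_idTensor_of (mkQ_tr_braidSum hq k), mkQ_headR, qNum_succ hq (k + 1)]
    module

theorem mkQ_tr_cupSum (hq : Generic q) : ∀ (k : ℕ) (t : Tens N (k + 1)),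
    (relSub N q (k + 1)).mkQ (tr (cupSum N q k) t) = (0 : ℂ) • (relSub N q (k + 1)).mkQ t
  | 0, t => by simp [cupSum, tr]
  | k + 1, t => by
    rw [cupSum, tr_smul, tr_mul, tr_headK, tr_idTensor, tr_add, tr_smul,
      LinearMap.smul_apply, Module.End.mul_apply, idTensor_add_apply, idTensor_smul_apply, map_smul,
      map_add, map_smul, mkQ_idTensor_of (mkQ_tr_braidSum hq k),
      mkQ_idTensor_of (mkQ_tr_cupSum hq k), mkQ_headK hq]
    simp

theorem mkQ_tr_antisym (hq : Generic q) : ∀ (k : ℕ) (t : Tens N k),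
    (relSub N q k).mkQ (tr (antisym N q k) t) = (1 : ℂ) • (relSub N q k).mkQ t
  | 0, t => by rw [antisym, tr_one, one_smul]; rfl
  | k + 1, t => by
    rw [antisym, tr_smul, tr_mul, tr_idTensor, bMinus_eq hq.1, tr_sub, tr_smul,
      LinearMap.smul_apply, Module.End.mul_apply, LinearMap.sub_apply, LinearMap.smul_apply,
      map_smul, map_sub, map_smul, mkQ_tr_braidSum hq, mkQ_tr_cupSum hq,
      mkQ_idTensor_of (mkQ_tr_antisym hq k), one_smul, zero_smul, smul_zero, sub_zero, smul_smul,
      one_div_mul_cancel (hq.qNum_ne_zero k), one_smul]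

/-- The transpose Aᵗ is also the identity modulo relations, and A kills relations, so A Aᵗ = A. The
left side is symmetric. -/
theorem tr_antisym (hq : Generic q) (k : ℕ) : tr (antisym N q k) = antisym N q k := by
  have h : antisym N q k * tr (antisym N q k) = antisym N q k := by
    refine LinearMap.ext fun t => ?_
    rw [Module.End.mul_apply, ← sub_eq_zero, ← map_sub]
    refine antisym_eq_zero hq k _ (mkQ_eq_iff.1 ?_)
    rw [mkQ_tr_antisym hq, one_smul]
  have h' := congrArg tr h
  rw [tr_mul, tr_tr, h] at h'
  exact h'.symm

/-- The transpose of A(R̂₁₂ + q⁻²) = 0, using that A and R̂₁₂ are symmetric. -/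
theorem headR_antisym (hq : Generic q) (t : Tens N (k + 2)) :
    headR N q k (antisym N q (k + 2) t) = -q ^ (-2 : ℤ) • antisym N q (k + 2) t := by
  have h : antisym N q (k + 2) * headR N q k = -q ^ (-2 : ℤ) • antisym N q (k + 2) := by
    refine LinearMap.ext fun s => ?_
    have := antisym_eq_zero hq _ _ (headR_add_mem (q := q) s)
    rw [map_add, map_smul] at this
    rw [Module.End.mul_apply, LinearMap.smul_apply, neg_smul]
    exact eq_neg_of_add_eq_zero_left this
  have h' := congrArg tr h
  rw [tr_mul, tr_smul, tr_headR, tr_antisym hq] at h'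
  exact LinearMap.congr_fun h' t

theorem headK_antisym (hq : Generic q) (t : Tens N (k + 2)) :
    headK N q k (antisym N q (k + 2) t) = 0 := by
  have h : antisym N q (k + 2) * headK N q k = 0 :=
    LinearMap.ext fun s => antisym_eq_zero hq _ _ (headK_mem hq s)
  have h' := congrArg tr h
  rw [tr_mul, tr_headK, tr_antisym hq] at h'
  have := LinearMap.congr_fun h' t
  rwa [← zero_smul ℂ (0 : Module.End ℂ (Tens N (k + 2))), tr_smul, zero_smul] at this

end Transpose

/-! ### Contractions with the metric -/

section Contraction

variable {N : ℕ} {q : ℂ} {j k l : ℕ}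

/-- The map `id ⊗ f`. -/
noncomputable def consMap (f : Tens N k →ₗ[ℂ] Tens N l) : Tens N (k + 1) →ₗ[ℂ] Tens N (l + 1) :=
  ∑ a, consTensor a ∘ₗ f ∘ₗ slice a

theorem slice_consMap (f : Tens N k →ₗ[ℂ] Tens N l) (a : Fin N) (t : Tens N (k + 1)) :
    slice a (consMap f t) = f (slice a t) := by
  simp [consMap, map_sum, slice_consTensor]

theorem consMap_consTensor (f : Tens N k →ₗ[ℂ] Tens N l) (a : Fin N) (t : Tens N k) :
    consMap f (consTensor a t) = consTensor a (f t) := by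
  refine slice_ext fun b => ?_
  rw [slice_consMap, slice_consTensor, slice_consTensor]
  split_ifs <;> simp

theorem headTwo_consMap (M : Matrix (Fin N × Fin N) (Fin N × Fin N) ℂ)
    (f : Tens N k →ₗ[ℂ] Tens N l) (t : Tens N (k + 2)) :
    headTwo M l (consMap (consMap f) t) = consMap (consMap f) (headTwo M k t) := by
  refine slice_ext fun a => slice_ext fun b => ?_
  simp only [slice_headTwo, slice_consMap, map_sum, map_smul]

variable (N q k) in
/-- The contraction of the first two tensor factors with the metric. -/
noncomputable def cap : Tens N (k + 2) →ₗ[ℂ] Tens N k :=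
  ∑ a, ∑ b, metric N q a b • (slice b ∘ₗ slice a)

theorem cap_apply (t : Tens N (k + 2)) :
    cap N q k t = ∑ a, ∑ b, metric N q a b • slice b (slice a t) := by
  simp [cap, LinearMap.sum_apply]

variable (N q k) in
/-- The insertion `t ↦ ∑ C^{ab} γ_a ⊗ γ_b ⊗ t`. -/
noncomputable def cup : Tens N k →ₗ[ℂ] Tens N (k + 2) :=
  ∑ a, ∑ b, metric N q a b • (consTensor a ∘ₗ consTensor b)

theorem slice_cup (t : Tens N k) (a b : Fin N) :
    slice b (slice a (cup N q k t)) = metric N q a b • t := by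
  simp [cup, LinearMap.sum_apply, map_sum, slice_consTensor]

theorem slice_slice_consTensor (a b i : Fin N) (t : Tens N (k + 1)) :
    slice b (slice a (consTensor i t)) = if a = i then slice b t else 0 := by
  rw [slice_consTensor]
  split_ifs <;> simp

theorem cap_consTensor (i : Fin N) (t : Tens N (k + 1)) :
    cap N q k (consTensor i t) = ∑ b, metric N q i b • slice b t := by
  rw [cap_apply, Finset.sum_eq_single i]
  · simp [slice_slice_consTensor]
  · intro a _ ha
    simp [slice_slice_consTensor, ha]
  · simp

theorem headK_eq (t : Tens N (k + 2)) : headK N q k t = cup N q k (cap N q k t) := by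
  refine slice_ext fun a => slice_ext fun b => ?_
  rw [headK, slice_headTwo, slice_cup, cap_apply, Finset.smul_sum]
  refine Finset.sum_congr rfl fun x _ => ?_
  rw [Finset.smul_sum]
  exact Finset.sum_congr rfl fun y _ => by rw [smul_smul]; rfl

/-- Since K₁₂ is cap followed by cup, this turns identities for K₁₂ into identities for the cap
alone. -/
theorem cup_injective (hN : 0 < N) (hq : q ≠ 0) : Function.Injective (cup N q k) := by
  intro s t h
  have h' := congrArg (fun u => slice (Fin.rev ⟨0, hN⟩) (slice ⟨0, hN⟩ u)) h
  simp only [slice_cup] at h'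
  refine smul_right_injective _ ?_ h'
  rw [metric_rev]
  exact zpow_ne_zero _ hq

theorem cap_cup (t : Tens N k) : cap N q k (cup N q k t) = loop N q • t := by
  simp only [cap_apply, slice_cup, smul_smul, ← Finset.sum_smul, loop]

/-- A zigzag: the cap on factors 1, 2 straightens the cup of K₂₃ and leaves its cap. -/
theorem cap_idTensor_headK (hq : q ≠ 0) (t : Tens N (k + 3)) :
    cap N q (k + 1) (idTensor (headK N q k) t) = consMap (cap N q k) t := by
  refine slice_ext fun c => ?_
  rw [slice_consMap, cap_apply, map_sum]
  have h : ∀ a, slice c (∑ b, metric N q a b • slice b (slice a (idTensor (headK N q k) t))) =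
      (if a = c then (1 : ℂ) else 0) • cap N q k (slice a t) := by
    intro a
    rw [← sum_metric_mul_metric hq, map_sum, Finset.sum_smul]
    refine Finset.sum_congr rfl fun b _ => ?_
    rw [map_smul, slice_idTensor, headK_eq, slice_cup, smul_smul]
  simp only [h, ite_smul, one_smul, zero_smul]
  simp

/-- Crossing symmetry for the cap, obtained from K₁₂R̂₂₃ = K₁₂K₂₃R̂₁₂⁻¹ by stripping the cup. -/
theorem cap_idTensor_headR (hN : 0 < N) (hq : q ≠ 0) (t : Tens N (k + 3)) :
    cap N q (k + 1) (idTensor (headR N q k) t) =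
      consMap (cap N q k) (headRInv N q (k + 1) t) := by
  refine cup_injective hN hq ?_
  rw [← cap_idTensor_headK hq, ← headK_eq, ← headK_eq]
  have h := congrArg (fun M => headThree M k) (kMat_mul_rMat_right (N := N) hq)
  simp only [headThree_mul, headThree_headK, headThree_headR', headThree_headK',
    headThree_headRInv] at h
  exact LinearMap.congr_fun h t

theorem consMap_cap_cup (hq : q ≠ 0) (t : Tens N (k + 1)) :
    consMap (cap N q k) (cup N q (k + 1) t) = t := by
  refine slice_ext fun c => ?_
  have h : ∀ a b, slice b (slice a (slice c (cup N q (k + 1) t))) =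
      metric N q c a • slice b t := by
    intro a b
    rw [slice_cup, map_smul]
  have h' : ∀ b, ∑ a, metric N q a b • slice b (slice a (slice c (cup N q (k + 1) t))) =
      (if c = b then (1 : ℂ) else 0) • slice b t := by
    intro b
    rw [← sum_metric_mul_metric hq, Finset.sum_smul]
    exact Finset.sum_congr rfl fun a _ => by rw [h, smul_smul, mul_comm]
  rw [slice_consMap, cap_apply, Finset.sum_comm]
  simp only [h', ite_smul, one_smul, zero_smul]
  simp

theorem headR_cup (hq : q ≠ 0) (t : Tens N k) :
    headR N q k (cup N q k t) = nu N q • cup N q k t := by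
  refine slice_ext fun a => slice_ext fun b => ?_
  rw [headR, slice_headTwo]
  simp only [map_smul, slice_cup, smul_smul, ← Finset.sum_smul, sum_rMat_metric hq]

/-- The contraction of `b⁻_{2,k+2} y` for an eigenvector `y` of `R̂₁₂`, modulo relations. -/
theorem mkQ_cap_bMinus (hN : 0 < N) (hq : Generic q) (y' : Tens N (k + 3)) {η : ℂ} (hη : η ≠ 0)
    {y : Tens N (k + 3)} (hy : y = headR N q (k + 1) y' + q ^ (-2 : ℤ) • y')
    (hR : headR N q (k + 1) y = η • y) :
    (relSub N q (k + 1)).mkQ (cap N q (k + 1) (idTensor (bMinus N q (k + 1)) y)) =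
      (relSub N q (k + 1)).mkQ (cap N q (k + 1) y) -
        (q ^ (-2 : ℤ) * (η⁻¹ + cupCoeff N q (k + 1))) •
          (relSub N q (k + 1)).mkQ (consMap (cap N q k) (idTensor (idTensor (bMinus N q k)) y)) := by
  have hInv : ∀ z, headR N q (k + 1) z = η • z → headRInv N q (k + 1) z = η⁻¹ • z := by
    intro z hz
    have := LinearMap.congr_fun (headRInv_mul_headR (N := N) (k := k + 1) hq.1) z
    rw [Module.End.mul_apply, hz, map_smul] at this
    rw [← inv_smul_smul₀ hη (headRInv N q (k + 1) z), this]; rfl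
  -- The cup sum starts with K₃₄ if it is nonzero, and the cap on factors 2, 3 turns K₃₄ into a cap
  -- on 4, 5, or rather on the factors next to it, leaving an operator that does not touch the first
  -- two factors. It preserves the image of R̂₁₂ + q⁻², where y lies.
  have hU : (relSub N q (k + 1)).mkQ
      (consMap (cap N q k) (idTensor (idTensor (cupSum N q k)) y)) = 0 := by
    rw [Submodule.mkQ_apply, Submodule.Quotient.mk_eq_zero]
    cases k with
    | zero =>
      have : idTensor (idTensor (cupSum N q 0)) y = 0 :=
        slice_ext fun a => slice_ext fun b => by
          rw [slice_idTensor, slice_idTensor]; simp [cupSum]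
      rw [this, map_zero]
      exact Submodule.zero_mem _
    | succ k =>
      have : consMap (cap N q (k + 1)) (idTensor (idTensor (cupSum N q (k + 1))) y) =
          consMap (consMap (q ^ (-2 : ℤ) • (cap N q k ∘ₗ
            idTensor (braidSum N q k + q ^ (-2 : ℤ) • cupSum N q k)))) y := by
        refine slice_ext fun a => ?_
        have e : idTensor (cupSum N q (k + 1)) (slice a y) = q ^ (-2 : ℤ) •
            idTensor (headK N q k) (idTensor (idTensor
              (braidSum N q k + q ^ (-2 : ℤ) • cupSum N q k)) (slice a y)) := by
          rw [cupSum, idTensor_smul_apply, idTensor_mul_apply]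
        rw [slice_consMap, slice_idTensor, e, map_smul, cap_idTensor_headK hq.1, slice_consMap]
        refine slice_ext fun b => ?_
        rw [map_smul, slice_consMap, slice_consMap, slice_idTensor]
        rfl
      rw [this, hy, map_add, map_smul, headR, ← headTwo_consMap]
      exact headR_add_mem _
  have hS : ∀ t : Tens N (k + 1), braidSum N q k t =
      bMinus N q k t + cupCoeff N q k • cupSum N q k t := by
    intro t; rw [bMinus_eq hq.1]; simp
  have hS' : idTensor (idTensor (braidSum N q k)) y = idTensor (idTensor (bMinus N q k)) y +
      cupCoeff N q k • idTensor (idTensor (cupSum N q k)) y :=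
    slice_ext fun a => slice_ext fun b => by simp only [map_add, map_smul, slice_idTensor, hS]
  have e1 : idTensor (bMinus N q (k + 1)) y = y -
      q ^ (-2 : ℤ) • idTensor (headR N q k) (idTensor (idTensor (braidSum N q k)) y) -
      cupCoeff N q (k + 1) • idTensor (cupSum N q (k + 1)) y := by
    rw [← idTensor_braidSum_succ]
    exact slice_ext fun a => by
      rw [bMinus_eq hq.1]; simp only [map_sub, map_smul, slice_idTensor]; rfl
  -- R̂₁₂ commutes with operators from the third factor on, so the eigenvalue persists, and the
  -- R̂₁₂⁻¹ created by crossing becomes η⁻¹.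
  have e2 : headR N q (k + 1) (idTensor (idTensor (braidSum N q k)) y) =
      η • idTensor (idTensor (braidSum N q k)) y := by
    rw [headR_comm, hR, map_smul]
  rw [e1, idTensor_cupSum_succ]
  simp only [map_sub, map_smul, cap_idTensor_headR hN hq.1, hInv _ e2]
  simp only [map_smul, cap_idTensor_headK hq.1,
    map_add, hS', hU, smul_zero, add_zero]
  module

end Contraction

/-! ### The quadratic relations of the Clifford algebra -/

section Constants

variable {N : ℕ} {q : ℂ}

theorem qPlus_mul_qMinus (q : ℂ) : qPlus q * qMinus q = lam q := by
  rw [qPlus, qMinus, lam, zpow_neg, zpow_ofNat, ← inv_pow]; ring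

variable (N q) in
/-- The coefficient of the contraction in degree `m`. -/
noncomputable def contrCoeff (m : ℕ) : ℂ :=
  (1 + q ^ (2 * (N : ℤ) - 4)) / (1 + q ^ (2 * (N : ℤ) - 4 * (m : ℤ)))

variable (N q) in
/-- The coefficient of the metric in the bilinear form. -/
noncomputable def formCoeff (s : ℂ) : ℂ :=
  s * q ^ (2 * (N : ℤ) - 3) * qPlus q / (q ^ (2 * (N : ℤ) - 4) + 1)

theorem contrCoeff_one (hq : Generic q) : contrCoeff N q 1 = 1 := by
  rw [contrCoeff, Nat.cast_one, mul_one, div_self (hq.one_add_zpow_ne_zero _)]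

/-- The normalization of g is chosen so that contracting the metric tensor gives the scalar of the
Clifford relation. -/
theorem formCoeff_mul_loop (hq : Generic q) (s : ℂ) : formCoeff N q s * loop N q =
    s * ((q ^ (2 * N) - 1) / (q ^ 2 - 1)) := by
  have h1 := hq.one_add_zpow_ne_zero (2 * (N : ℤ) - 4)
  have h4 := hq.2 4 (by norm_num)
  have h2 := sub_ne_zero.2 (hq.2 2 (by norm_num))
  have hl := lam_ne_zero hq.1 h4
  have e := lam_mul_loop hq.1 N
  have h0 := hq.1
  refine mul_left_cancel₀ hl ?_
  rw [mul_left_comm, e, formCoeff, lam, qPlus]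
  have hA : q ^ (2 * N) = q ^ (2 * (N : ℤ)) := by rw [← zpow_natCast]; push_cast; rfl
  have hA0 : q ^ (2 * (N : ℤ)) ≠ 0 := zpow_ne_zero _ h0
  rw [zpow_sub₀ h0] at h1
  rw [hA, zpow_sub₀ h0, zpow_sub₀ h0, zpow_sub₀ h0, zpow_sub₀ h0, zpow_neg]
  generalize q ^ (2 * (N : ℤ)) = A at *
  have h1' : A / q ^ (4 : ℤ) + 1 ≠ 0 := by rwa [add_comm]
  simp only [zpow_ofNat] at *
  have h3 : A + q ^ 4 ≠ 0 := by
    intro h; apply h1'; field_simp; rw [mul_zero]; exact h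
  field_simp
  ring

/-- The condition that the degree 0 part of the P₊-relations vanish, where R̂ has eigenvalue η = q².
-/
theorem contrCoeff_eq (hq : Generic q) (m : ℕ) : contrCoeff N q (m + 1) =
    contrCoeff N q (m + 2) * (q ^ (-2 : ℤ) * (q ^ (-2 : ℤ) + cupCoeff N q (m + 1))) := by
  have h0 := hq.1
  have h1 := hq.one_add_zpow_ne_zero (2 * (N : ℤ) - 4 * ((m + 1 : ℕ) : ℤ))
  have h2 := hq.one_add_zpow_ne_zero (2 * (N : ℤ) - 4 * ((m + 2 : ℕ) : ℤ))
  have e : q ^ (2 * (N : ℤ) - 4 * ((m + 2 : ℕ) : ℤ)) =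
      q ^ (2 * (N : ℤ) - 4 * ((m + 1 : ℕ) : ℤ)) / q ^ 4 := by
    rw [← zpow_natCast q 4, ← zpow_sub₀ h0]; congr 1; push_cast; ring
  rw [contrCoeff, contrCoeff, cupCoeff, qPlus_mul_qMinus, lam]
  rw [e] at h2 ⊢
  generalize q ^ (2 * (N : ℤ) - 4 * ((m + 1 : ℕ) : ℤ)) = B at *
  generalize 1 + q ^ (2 * (N : ℤ) - 4) = A
  simp only [zpow_neg, zpow_ofNat]
  have h3 : q ^ 4 + B ≠ 0 := by
    intro h; apply h2; field_simp; rw [mul_zero]; exact h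
  field_simp
  ring

/-- The analogous condition for the metric relation, with η = ν: the scalar by which its degree 0
part acts does not depend on the degree. -/
theorem contrCoeff_loop (hq : Generic q) (m : ℕ) :
    contrCoeff N q (m + 2) * (loop N q -
      q ^ (-2 : ℤ) * ((nu N q)⁻¹ + cupCoeff N q (m + 1)) * qNum q (m + 1)) +
    contrCoeff N q (m + 1) * qNum q (m + 1) = loop N q := by
  have h0 := hq.1
  have h4 := hq.2 4 (by norm_num)
  have hl := lam_ne_zero hq.1 h4
  have hn := one_sub_mul_qNum hq (m + 1)
  have e := lam_mul_loop hq.1 N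
  have h2 := hq.one_add_zpow_ne_zero (2 * (N : ℤ) - 4 * ((m + 2 : ℕ) : ℤ))
  have e2 : q ^ (2 * (N : ℤ) - 4 * ((m + 2 : ℕ) : ℤ)) =
      q ^ (2 * (N : ℤ)) * (q ^ (-2 : ℤ)) ^ (2 * (m + 1)) / q ^ 4 := by
    rw [← zpow_natCast q 4, ← zpow_natCast (q ^ (-2 : ℤ)), ← zpow_mul, ← zpow_add₀ h0,
      ← zpow_sub₀ h0]
    congr 1; push_cast; ring
  have key : contrCoeff N q (m + 2) *
      (lam q * loop N q - (lam q * qNum q (m + 1)) * (q ^ (-2 : ℤ) * ((nu N q)⁻¹ - q ^ (-2 : ℤ)))) =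
      lam q * loop N q := by
    have hn' : lam q * qNum q (m + 1) = q ^ 2 * (1 - (q ^ (-2 : ℤ)) ^ (2 * (m + 1))) := by
      rw [← hn, lam]
      simp only [zpow_neg, zpow_ofNat]
      field_simp
    rw [hn', e, contrCoeff, e2, nu, lam]
    rw [e2] at h2
    rw [zpow_sub₀ h0, zpow_sub₀ h0, zpow_sub₀ h0]
    generalize (q ^ (-2 : ℤ)) ^ (2 * (m + 1)) = B at *
    have hA0 : q ^ (2 * (N : ℤ)) ≠ 0 := zpow_ne_zero _ h0
    generalize q ^ (2 * (N : ℤ)) = A at *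
    simp only [zpow_neg, zpow_ofNat]
    have h3 : q ^ 4 + A * B ≠ 0 := by
      intro h; apply h2; field_simp; rw [mul_zero]; exact h
    field_simp
    ring
  refine mul_left_cancel₀ hl ?_
  rw [contrCoeff_eq hq m, ← key]
  ring

end Constants

/-! ### P₊ as an eigenspace of R̂ -/

section Projector

variable {N : ℕ} {q : ℂ}

/-- The coefficient of K in P₊ is determined by comparing the K-terms in R̂ P₊ = q² P₊. -/
theorem projector_coeff (hq : Generic q) (hN : 0 < N) :
    qPlus q * qMinus q / (q ^ (2 * N) - 1) * (q ^ 2 - nu N q) = lam q * nu N q := by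
  have h := sub_ne_zero.2 (hq.2 (2 * N) (by omega))
  have h0 := hq.1
  have hA : q ^ (2 * N) = q ^ (2 * (N : ℤ)) := by rw [← zpow_natCast]; push_cast; rfl
  have hA0 : q ^ (2 * (N : ℤ)) ≠ 0 := zpow_ne_zero _ h0
  rw [qPlus_mul_qMinus, nu, zpow_sub₀ h0]
  rw [hA] at h ⊢
  generalize q ^ (2 * (N : ℤ)) = A at *
  simp only [zpow_ofNat]
  field_simp

theorem rMat_mul_pPlus (hq : Generic q) (hN : 0 < N) :
    rMat N q * pPlus N q = q ^ 2 • pPlus N q := by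
  have h0 := hq.1
  have e := projector_coeff hq hN
  have el : q ^ (-2 : ℤ) + lam q = q ^ 2 := by rw [lam]; ring
  have ep : q ^ 2 * q ^ (-2 : ℤ) = 1 := by
    rw [zpow_neg, zpow_ofNat]; exact mul_inv_cancel₀ (pow_ne_zero _ h0)
  rw [pPlus, mul_smul_comm, smul_comm]
  congr 1
  rw [mul_sub, mul_add, mul_smul_comm, mul_smul_comm, mul_one, rMat_mul_rMat h0,
    rMat_mul_kMat h0]
  generalize qPlus q * qMinus q / (q ^ (2 * N) - 1) = μ at *
  simp only [smul_sub, smul_add, smul_smul, ep, one_smul]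
  rw [← el] at e ⊢
  have : (lam q * nu N q + μ * nu N q) = (q ^ (-2 : ℤ) + lam q) * μ := by linear_combination -e
  rw [← this]
  module

/-- Evaluating K R̂ P₊ in two ways gives (q² - ν) K P₊ = 0. Here q² = ν is excluded, since
`projector_coeff` would make (q² - q⁻²)ν vanish. -/
theorem kMat_mul_pPlus (hq : Generic q) (hN : 0 < N) : kMat N q * pPlus N q = 0 := by
  have h0 := hq.1
  have h := congrArg (kMat N q * ·) (rMat_mul_pPlus hq hN)
  simp only [← mul_assoc, kMat_mul_rMat h0, smul_mul_assoc, mul_smul_comm] at h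
  have h2 : q ^ 2 - nu N q ≠ 0 := by
    intro h
    have := projector_coeff hq hN
    rw [h, mul_zero] at this
    exact mul_ne_zero (lam_ne_zero h0 (hq.2 4 (by norm_num))) (zpow_ne_zero _ h0) this.symm
  have h3 : (q ^ 2 - nu N q) • (kMat N q * pPlus N q) = 0 := by
    rw [sub_smul, h, sub_self]
  exact (smul_eq_zero.1 h3).resolve_left h2

end Projector

/-! ### Contractions of the exterior powers -/

section Contract

variable {N : ℕ} {q s : ℂ} {k : ℕ}

variable (q s) in
/-- The contraction `⟨γ_i, ·⟩` in positive degree. -/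
noncomputable def contractSucc (i : Fin N) (m : ℕ) : Tens N (m + 1) →ₗ[ℂ] Tens N m :=
  contract N q s i (m + 1)

theorem contractSucc_apply (i : Fin N) (m : ℕ) (t : Tens N (m + 1)) :
    contractSucc q s i m t =
      formCoeff N q s • ∑ b, metric N q i b • slice b (bMinus N q m t) := by
  funext L
  simp only [contractSucc, contract, LinearMap.comp_apply, gFirst, LinearMap.coe_mk, AddHom.coe_mk, slice,
    Pi.smul_apply, Finset.sum_apply, smul_eq_mul, Finset.mul_sum, gForm, formCoeff]
  exact Finset.sum_congr rfl fun b _ => by ring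

theorem contractSucc_eq_cap (i : Fin N) (m : ℕ) (t : Tens N (m + 1)) :
    contractSucc q s i m t = formCoeff N q s • cap N q m (idTensor (bMinus N q m) (consTensor i t)) := by
  rw [contractSucc_apply, idTensor_consTensor, cap_consTensor]

/-- Contracting the first factor commutes with id ⊗ A_m, and (id ⊗ A_m) b⁻ is [m+1] A_{m+1}. So
after antisymmetrization ⟨γ_i, t⟩ depends only on A_{m+1}t, which is why contractions descend. -/
theorem antisym_contractSucc (hq : Generic q) (i : Fin N) (m : ℕ) (t : Tens N (m + 1)) :
    antisym N q m (contractSucc q s i m t) = (formCoeff N q s * qNum q (m + 1)) •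
      ∑ b, metric N q i b • slice b (antisym N q (m + 1) t) := by
  rw [contractSucc_apply, antisym_succ]
  simp only [map_smul, map_sum, slice_idTensor, smul_comm (metric N q _ _) (1 / qNum q (m + 1))]
  rw [← Finset.smul_sum, smul_smul, mul_assoc, mul_one_div_cancel (hq.qNum_ne_zero m), mul_one]

theorem contract_mem (hq : Generic q) (i : Fin N) : ∀ (m : ℕ) (t : Tens N m),
    t ∈ relSub N q m → contract N q s i m t ∈ relSub N q (m - 1)
  | 0, t, _ => Submodule.zero_mem _
  | m + 1, t, ht => by
    rw [← ker_antisym hq, LinearMap.mem_ker] at ht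
    change contractSucc q s i m t ∈ relSub N q m
    rw [← ker_antisym hq, LinearMap.mem_ker, antisym_contractSucc hq, ht]
    simp

variable (r : Fin N → Fin N → ℂ)

/-- The tensor `∑ r_{kl} γ_k ⊗ γ_l ⊗ t`. -/
noncomputable def relTensor (t : Tens N k) : Tens N (k + 2) :=
  ∑ a, ∑ b, r a b • consTensor a (consTensor b t)

theorem cup_eq_relTensor (t : Tens N k) : cup N q k t = relTensor (metric N q) t := by
  simp [cup, relTensor, LinearMap.sum_apply]

theorem slice_relTensor (t : Tens N k) (a b : Fin N) :
    slice b (slice a (relTensor r t)) = r a b • t := by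
  simp [relTensor, map_sum, slice_consTensor]

theorem headTwo_consTensor (M : Matrix (Fin N × Fin N) (Fin N × Fin N) ℂ) (i j : Fin N)
    (t : Tens N k) : headTwo M k (consTensor i (consTensor j t)) =
      relTensor (fun a b => M (a, b) (i, j)) t := by
  refine slice_ext fun a => slice_ext fun b => ?_
  rw [slice_headTwo, slice_relTensor, Finset.sum_eq_single i, Finset.sum_eq_single j]
  · simp [slice_consTensor]
  · intro y _ hy; simp [slice_consTensor, hy]
  · simp
  · intro x _ hx; simp [slice_consTensor, hx]
  · simp

theorem sum_contract_consTensor (m : ℕ) (t : Tens N m) :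
    ∑ a, ∑ b, r a b • contractSucc q s a m (consTensor b t) =
      formCoeff N q s • cap N q m (idTensor (bMinus N q m) (relTensor r t)) := by
  simp only [contractSucc_eq_cap, relTensor, map_sum, map_smul, Finset.smul_sum]
  exact Finset.sum_congr rfl fun a _ => Finset.sum_congr rfl fun b _ => smul_comm _ _ _

theorem sum_consTensor_contract (m : ℕ) (t : Tens N (m + 1)) :
    ∑ a, ∑ b, r a b • consTensor a (contractSucc q s b m t) =
      formCoeff N q s • consMap (cap N q m) (idTensor (idTensor (bMinus N q m))
        (relTensor r t)) := by
  simp only [contractSucc_eq_cap, relTensor, map_sum, map_smul, Finset.smul_sum, idTensor_consTensor,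
    consMap_consTensor]
  exact Finset.sum_congr rfl fun a _ => Finset.sum_congr rfl fun b _ => smul_comm _ _ _

/-- The degree 0 part of a quadratic expression: contraction after wedge puts b⁻ from the second
factor under a cap, wedge after contraction puts it from the third. `mkQ_cap_bMinus` expresses the
former by the latter. -/
theorem mkQ_sum_contract (hN : 0 < N) (hq : Generic q) {η : ℂ} (hη : η ≠ 0) (t : Tens N (k + 1))
    {y' : Tens N (k + 3)} (hy : relTensor r t = headR N q (k + 1) y' + q ^ (-2 : ℤ) • y')
    (hR : headR N q (k + 1) (relTensor r t) = η • relTensor r t) :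
    (relSub N q (k + 1)).mkQ (contrCoeff N q (k + 2) •
        ∑ a, ∑ b, r a b • contractSucc q s a (k + 1) (consTensor b t) +
      contrCoeff N q (k + 1) • ∑ a, ∑ b, r a b • consTensor a (contractSucc q s b k t)) =
    formCoeff N q s • (contrCoeff N q (k + 2) •
        (relSub N q (k + 1)).mkQ (cap N q (k + 1) (relTensor r t)) +
      (contrCoeff N q (k + 1) - contrCoeff N q (k + 2) *
          (q ^ (-2 : ℤ) * (η⁻¹ + cupCoeff N q (k + 1)))) •
        (relSub N q (k + 1)).mkQ (consMap (cap N q k)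
          (idTensor (idTensor (bMinus N q k)) (relTensor r t)))) := by
  have h := mkQ_cap_bMinus hN hq y' hη hy hR
  have h1 := sum_contract_consTensor (q := q) (s := s) r (k + 1) t
  have h2 := sum_consTensor_contract (q := q) (s := s) r k t
  rw [h1, h2, map_add, map_smul, map_smul, map_smul, map_smul, h]
  module

theorem cap_antisym (hN : 0 < N) (hq : Generic q) (t : Tens N (k + 2)) :
    cap N q k (antisym N q (k + 2) t) = 0 := by
  refine cup_injective hN hq.1 ?_
  rw [← headK_eq, headK_antisym hq, map_zero]

theorem antisym_contractSucc_contractSucc (hq : Generic q) (t : Tens N (k + 2)) (a b : Fin N) :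
    antisym N q k (contractSucc q s a k (contractSucc q s b (k + 1) t)) =
      (formCoeff N q s * qNum q (k + 1) * (formCoeff N q s * qNum q (k + 2))) •
        ∑ x, ∑ y, (metric N q a x * metric N q b y) •
          slice x (slice y (antisym N q (k + 2) t)) := by
  rw [antisym_contractSucc hq, antisym_contractSucc hq, mul_smul]
  simp only [map_smul, map_sum, Finset.smul_sum, smul_smul]
  refine Finset.sum_congr rfl fun x _ => Finset.sum_congr rfl fun y _ => ?_
  congr 1; ring

/-- Membership in I_k is tested by A_k, which replaces both contractions by metric contractions of A
t. -/
theorem sum_contract_contract_mem (hq : Generic q) (t : Tens N (k + 2))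
    (h : ∑ x, ∑ y, (∑ a, ∑ b, r a b * (metric N q a x * metric N q b y)) •
      slice x (slice y (antisym N q (k + 2) t)) = 0) :
    ∑ a, ∑ b, r a b • contractSucc q s a k (contractSucc q s b (k + 1) t) ∈ relSub N q k := by
  rw [← ker_antisym hq, LinearMap.mem_ker]
  simp only [map_sum, map_smul]
  simp only [antisym_contractSucc_contractSucc hq, smul_comm (r _ _)]
  simp only [← Finset.smul_sum]
  rw [← smul_zero (formCoeff N q s * qNum q (k + 1) * (formCoeff N q s * qNum q (k + 2))), ← h]
  congr 1
  simp only [Finset.sum_smul, Finset.smul_sum, smul_smul]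
  conv_lhs => enter [2, a]; rw [Finset.sum_comm]
  rw [Finset.sum_comm]
  refine Finset.sum_congr rfl fun x _ => ?_
  conv_lhs => enter [2, a]; rw [Finset.sum_comm]
  rw [Finset.sum_comm]

end Contract

/-! ### The Clifford relations in each degree -/

section Relations

variable {N : ℕ} {q s : ℂ} {k : ℕ}

theorem headR_relTensor_pPlus (hq : Generic q) (hN : 0 < N) (i j : Fin N) (t : Tens N k) :
    headR N q k (relTensor (fun a b => pPlus N q (a, b) (i, j)) t) =
      q ^ 2 • relTensor (fun a b => pPlus N q (a, b) (i, j)) t := by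
  rw [← headTwo_consTensor, headR, ← Module.End.mul_apply, ← headTwo_mul, rMat_mul_pPlus hq hN,
    headTwo_smul]
  rfl

theorem cap_relTensor_pPlus (hq : Generic q) (hN : 0 < N) (i j : Fin N) (t : Tens N k) :
    cap N q k (relTensor (fun a b => pPlus N q (a, b) (i, j)) t) = 0 := by
  refine cup_injective hN hq.1 ?_
  rw [← headTwo_consTensor, ← headK_eq, headK, ← Module.End.mul_apply, ← headTwo_mul,
    kMat_mul_pPlus hq hN, map_zero, ← zero_smul ℂ (0 : Matrix _ _ ℂ), headTwo_smul]
  simp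

theorem exists_headR_add {η : ℂ} (hη : η + q ^ (-2 : ℤ) ≠ 0) {y : Tens N (k + 2)}
    (hy : headR N q k y = η • y) : ∃ y', y = headR N q k y' + q ^ (-2 : ℤ) • y' := by
  refine ⟨(η + q ^ (-2 : ℤ))⁻¹ • y, ?_⟩
  rw [map_smul, hy, smul_comm (q ^ (-2 : ℤ)), ← smul_add, ← add_smul, smul_smul,
    inv_mul_cancel₀ hη, one_smul]

theorem Generic.sq_add_ne_zero (hq : Generic q) : q ^ 2 + q ^ (-2 : ℤ) ≠ 0 := by
  have h := mul_ne_zero (zpow_ne_zero (-2) hq.1) (hq.one_add_zpow_ne_zero 4)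
  rw [mul_add, mul_one, ← zpow_add₀ hq.1, add_comm] at h
  exact h

theorem mem_relSub_of_headR {η : ℂ} (hη : η + q ^ (-2 : ℤ) ≠ 0) {y : Tens N (k + 2)}
    (hy : headR N q k y = η • y) : y ∈ relSub N q (k + 2) := by
  obtain ⟨y', h⟩ := exists_headR_add hη hy
  rw [h]
  exact headR_add_mem y'

theorem relTensor_pPlus_mem (hq : Generic q) (hN : 0 < N) (i j : Fin N) (t : Tens N k) :
    relTensor (fun a b => pPlus N q (a, b) (i, j)) t ∈ relSub N q (k + 2) :=
  mem_relSub_of_headR hq.sq_add_ne_zero (headR_relTensor_pPlus hq hN i j t)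

theorem relTensor_metric_mem (hq : Generic q) (t : Tens N k) :
    relTensor (metric N q) t ∈ relSub N q (k + 2) := by
  rw [← cup_eq_relTensor]
  exact mem_relSub_of_headR hq.nu_add_ne_zero (headR_cup hq.1 t)

theorem mkQ_sum_contract_pPlus (hN : 0 < N) (hq : Generic q) (i j : Fin N) (t : Tens N (k + 1)) :
    (relSub N q (k + 1)).mkQ (contrCoeff N q (k + 2) •
        ∑ a, ∑ b, pPlus N q (a, b) (i, j) • contractSucc q s a (k + 1) (consTensor b t) +
      contrCoeff N q (k + 1) •
        ∑ a, ∑ b, pPlus N q (a, b) (i, j) • consTensor a (contractSucc q s b k t)) = 0 := by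
  have hR := headR_relTensor_pPlus (k := k + 1) hq hN i j t
  obtain ⟨y', h⟩ := exists_headR_add hq.sq_add_ne_zero hR
  have e : (q ^ 2)⁻¹ = q ^ (-2 : ℤ) := by rw [zpow_neg, zpow_ofNat]
  have := mkQ_sum_contract (s := s) _ hN hq (pow_ne_zero 2 hq.1) t h hR
  rw [this, cap_relTensor_pPlus hq hN, contrCoeff_eq hq k, e, sub_self]
  simp

theorem consMap_cap_bMinus_cup (hq : q ≠ 0) (t : Tens N (k + 1)) :
    consMap (cap N q k) (idTensor (idTensor (bMinus N q k)) (cup N q (k + 1) t)) =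
      bMinus N q k t := by
  have e : idTensor (idTensor (bMinus N q k)) (cup N q (k + 1) t) =
      cup N q (k + 1) (bMinus N q k t) :=
    slice_ext fun a => slice_ext fun b => by
      rw [slice_idTensor, slice_idTensor, slice_cup, slice_cup, map_smul]
  rw [e, consMap_cap_cup hq]

theorem mkQ_sum_contract_metric (hN : 0 < N) (hq : Generic q) (t : Tens N (k + 1)) :
    (relSub N q (k + 1)).mkQ (contrCoeff N q (k + 2) •
        ∑ a, ∑ b, metric N q a b • contractSucc q s a (k + 1) (consTensor b t) +
      contrCoeff N q (k + 1) • ∑ a, ∑ b, metric N q a b • consTensor a (contractSucc q s b k t)) =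
    (s * ((q ^ (2 * N) - 1) / (q ^ 2 - 1))) • (relSub N q (k + 1)).mkQ t := by
  have hR := headR_cup hq.1 (k := k + 1) t
  rw [cup_eq_relTensor] at hR
  obtain ⟨y', h⟩ := exists_headR_add hq.nu_add_ne_zero hR
  have := mkQ_sum_contract (s := s) _ hN hq (η := nu N q) (zpow_ne_zero _ hq.1) t h hR
  rw [this, ← cup_eq_relTensor, cap_cup, consMap_cap_bMinus_cup hq.1, mkQ_bMinus hq, map_smul,
    ← formCoeff_mul_loop hq, mul_smul]
  have e := congrArg (fun r => formCoeff N q s • r • (relSub N q (k + 1)).mkQ t)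
    (contrCoeff_loop (N := N) hq k)
  refine Eq.trans ?_ e
  module

theorem sum_contract_zero (r : Fin N → Fin N → ℂ) (t : Tens N 0) :
    ∑ a, ∑ b, r a b • contractSucc q s a 0 (consTensor b t) =
      formCoeff N q s • cap N q 0 (relTensor r t) := by
  have e : idTensor (bMinus N q 0) (relTensor r t) = relTensor r t :=
    slice_ext fun a => by rw [slice_idTensor]; simp [bMinus]
  rw [sum_contract_consTensor, e]

theorem sum_metric_metric (hq : q ≠ 0) (x y : Fin N) :
    ∑ a, ∑ b, metric N q a b * (metric N q a x * metric N q b y) = metric N q y x := by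
  have h : ∀ a, ∑ b, metric N q a b * (metric N q a x * metric N q b y) =
      metric N q a x * if a = y then 1 else 0 := by
    intro a
    rw [← sum_metric_mul_metric hq, Finset.mul_sum]
    exact Finset.sum_congr rfl fun b _ => by ring
  simp [h]

/-- Two crossings, R̂ to R̂⁻¹ and back to R̂, amount to a half turn of R̂. It brings the doubly
contracted R̂ into a form that acts on the first two factors of A t. -/
theorem sum_rMat_metric_metric (hq : q ≠ 0) (i j x y : Fin N) :
    ∑ a, ∑ b, rMat N q (a, b) (i, j) * (metric N q a x * metric N q b y) =
      metric N q i i.rev * metric N q j j.rev * rMat N q (j.rev, i.rev) (y, x) := by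
  rw [Finset.sum_eq_single x.rev, Finset.sum_eq_single y.rev]
  -- The crossings leave metric factors at the wrong indices. As χ(a)χ(a') = 1, weight preservation
  -- trades those at x', y' for those at i, j.
  · set χ : Fin N → ℂ := fun a => metric N q a a.rev * metric N q a a.rev with hχ
    have hχ' : ∀ a, χ a * χ a.rev = 1 := by
      intro a
      have := metric_rev_mul hq a
      simp only [hχ, Fin.rev_rev]
      linear_combination (metric N q a a.rev * metric N q a.rev a + 1) * this
    have h1 := rMat_mul_weight (q := q) χ hχ' x.rev y.rev i j
    have h2 := metric_mul_rMat hq y.rev x i j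
    have h3 := metric_mul_rInv hq j.rev y x i
    have hx := metric_rev_mul hq x
    have hy := metric_rev_mul hq y
    have hi := metric_rev_mul hq i
    have hj := metric_rev_mul hq j
    simp only [hχ, Fin.rev_rev] at h1
    generalize metric N q x x.rev = cx at *
    generalize metric N q x.rev x = cx' at *
    generalize metric N q y y.rev = cy at *
    generalize metric N q y.rev y = cy' at *
    generalize metric N q i i.rev = ci at *
    generalize metric N q i.rev i = ci' at *
    generalize metric N q j j.rev = cj at *
    generalize metric N q j.rev j = cj' at *
    generalize rMat N q (x.rev, y.rev) (i, j) = R at *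
    generalize rMat N q (j.rev, i.rev) (y, x) = R' at *
    generalize rInv N q (y.rev, j.rev) (x, i) = S at *
    have e : cx * cy * R = R' * (ci' * cj') := by linear_combination cy * h2 + cj' * h3
    calc R * (cx' * cy') = R * (cx' * cy') * ((cx * cx') * (cy * cy')) := by
          rw [hx, hy, mul_one, mul_one]
      _ = R * (cx' * cx' * (cy' * cy')) * (cx * cy) := by ring
      _ = ci * ci * (cj * cj) * (cx * cy * R) := by rw [h1]; ring
      _ = ci * cj * R' * ((ci * ci') * (cj * cj')) := by rw [e]; ring
      _ = ci * cj * R' := by rw [hi, hj, mul_one, mul_one]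
  · intro b _ hb; rw [metric_of_ne (i := b) (by rintro rfl; simp at hb)]; ring
  · simp
  · intro a _ ha; simp [metric_of_ne (i := a) (j := x) (by rintro rfl; simp at ha)]
  · simp

theorem sum_contract_contract_metric (hN : 0 < N) (hq : Generic q) (t : Tens N (k + 2)) :
    ∑ a, ∑ b, metric N q a b • contractSucc q s a k (contractSucc q s b (k + 1) t) ∈
      relSub N q k := by
  refine sum_contract_contract_mem _ hq t ?_
  simp only [sum_metric_metric hq.1]
  rw [Finset.sum_comm, ← cap_apply, cap_antisym hN hq]

/-- After the half turn, q⁻² + R̂ - μK is applied to A t, up to metric factors. There R̂₁₂ is -q⁻²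
and K₁₂ is 0. -/
theorem sum_contract_contract_pPlus (hN : 0 < N) (hq : Generic q) (i j : Fin N)
    (t : Tens N (k + 2)) :
    ∑ a, ∑ b, pPlus N q (a, b) (i, j) •
      contractSucc q s a k (contractSucc q s b (k + 1) t) ∈ relSub N q k := by
  refine sum_contract_contract_mem _ hq t ?_
  set τ := antisym N q (k + 2) t with hτ
  have hK : ∑ x, ∑ y, metric N q y x • slice x (slice y τ) = 0 := by
    rw [Finset.sum_comm, ← cap_apply, hτ, cap_antisym hN hq]
  have hR : ∑ x, ∑ y, rMat N q (j.rev, i.rev) (y, x) • slice x (slice y τ) =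
      -q ^ (-2 : ℤ) • slice i.rev (slice j.rev τ) := by
    rw [Finset.sum_comm, ← slice_headTwo, ← map_smul, ← map_smul, hτ, ← headR_antisym hq]; rfl
  have h1 : ∑ x, ∑ y, (metric N q i x * metric N q j y) • slice x (slice y τ) =
      (metric N q i i.rev * metric N q j j.rev) • slice i.rev (slice j.rev τ) := by
    rw [Finset.sum_eq_single i.rev, Finset.sum_eq_single j.rev]
    · intro b _ hb; rw [metric_of_ne hb]; simp
    · simp
    · intro b _ hb; simp [metric_of_ne hb]
    · simp
  have e : ∀ x y, ∑ a, ∑ b, pPlus N q (a, b) (i, j) * (metric N q a x * metric N q b y) =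
      (1 / (q ^ 2 + q ^ (-2 : ℤ))) * (q ^ (-2 : ℤ) * (metric N q i x * metric N q j y) +
        metric N q i i.rev * metric N q j j.rev * rMat N q (j.rev, i.rev) (y, x) -
        (qPlus q * qMinus q / (q ^ (2 * N) - 1) * metric N q i j) * metric N q y x) := by
    intro x y
    have h1 : metric N q i x * metric N q j y = ∑ a, ∑ b, (if (a, b) = (i, j) then 1 else 0) *
        (metric N q a x * metric N q b y) := by
      rw [Finset.sum_eq_single i, Finset.sum_eq_single j]
      · simp
      · intro b _ hb; simp [hb]
      · simp
      · intro a _ ha; simp [ha]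
      · simp
    rw [h1, ← sum_rMat_metric_metric hq.1, ← sum_metric_metric hq.1 x y]
    simp only [Finset.mul_sum, ← Finset.sum_add_distrib, ← Finset.sum_sub_distrib]
    refine Finset.sum_congr rfl fun a _ => Finset.sum_congr rfl fun b _ => ?_
    simp only [pPlus, Matrix.smul_apply, Matrix.sub_apply, Matrix.add_apply, Matrix.one_apply,
      smul_eq_mul, kMat_apply]
    ring
  simp only [e, mul_smul, sub_smul, add_smul, ← Finset.smul_sum, Finset.sum_add_distrib,
    Finset.sum_sub_distrib]
  simp only [mul_smul, ← Finset.smul_sum] at h1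
  rw [h1, hR, hK]
  module

end Relations

/-! ### The representation on the sum of the exterior powers -/

section Representation

variable {N : ℕ} {q s : ℂ}

variable (N q) in
/-- The direct sum of the exterior powers. -/
abbrev ExtSum : Type := DirectSum ℕ fun m => ExtPow N q m

/-- The class of a tensor in the direct sum of the exterior powers. -/
noncomputable def cls (q : ℂ) (m : ℕ) : Tens N m →ₗ[ℂ] ExtSum N q :=
  DirectSum.lof ℂ ℕ (fun m => ExtPow N q m) m ∘ₗ (LinearMap.ker (antisym N q m)).mkQ

theorem cls_apply (m : ℕ) (t : Tens N m) :
    cls q m t = DirectSum.lof ℂ ℕ (fun m => ExtPow N q m) m (Submodule.Quotient.mk t) := rfl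

theorem cls_eq (hq : Generic q) {m : ℕ} {t t' : Tens N m}
    (h : (relSub N q m).mkQ t = (relSub N q m).mkQ t') : cls q m t = cls q m t' := by
  rw [cls_apply, cls_apply]
  congr 1
  rw [Submodule.Quotient.eq, ker_antisym hq]
  exact mkQ_eq_iff.1 h

theorem cls_eq_zero (hq : Generic q) {m : ℕ} {t : Tens N m} (h : t ∈ relSub N q m) :
    cls q m t = 0 := by
  rw [← map_zero (cls q m)]
  exact cls_eq hq (mkQ_eq_iff.2 (by rwa [sub_zero]))

theorem ExtSum.hom_ext {M : Type*} [AddCommMonoid M] [Module ℂ M] {f g : ExtSum N q →ₗ[ℂ] M}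
    (h : ∀ m t, f (cls q m t) = g (cls q m t)) : f = g := by
  refine DirectSum.linearMap_ext _ fun m => LinearMap.ext fun x => ?_
  obtain ⟨t, rfl⟩ := Submodule.Quotient.mk_surjective _ x
  exact h m t

/-- The map `t ↦ γ_i ∧ t` of exterior powers. -/
noncomputable def wedgeMap (hq : Generic q) (i : Fin N) (m : ℕ) :
    ExtPow N q m →ₗ[ℂ] ExtPow N q (m + 1) :=
  Submodule.mapQ _ _ (consTensor i) fun t ht => by
    rw [ker_antisym hq] at ht
    rw [Submodule.mem_comap, ker_antisym hq]
    exact consSub_relSub_le m (consTensor_mem ht i)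

variable (s) in
/-- The contraction of exterior powers. -/
noncomputable def contractMap (hq : Generic q) (i : Fin N) (m : ℕ) :
    ExtPow N q m →ₗ[ℂ] ExtPow N q (m - 1) :=
  Submodule.mapQ _ _ (contract N q s i m) fun t ht => by
    rw [ker_antisym hq] at ht
    rw [Submodule.mem_comap, ker_antisym hq]
    exact contract_mem hq i m t ht

variable (s) in
/-- The operator by which the generator `γ_i` acts. -/
noncomputable def genAct (hq : Generic q) (i : Fin N) : Module.End ℂ (ExtSum N q) :=
  DirectSum.toModule ℂ ℕ _ fun m =>
    DirectSum.lof ℂ ℕ (fun m => ExtPow N q m) (m + 1) ∘ₗ wedgeMap hq i m +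
      contrCoeff N q m • DirectSum.lof ℂ ℕ (fun m => ExtPow N q m) (m - 1) ∘ₗ contractMap s hq i m

theorem genAct_cls (hq : Generic q) (i : Fin N) (m : ℕ) (t : Tens N m) :
    genAct s hq i (cls q m t) = cls q (m + 1) (consTensor i t) +
      contrCoeff N q m • cls q (m - 1) (contract N q s i m t) := by
  rw [cls_apply, genAct, DirectSum.toModule_lof]
  rfl

theorem genAct_cls_zero (hq : Generic q) (i : Fin N) (t : Tens N 0) :
    genAct s hq i (cls q 0 t) = cls q 1 (consTensor i t) := by
  rw [genAct_cls, contract, LinearMap.zero_apply, map_zero, smul_zero, add_zero]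

theorem genAct_cls_succ (hq : Generic q) (i : Fin N) (m : ℕ) (t : Tens N (m + 1)) :
    genAct s hq i (cls q (m + 1) t) = cls q (m + 2) (consTensor i t) +
      contrCoeff N q (m + 1) • cls q m (contractSucc q s i m t) :=
  genAct_cls hq i (m + 1) t

variable (r : Fin N → Fin N → ℂ)

theorem sum_genAct_cls_zero (hq : Generic q) (t : Tens N 0) :
    ∑ a, ∑ b, r a b • genAct s hq a (genAct s hq b (cls q 0 t)) =
      cls q 2 (relTensor r t) + contrCoeff N q 1 •
        cls q 0 (∑ a, ∑ b, r a b • contractSucc q s a 0 (consTensor b t)) := by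
  simp only [genAct_cls_zero, genAct_cls_succ, relTensor, map_sum, map_smul, smul_add,
    Finset.sum_add_distrib, Finset.smul_sum, smul_comm (r _ _) (contrCoeff N q _)]

theorem sum_genAct_cls_one (hq : Generic q) (t : Tens N 1) :
    ∑ a, ∑ b, r a b • genAct s hq a (genAct s hq b (cls q 1 t)) =
      cls q 3 (relTensor r t) + cls q 1 (contrCoeff N q 2 •
        ∑ a, ∑ b, r a b • contractSucc q s a 1 (consTensor b t) +
        contrCoeff N q 1 • ∑ a, ∑ b, r a b • consTensor a (contractSucc q s b 0 t)) := by
  simp only [genAct_cls_zero, genAct_cls_succ, relTensor, map_sum, map_smul, map_add, smul_add,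
    Finset.sum_add_distrib, Finset.smul_sum, smul_comm (r _ _) (contrCoeff N q _), add_assoc]

/-- The three homogeneous components, of degrees +2, 0 and -2. Degrees 0 and 1 are separate because
the contractions stop there. -/
theorem sum_genAct_cls_add_two (hq : Generic q) (m : ℕ) (t : Tens N (m + 2)) :
    ∑ a, ∑ b, r a b • genAct s hq a (genAct s hq b (cls q (m + 2) t)) =
      cls q (m + 4) (relTensor r t) + (cls q (m + 2) (contrCoeff N q (m + 3) •
        ∑ a, ∑ b, r a b • contractSucc q s a (m + 2) (consTensor b t) +
        contrCoeff N q (m + 2) • ∑ a, ∑ b, r a b • consTensor a (contractSucc q s b (m + 1) t)) +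
      (contrCoeff N q (m + 2) * contrCoeff N q (m + 1)) •
        cls q m (∑ a, ∑ b, r a b • contractSucc q s a m (contractSucc q s b (m + 1) t))) := by
  simp only [genAct_cls_succ, relTensor, map_sum, map_smul, map_add, smul_add, mul_smul,
    Finset.sum_add_distrib, Finset.smul_sum, smul_comm (r _ _) (contrCoeff N q _), add_assoc]

theorem sum_genAct_pPlus (hN : 0 < N) (hq : Generic q) (i j : Fin N) :
    ∑ a, ∑ b, pPlus N q (a, b) (i, j) • (genAct s hq a * genAct s hq b) = 0 := by
  refine ExtSum.hom_ext fun m t => ?_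
  simp only [LinearMap.sum_apply, LinearMap.smul_apply, Module.End.mul_apply, LinearMap.zero_apply]
  match m, t with
  | 0, t =>
    rw [sum_genAct_cls_zero, cls_eq_zero hq (relTensor_pPlus_mem hq hN i j t), sum_contract_zero,
      cap_relTensor_pPlus hq hN]
    simp
  | 1, t =>
    rw [sum_genAct_cls_one, cls_eq_zero hq (relTensor_pPlus_mem hq hN i j t), cls_eq_zero hq
      ((Submodule.Quotient.mk_eq_zero _).1 (mkQ_sum_contract_pPlus hN hq i j t)), add_zero]
  | m + 2, t =>
    rw [sum_genAct_cls_add_two, cls_eq_zero hq (relTensor_pPlus_mem hq hN i j t), cls_eq_zero hq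
      ((Submodule.Quotient.mk_eq_zero _).1 (mkQ_sum_contract_pPlus hN hq i j t)),
      cls_eq_zero hq (sum_contract_contract_pPlus hN hq i j t), smul_zero, add_zero, add_zero]

theorem sum_genAct_metric (hN : 0 < N) (hq : Generic q) :
    ∑ a, ∑ b, metric N q a b • (genAct s hq a * genAct s hq b) =
      (s * ((q ^ (2 * N) - 1) / (q ^ 2 - 1))) • 1 := by
  refine ExtSum.hom_ext fun m t => ?_
  simp only [LinearMap.sum_apply, LinearMap.smul_apply, Module.End.mul_apply, Module.End.one_apply]
  match m, t with
  | 0, t =>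
    rw [sum_genAct_cls_zero, cls_eq_zero hq (relTensor_metric_mem hq t), sum_contract_zero,
      ← cup_eq_relTensor, cap_cup, contrCoeff_one hq, one_smul, zero_add, smul_smul,
      formCoeff_mul_loop hq, map_smul]
  | 1, t =>
    have h := mkQ_sum_contract_metric (s := s) hN hq t
    rw [← map_smul] at h
    rw [sum_genAct_cls_one, cls_eq_zero hq (relTensor_metric_mem hq t), cls_eq hq h, zero_add,
      map_smul]
  | m + 2, t =>
    have h := mkQ_sum_contract_metric (s := s) hN hq t
    rw [← map_smul] at h
    rw [sum_genAct_cls_add_two, cls_eq_zero hq (relTensor_metric_mem hq t), cls_eq hq h,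
      cls_eq_zero hq (sum_contract_contract_metric hN hq t), zero_add, smul_zero, add_zero,
      map_smul]

variable (s) in
/-- The representation of the Clifford algebra on the sum of the exterior powers. -/
noncomputable def extSumAct (hN : 0 < N) (hq : Generic q) :
    Cl N q s →ₐ[ℂ] Module.End ℂ (ExtSum N q) :=
  RingQuot.liftAlgHom ℂ ⟨FreeAlgebra.lift ℂ (genAct s hq), fun x y h => by
    cases h with
    | plus i j =>
      simp only [map_sum, map_smul, map_mul, FreeAlgebra.lift_ι_apply, map_zero]
      exact sum_genAct_pPlus hN hq i j
    | form =>
      rw [AlgHom.commutes, Algebra.algebraMap_eq_smul_one, ← sum_genAct_metric hN hq]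
      simp only [map_sum, map_smul, map_mul, FreeAlgebra.lift_ι_apply]⟩

theorem extSumAct_gen (hN : 0 < N) (hq : Generic q) (i : Fin N) :
    extSumAct s hN hq (gen N q s i) = genAct s hq i := by
  rw [extSumAct, gen, RingQuot.liftAlgHom_mkAlgHom_apply, FreeAlgebra.lift_ι_apply]

end Representation

/-! ### The exterior algebra as the sum of the exterior powers -/

section Exterior

variable {N : ℕ} {q s : ℂ}

theorem sum_gen_pPlus (i j : Fin N) :
    ∑ a, ∑ b, pPlus N q (a, b) (i, j) • (gen N q s a * gen N q s b) = 0 := by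
  have h := RingQuot.mkAlgHom_rel ℂ (ClRel.plus (N := N) (q := q) (s := s) i j)
  simp only [map_sum, map_smul, map_mul, map_zero] at h
  exact h

theorem sum_gen_metric :
    ∑ a, ∑ b, metric N q a b • (gen N q s a * gen N q s b) =
      algebraMap ℂ _ (s * ((q ^ (2 * N) - 1) / (q ^ 2 - 1))) := by
  have h := RingQuot.mkAlgHom_rel ℂ (ClRel.form (N := N) (q := q) (s := s))
  rw [AlgHom.commutes] at h
  simp only [map_sum, map_smul, map_mul (RingQuot.mkAlgHom ℂ (ClRel N q s))] at h
  exact h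

theorem toExt_consTensor (m : ℕ) (i : Fin N) (t : Tens N m) :
    toExt N q (m + 1) (consTensor i t) = gen N q 0 i * toExt N q m t := by
  rw [toExt, toExt, Fintype.linearCombination_apply, Fintype.linearCombination_apply,
    ← (Fin.consEquiv fun _ : Fin (m + 1) => Fin N).sum_comp, Fintype.sum_prod_type,
    Finset.sum_eq_single i, Finset.mul_sum]
  · refine Finset.sum_congr rfl fun J _ => ?_
    simp [consTensor, Fin.consEquiv, List.ofFn_succ]
  · intro j _ hj
    refine Finset.sum_eq_zero fun J _ => ?_
    simp [consTensor, Fin.consEquiv, hj]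
  · simp

theorem toExt_zero (t : Tens N 0) : toExt N q 0 t = algebraMap ℂ _ (t default) := by
  rw [toExt, Fintype.linearCombination_apply, Algebra.algebraMap_eq_smul_one]
  simp

/-- R̂ + q⁻² is a combination of P₊ and K, and for c = 0 both give zero on products of generators.
Hence I_m maps to zero in Λ. -/
theorem sum_gen_rMat_add (hq : Generic q) (i j : Fin N) :
    ∑ a, ∑ b, (rMat N q + q ^ (-2 : ℤ) • (1 : Matrix (Fin N × Fin N) (Fin N × Fin N) ℂ))
      (a, b) (i, j) • (gen N q 0 a * gen N q 0 b) = 0 := by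
  have h1 := sum_gen_pPlus (N := N) (q := q) (s := 0) i j
  have h2 := sum_gen_metric (N := N) (q := q) (s := 0)
  rw [zero_mul, map_zero] at h2
  have e : rMat N q + q ^ (-2 : ℤ) • (1 : Matrix (Fin N × Fin N) (Fin N × Fin N) ℂ) =
      (q ^ 2 + q ^ (-2 : ℤ)) • pPlus N q +
        (qPlus q * qMinus q / (q ^ (2 * N) - 1)) • kMat N q := by
    rw [pPlus, smul_smul, mul_one_div_cancel hq.sq_add_ne_zero, one_smul]
    abel
  have e' : ∀ a b, (rMat N q + q ^ (-2 : ℤ) • (1 : Matrix (Fin N × Fin N) (Fin N × Fin N) ℂ))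
      (a, b) (i, j) • (gen N q 0 a * gen N q 0 b) =
      (q ^ 2 + q ^ (-2 : ℤ)) • pPlus N q (a, b) (i, j) • (gen N q 0 a * gen N q 0 b) +
      (qPlus q * qMinus q / (q ^ (2 * N) - 1) * metric N q i j) •
        metric N q a b • (gen N q 0 a * gen N q 0 b) := by
    intro a b
    rw [e, Matrix.add_apply, Matrix.smul_apply, Matrix.smul_apply, kMat_apply]
    simp only [smul_eq_mul]
    module
  simp only [e', Finset.sum_add_distrib, ← Finset.smul_sum, h1, h2, smul_zero, add_zero]

theorem toExt_headTwo (m : ℕ) (M : Matrix (Fin N × Fin N) (Fin N × Fin N) ℂ)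
    (h : ∀ i j, ∑ a, ∑ b, M (a, b) (i, j) • (gen N q 0 a * gen N q 0 b) = 0)
    (t : Tens N (m + 2)) : toExt N q (m + 2) (headTwo M m t) = 0 := by
  have e : t = ∑ i, ∑ j, consTensor i (consTensor j (slice j (slice i t))) := by
    conv_lhs => rw [← sum_consTensor_slice t]
    refine Finset.sum_congr rfl fun i _ => ?_
    conv_lhs => rw [← sum_consTensor_slice (slice i t), map_sum]
  rw [e]
  simp only [map_sum, headTwo_consTensor]
  refine Finset.sum_eq_zero fun i _ => Finset.sum_eq_zero fun j _ => ?_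
  have h' := h i j
  simp only [← smul_mul_assoc] at h'
  simp only [relTensor, map_sum, map_smul, toExt_consTensor]
  simp only [← mul_assoc, ← smul_mul_assoc, ← Finset.sum_mul, h', zero_mul]

theorem toExt_relSub (hq : Generic q) : ∀ (m : ℕ), ∀ t ∈ relSub N q m, toExt N q m t = 0
  | 0, t, ht => by rw [(Submodule.mem_bot ℂ).1 ht, map_zero]
  | 1, t, ht => by rw [(Submodule.mem_bot ℂ).1 ht, map_zero]
  | m + 2, t, ht => by
    obtain ⟨u, hu, -, ⟨y, rfl⟩, rfl⟩ := Submodule.mem_sup.1 ht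
    have h1 : toExt N q (m + 2) u = 0 := by
      rw [← sum_consTensor_slice u, map_sum]
      refine Finset.sum_eq_zero fun a _ => ?_
      rw [toExt_consTensor, toExt_relSub hq (m + 1) _ (mem_consSub.1 hu a), mul_zero]
    rw [map_add, h1, zero_add, headR, ← headTwo_one, ← headTwo_smul, ← headTwo_add]
    exact toExt_headTwo m _ (sum_gen_rMat_add hq) y

/-- The canonical map from an exterior power to the exterior algebra. -/
noncomputable def extPowMap (hq : Generic q) (m : ℕ) : ExtPow N q m →ₗ[ℂ] Ext N q :=
  Submodule.liftQ _ (toExt N q m) fun t ht =>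
    toExt_relSub hq m t (by rwa [← ker_antisym hq])

/-- The canonical map from the sum of the exterior powers to the exterior algebra. -/
noncomputable def extSumMap (hq : Generic q) : ExtSum N q →ₗ[ℂ] Ext N q :=
  DirectSum.toModule ℂ ℕ _ fun m => extPowMap hq m

theorem extSumMap_lof (hq : Generic q) (m : ℕ) (x : ExtPow N q m) :
    extSumMap hq (DirectSum.lof ℂ ℕ (fun m => ExtPow N q m) m x) = extPowMap hq m x := by
  rw [extSumMap, DirectSum.toModule_lof]

theorem extSumMap_cls (hq : Generic q) (m : ℕ) (t : Tens N m) :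
    extSumMap hq (cls q m t) = toExt N q m t := by
  rw [cls_apply, extSumMap_lof]; rfl

theorem formCoeff_zero : formCoeff N q 0 = 0 := by simp [formCoeff]

theorem genAct_zero_cls (hq : Generic q) (i : Fin N) : ∀ (m : ℕ) (t : Tens N m),
    genAct 0 hq i (cls q m t) = cls q (m + 1) (consTensor i t)
  | 0, t => genAct_cls_zero hq i t
  | m + 1, t => by
    rw [genAct_cls_succ, contractSucc_apply, formCoeff_zero, zero_smul, map_zero, smul_zero,
      add_zero]

variable (N q) in
/-- The unit of the exterior algebra as a tensor of degree zero. -/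
def unitTensor : Tens N 0 := fun _ => 1

/-- The inverse of the canonical map: the action of the exterior algebra on the unit. -/
noncomputable def extSumInv (hN : 0 < N) (hq : Generic q) : Ext N q →ₗ[ℂ] ExtSum N q :=
  LinearMap.applyₗ (cls q 0 (unitTensor N)) ∘ₗ (extSumAct 0 hN hq).toLinearMap

/-- For c = 0 the contractions vanish and γ_i acts by the wedge alone, so acting on the unit
rebuilds the tensor factor by factor. -/
theorem extSumInv_toExt (hN : 0 < N) (hq : Generic q) : ∀ (m : ℕ) (t : Tens N m),
    extSumInv hN hq (toExt N q m t) = cls q m t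
  | 0, t => by
    rw [toExt_zero]
    change extSumAct 0 hN hq (algebraMap ℂ _ (t default)) (cls q 0 (unitTensor N)) = _
    rw [AlgHom.commutes, Module.algebraMap_end_apply, ← map_smul]
    congr 1
    funext J
    rw [Subsingleton.elim J default]
    simp [unitTensor]
  | m + 1, t => by
    conv_lhs => rw [← sum_consTensor_slice t, map_sum, map_sum]
    conv_rhs => rw [← sum_consTensor_slice t, map_sum]
    refine Finset.sum_congr rfl fun a _ => ?_
    rw [toExt_consTensor]
    change extSumAct 0 hN hq (gen N q 0 a * toExt N q m (slice a t)) (cls q 0 (unitTensor N)) = _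
    rw [map_mul, Module.End.mul_apply, extSumAct_gen]
    have h : extSumAct 0 hN hq (toExt N q m (slice a t)) (cls q 0 (unitTensor N)) = _ :=
      extSumInv_toExt hN hq m (slice a t)
    rw [h, genAct_zero_cls]

theorem gen_mul_extSumMap (hq : Generic q) (i : Fin N) (x : ExtSum N q) :
    gen N q 0 i * extSumMap hq x = extSumMap hq (genAct 0 hq i x) := by
  have : LinearMap.mulLeft ℂ (gen N q 0 i) ∘ₗ extSumMap hq = extSumMap hq ∘ₗ genAct 0 hq i :=
    ExtSum.hom_ext fun m t => by
      simp only [LinearMap.comp_apply, LinearMap.mulLeft_apply]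
      rw [genAct_zero_cls, extSumMap_cls, extSumMap_cls, toExt_consTensor]
  exact LinearMap.congr_fun this x

/-- The range is a left ideal. As it also contains 1, the canonical map is surjective. -/
theorem mul_extSumMap_mem (hq : Generic q) (z : FreeAlgebra ℂ (Fin N)) :
    ∀ w ∈ LinearMap.range (extSumMap (N := N) hq),
      RingQuot.mkAlgHom ℂ (ClRel N q 0) z * w ∈ LinearMap.range (extSumMap (N := N) hq) := by
  induction z using FreeAlgebra.induction with
  | grade0 r =>
    intro w hw
    rw [AlgHom.commutes, ← Algebra.smul_def]
    exact Submodule.smul_mem _ _ hw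
  | grade1 i =>
    rintro _ ⟨x, rfl⟩
    exact ⟨_, (gen_mul_extSumMap hq i x).symm⟩
  | mul a b ha hb =>
    intro w hw
    rw [map_mul, mul_assoc]
    exact ha _ (hb _ hw)
  | add a b ha hb =>
    intro w hw
    rw [map_add, add_mul]
    exact Submodule.add_mem _ (ha _ hw) (hb _ hw)

theorem extSumMap_surjective (hq : Generic q) :
    Function.Surjective (extSumMap (N := N) hq) := by
  intro y
  obtain ⟨z, rfl⟩ := RingQuot.mkAlgHom_surjective ℂ (ClRel N q 0) y
  have h := mul_extSumMap_mem hq z 1 ⟨cls q 0 (unitTensor N), by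
    rw [extSumMap_cls, toExt_zero]; exact map_one _⟩
  rwa [mul_one] at h

theorem extSumInv_extSumMap (hN : 0 < N) (hq : Generic q) (x : ExtSum N q) :
    extSumInv hN hq (extSumMap hq x) = x := by
  have : extSumInv hN hq ∘ₗ extSumMap hq = LinearMap.id :=
    ExtSum.hom_ext fun m t => by
      rw [LinearMap.comp_apply, extSumMap_cls, extSumInv_toExt]; rfl
  exact LinearMap.congr_fun this x

/-- The exterior algebra is the direct sum of the exterior powers. -/
noncomputable def extSumEquiv (hN : 0 < N) (hq : Generic q) : ExtSum N q ≃ₗ[ℂ] Ext N q :=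
  LinearEquiv.ofBijective (extSumMap hq)
    ⟨Function.LeftInverse.injective (extSumInv_extSumMap hN hq), extSumMap_surjective hq⟩

theorem extPowMap_injective (hN : 0 < N) (hq : Generic q) (m : ℕ) :
    Function.Injective (extPowMap (N := N) hq m) := by
  intro x y h
  rw [← extSumMap_lof, ← extSumMap_lof] at h
  exact DirectSum.of_injective m ((extSumEquiv hN hq).injective h)

end Exterior

end FRT

theorem theorem1 (N : ℕ) (hN : 3 ≤ N) (q : ℂ) (hq0 : q ≠ 0)
    (hq : ∀ m : ℕ, 0 < m → q ^ m ≠ 1) (c2 : ℝ) (hc2 : c2 ≠ 0) :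
    ∃ (emb : (m : ℕ) → FRT.ExtPow N q m →ₗ[ℂ] FRT.Ext N q)
      (ctr : Fin N → (m : ℕ) → FRT.ExtPow N q m →ₗ[ℂ] FRT.ExtPow N q (m - 1))
      (act : FRT.Cl N q (c2 : ℂ) →ₐ[ℂ] Module.End ℂ (FRT.Ext N q)),
      (∀ (m : ℕ) (t : FRT.Tens N m), emb m (Submodule.Quotient.mk t) = FRT.toExt N q m t) ∧
      (∀ m : ℕ, Function.Injective (emb m)) ∧
      (∀ (i : Fin N) (m : ℕ) (t : FRT.Tens N m),
        ctr i m (Submodule.Quotient.mk t) =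
          Submodule.Quotient.mk (FRT.contract N q (c2 : ℂ) i m t)) ∧
      ∀ (i : Fin N) (m : ℕ) (x : FRT.ExtPow N q m),
        act (FRT.gen N q (c2 : ℂ) i) (emb m x) =
          FRT.gen N q 0 i * emb m x +
            ((1 + q ^ (2 * (N : ℤ) - 4)) / (1 + q ^ (2 * (N : ℤ) - 4 * (m : ℤ)))) •
              emb (m - 1) (ctr i m x) := by
  have hN0 : 0 < N := by omega
  have hg : FRT.Generic q := ⟨hq0, hq⟩
  refine ⟨FRT.extPowMap hg, fun i m => FRT.contractMap c2 hg i m,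
    -- The action on ⨁ V^{∧m} is transported to Λ by conjugation with the canonical isomorphism,
    -- which turns the wedge maps into left multiplication.
    ((FRT.extSumEquiv hN0 hg).conjAlgEquiv ℂ).toAlgHom.comp (FRT.extSumAct c2 hN0 hg),
    fun _ _ => rfl, FRT.extPowMap_injective hN0 hg, fun _ _ _ => rfl, fun i m x => ?_⟩
  obtain ⟨t, rfl⟩ := Submodule.Quotient.mk_surjective _ x
  have e : FRT.extPowMap hg m (Submodule.Quotient.mk t) =
      FRT.extSumEquiv hN0 hg (FRT.cls q m t) := (FRT.extSumMap_cls hg m t).symm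
  have h : (FRT.extSumEquiv hN0 hg) (FRT.extSumAct c2 hN0 hg (FRT.gen N q c2 i)
      ((FRT.extSumEquiv hN0 hg).symm (FRT.extSumEquiv hN0 hg (FRT.cls q m t)))) =
      FRT.gen N q 0 i * FRT.extSumEquiv hN0 hg (FRT.cls q m t) + FRT.contrCoeff N q m •
        FRT.extPowMap hg (m - 1) (FRT.contractMap c2 hg i m (Submodule.Quotient.mk t)) := by
    rw [LinearEquiv.symm_apply_apply, FRT.extSumAct_gen, FRT.genAct_cls, map_add, map_smul]
    congr 1
    · have := FRT.gen_mul_extSumMap hg i (FRT.cls q m t)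
      rw [FRT.genAct_zero_cls] at this
      exact this.symm
    · congr 1
      exact FRT.extSumMap_cls hg (m - 1) _
  rw [e]
  exact h
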